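/- **Setting.** Let $\Delta\subset\mathbb R^n$ be a regular lattice polytope: a nonempty compact convex polytope with vertices in $\mathbb Z^n$, such that from each vertex exactly $n$ edges emanate and these lie along lines generated by a $\mathbb Z$-basis of $\mathbb Z^n$. Write $$\Delta=\bigcap_{i=1}^d\{x:\langle u_i,x\rangle+\mu_i\ge 0\}$$ with $d$ minimal (so $d$ is the number of facets) and primitive inward normals $u_i\in(\mathbb Z^n)^*$, and for $h\in\mathbb R^d$ put $\Delta(h)=\bigcap_{i=1}^d\{x:\langle u_i,x\rangle+\mu_i+h_i\ge0\}$. Let $$\sum_{\Delta\cap\mathbb Z^n}{}' f=\sum_{x\in\Delta\cap\mathbb Z^n}\mathbf 1^w_\Delta(x)f(x),$$ where $\mathbf 1^w_\Delta=2^{-c}$ on the relative interior of each face of codimension $c$. Let $b_j$ be the Bernoulli numbers, $$\mathbf L^{2k}(S)=\sum_{j=0}^{k}\frac{b_{2j}}{(2j)!}S^{2j}$$ (the truncation at $S^{2k}$ of $\frac{S/2}{\tanh(S/2)}$), and $P_m(x)=B_m(x-\lfloor x\rfloor)/m!$ with $B_m$ the $m$-th Bernoulli polynomial. A *polarizing vector*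 is a $\xi\in(\mathbb R^n)^*$ that does not vanish on any edge direction. For a vertex $v$ let $\alpha_{1,v},\dots,\alpha_{n,v}\in\mathbb Z^n$ be the primitive vectors along the edges emanating from $v$; put $\alpha^\sharp_{i,v}=-\alpha_{i,v}$ if $\langle\xi,\alpha_{i,v}\rangle>0$ and $\alpha^\sharp_{i,v}=\alpha_{i,v}$ otherwise, let $\#v$ be the number of flipped vectors, and let $\mathbf C_v^\sharp=v+\sum_i\mathbb R_{\ge0}\,\alpha^\sharp_{i,v}$. For a $C^{mn}$ function $g$ of compact support on $\mathbb R^n$ and $k=\lfloor m/2\rfloor$, let $$R^{\rm st}_m(g)=\sum_{I\subsetneq\{1,\dots,n\}}(-1)^{(m-1)(n-|I|)}\prod_{i\in I}\mathbf L^{2k}\Big(\frac{\partial}{\partial h_i}\Big)\int_{\{t_i\pm h_i\ge0\ \forall i\}}\prod_{i\notin I}P_m(t_i)\prod_{i\notin I}\Big(\frac{\partial}{\partial t_i}\Big)^{m}g(t)\,dt\,\Big|_{h=0}$$ for any choice of the signs $\pm$, and define $$S^m_\Delta(f)=\sum_v(-1)^{\#v}R^{\rm st}_m(g_v),\qquad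 g_v(t)=f\Big(v+\sum_i t_i\alpha^\sharp_{i,v}\Big),$$ the sum being over the vertices $v$ of $\Delta$. **Theorem 4.1.** Let $m\ge1$ be an integer, $k=\lfloor m/2\rfloor$, let $\Delta\subset\mathbb R^n$ be a regular lattice polytope and $\xi$ a polarizing vector for $\Delta$. Then for every (real- or complex-valued) $C^{mn}$ function $f$ of compact support on $\mathbb R^n$ $$\sum_{\Delta\cap\mathbb Z^n}{}' f=\prod_{i=1}^d\mathbf L^{2k}\Big(\frac{\partial}{\partial h_i}\Big)\int_{\Delta(h)}f(x)\,dx\,\Big|_{h=0}+S^m_\Delta(f),$$ where all the partial derivatives with respect to $h$ in this formula and in the definition of $S^m_\Delta(f)$ exist and are continuous near $h=0$. Moreover: 1. $S^m_\Delta(f)$ is a sum of integrals over orthants of bounded periodic functions times partial derivatives of $f$ of orders between $m$ and $mn$: there are bounded measurable $\mathbb Z^n$-periodic functions $\varphi_{v,a}:\mathbb R^n\to\mathbb R$, not depending on $f$, such that for all such $f$ $$S^m_\Delta(f)=\sum_v\ \sum_{m\le|a|\le mn}\ \int_{\mathbf C_v^\sharp}\varphi_{v,a}(x)\,\partial^a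 f(x)\,dx .$$ 2. $S^m_\Delta(f)$ does not depend on the choice of the polarizing vector $\xi$ (nor on the signs $\pm$). 3. $f\mapsto S^m_\Delta(f)$ is a distribution, continuous on $C^{mn}_c(\mathbb R^n)$, and is supported on $\Delta$: it vanishes on every $f$ whose support is disjoint from $\Delta$. -/

import Mathlib

open MeasureTheory

noncomputable section

namespace EulerMaclaurin

/-! ### Polytopes in `ℝⁿ = Fin n → ℝ` (with Lebesgue measure `volume`) -/

/-- The point of `ℝⁿ` given by an integer vector. -/
def intVec {n : ℕ} (z : Fin n → ℤ) : Fin n → ℝ := fun i => (z i : ℝ)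

/-- `z` is primitive: not a multiple of a lattice element by an integer greater than one.
In particular the zero vector is not primitive. -/
def IsPrimitive {n : ℕ} (z : Fin n → ℤ) : Prop :=
  ∀ (c : ℤ) (w : Fin n → ℤ), 1 < c → z ≠ c • w

/-- A nonempty compact convex polytope: the convex hull of a finite set of points. -/
def IsPolytope {n : ℕ} (Δ : Set (Fin n → ℝ)) : Prop :=
  ∃ S : Set (Fin n → ℝ), S.Finite ∧ S.Nonempty ∧ Δ = convexHull ℝ S

/-- `F` is a nonempty face of `Δ` (`Δ` itself included). -/
def IsFace {n : ℕ} (Δ F : Set (Fin n → ℝ)) : Prop :=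
  F.Nonempty ∧ IsExposed ℝ Δ F

/-- The dimension of (the affine span of) `F`. -/
def faceDim {n : ℕ} (F : Set (Fin n → ℝ)) : ℕ := Module.finrank ℝ (vectorSpan ℝ F)

/-- The edges (one-dimensional faces) of `Δ` that emanate from `v`. -/
def edgesAt {n : ℕ} (Δ : Set (Fin n → ℝ)) (v : Fin n → ℝ) : Set (Set (Fin n → ℝ)) :=
  {E | IsFace Δ E ∧ faceDim E = 1 ∧ v ∈ E}

/-- `Δ` is simple: exactly `n` edges emanate from each vertex. -/
def IsSimple {n : ℕ} (Δ : Set (Fin n → ℝ)) : Prop :=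
  ∀ v ∈ Δ.extremePoints ℝ, (edgesAt Δ v).encard = n

/-- A regular integral (lattice) polytope: a polytope whose vertices are lattice points,
which is simple, and such that the edges emanating from each vertex lie along
lines that are generated by a `ℤ`-basis of `ℤⁿ`. -/
structure IsRegularLatticePolytope {n : ℕ} (Δ : Set (Fin n → ℝ)) : Prop where
  polytope : IsPolytope Δ
  integral : ∀ v ∈ Δ.extremePoints ℝ, ∃ z : Fin n → ℤ, v = intVec z
  simple : IsSimple Δ
  regular : ∀ v ∈ Δ.extremePoints ℝ, ∃ b : Module.Basis (edgesAt Δ v) ℤ (Fin n → ℤ),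
    ∀ E : edgesAt Δ v, vectorSpan ℝ (E : Set (Fin n → ℝ)) = Submodule.span ℝ {intVec (b E)}

/-- The set `⋂ i, {x | ⟨u i, x⟩ + μ i + h i ≥ 0}`. -/
def dilated {n d : ℕ} (u : Fin d → Fin n → ℝ) (μ : Fin d → ℝ) (h : Fin d → ℝ) :
    Set (Fin n → ℝ) :=
  {x | ∀ i, 0 ≤ (∑ j, u i j * x j) + μ i + h i}

/-- `Δ` is the intersection of the `d` half-spaces `⟨u i, x⟩ + μ i ≥ 0`, where `d` is the smallest
possible number of half-spaces (so that `d` is the number of facets of `Δ`) and the inward normals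
`u i` are primitive lattice vectors. -/
structure IsFacetPresentation {n d : ℕ} (Δ : Set (Fin n → ℝ)) (u : Fin d → Fin n → ℤ)
    (μ : Fin d → ℝ) : Prop where
  eq_inter : Δ = dilated (fun i => intVec (u i)) μ 0
  minimal : ∀ (d' : ℕ) (u' : Fin d' → Fin n → ℝ) (μ' : Fin d' → ℝ), Δ = dilated u' μ' 0 → d ≤ d'
  primitive : ∀ i, IsPrimitive (u i)

/-- The weighted characteristic function: `1 / 2 ^ k` on the relative interior of each face of
codimension `k`, and `0` outside `Δ`. -/
def weightedChar {n : ℕ} (Δ : Set (Fin n → ℝ)) (x : Fin n → ℝ) : ℝ :=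
  ∑ᶠ F ∈ {F | IsFace Δ F},
    (intrinsicInterior ℝ F).indicator (fun _ => (1 / 2 : ℝ) ^ (n - faceDim F)) x

/-- The weighted sum of the values of `f` over the lattice points of `Δ`. -/
def weightedSum {E : Type*} [AddCommGroup E] [Module ℝ E] {n : ℕ} (Δ : Set (Fin n → ℝ))
    (f : (Fin n → ℝ) → E) : E :=
  ∑ᶠ z ∈ {z : Fin n → ℤ | intVec z ∈ Δ}, weightedChar Δ (intVec z) • f (intVec z)

/-! ### Edge vectors and polarization -/

/-- The set of primitive lattice vectors in the directions of the edges of `Δ` that emanate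
from `v`. -/
def edgeVectorSet {n : ℕ} (Δ : Set (Fin n → ℝ)) (v : Fin n → ℝ) : Set (Fin n → ℤ) :=
  {α | IsPrimitive α ∧ ∃ E ∈ edgesAt Δ v, ∃ t : ℝ, 0 < t ∧ v + t • intVec α ∈ E}

open Classical in
/-- The primitive edge vectors of `Δ` at `v` as a finset (there are finitely many when `Δ` is a
polytope and `v` a vertex). -/
def edgeVectors {n : ℕ} (Δ : Set (Fin n → ℝ)) (v : Fin n → ℝ) : Finset (Fin n → ℤ) :=
  if h : (edgeVectorSet Δ v).Finite then h.toFinset else ∅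

/-- `ξ ∈ (ℝⁿ)*` is a polarizing vector for `Δ`: it does not vanish on any edge vector. -/
def IsPolarizing {n : ℕ} (Δ : Set (Fin n → ℝ)) (ξ : Module.Dual ℝ (Fin n → ℝ)) : Prop :=
  ∀ v ∈ Δ.extremePoints ℝ, ∀ α ∈ edgeVectors Δ v, ξ (intVec α) ≠ 0

open Classical in
/-- The polarized edge vector: `α` is flipped exactly if `⟨ξ, α⟩ > 0`. -/
def polarized {n : ℕ} (ξ : Module.Dual ℝ (Fin n → ℝ)) (α : Fin n → ℤ) : Fin n → ℝ :=
  if 0 < ξ (intVec α) then -intVec α else intVec α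

open Classical in
/-- The number of edge vectors at `v` that are flipped by the polarization. -/
def flipCount {n : ℕ} (Δ : Set (Fin n → ℝ)) (ξ : Module.Dual ℝ (Fin n → ℝ)) (v : Fin n → ℝ) : ℕ :=
  ((edgeVectors Δ v).filter fun α => 0 < ξ (intVec α)).card

/-- The affine map `t ↦ v + ∑ α, t α • α♯` from the standard space with one coordinate for each
edge vector `α` at `v`; it maps the standard orthant onto the polarized tangent cone. -/
def vertexChart {n : ℕ} (Δ : Set (Fin n → ℝ)) (ξ : Module.Dual ℝ (Fin n → ℝ)) (v : Fin n → ℝ)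
    (t : edgeVectors Δ v → ℝ) : Fin n → ℝ :=
  v + ∑ α : edgeVectors Δ v, t α • polarized ξ α

/-- The shifted standard orthant `{t | t i + h i ≥ 0 for all i}`. -/
def orthant {ι : Type*} (h : ι → ℝ) : Set (ι → ℝ) := {t | ∀ i, 0 ≤ t i + h i}

/-- The polarized tangent cone `v + ∑ ℝ≥0 α♯`. -/
def polarizedCone {n : ℕ} (Δ : Set (Fin n → ℝ)) (ξ : Module.Dual ℝ (Fin n → ℝ))
    (v : Fin n → ℝ) : Set (Fin n → ℝ) :=
  vertexChart Δ ξ v '' orthant 0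

/-! ### Partial derivatives and the operators `L^{2k}(∂/∂h)` -/

/-- The partial derivative `∂F/∂h_i`. -/
def partialDeriv {ι E : Type*} [DecidableEq ι] [NormedAddCommGroup E] [NormedSpace ℝ E]
    (i : ι) (F : (ι → ℝ) → E) (h : ι → ℝ) : E :=
  deriv (fun t => F (Function.update h i t)) (h i)

/-- The mixed partial derivative `∏_{i ∈ s} (∂/∂x_i)^{a i} F`. -/
def mixedPartial {ι E : Type*} [DecidableEq ι] [NormedAddCommGroup E] [NormedSpace ℝ E]
    (s : Finset ι) (a : ι → ℕ) (F : (ι → ℝ) → E) : (ι → ℝ) → E :=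
  s.toList.foldr (fun i G => (partialDeriv i)^[a i] G) F

/-- On a neighbourhood of `0`, all iterated partial derivatives of `F`, taken in any order, of order
at most `r i` in each variable `h_i`, exist and are continuous. -/
def HasContinuousPartials {ι E : Type*} [DecidableEq ι] [NormedAddCommGroup E] [NormedSpace ℝ E]
    (r : ι → ℕ) (F : (ι → ℝ) → E) : Prop :=
  ∃ U : Set (ι → ℝ), IsOpen U ∧ 0 ∈ U ∧ ∀ w : List ι, (∀ i, w.count i ≤ r i) →
    ContinuousOn (w.foldr partialDeriv F) U ∧
    ∀ i, w.count i < r i → ∀ h ∈ U,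
      DifferentiableAt ℝ (fun t => w.foldr partialDeriv F (Function.update h i t)) (h i)

/-- The operator `L^{2k}(∂/∂h_i) = ∑_{j ≤ k} b_{2j} / (2j)! (∂/∂h_i)^{2j}`, the truncation at `2k` of
the power series `L(S) = (S/2) / tanh (S/2)` evaluated at `∂/∂h_i`. -/
def opL {ι E : Type*} [DecidableEq ι] [NormedAddCommGroup E] [NormedSpace ℝ E]
    (k : ℕ) (i : ι) (F : (ι → ℝ) → E) (h : ι → ℝ) : E :=
  ∑ j ∈ Finset.range (k + 1),
    ((bernoulli (2 * j) : ℝ) / ((2 * j).factorial : ℝ)) • (partialDeriv i)^[2 * j] F h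

/-- The operator `∏_{i ∈ s} L^{2k}(∂/∂h_i)`. -/
def prodOpL {ι E : Type*} [DecidableEq ι] [NormedAddCommGroup E] [NormedSpace ℝ E]
    (k : ℕ) (s : Finset ι) (F : (ι → ℝ) → E) : (ι → ℝ) → E :=
  s.toList.foldr (fun i G => opL k i G) F

/-! ### The remainder -/

/-- The periodic function `P_m(x) = B_m({x}) / m!`. -/
def periodicB (m : ℕ) (x : ℝ) : ℝ := bernoulliFun m (Int.fract x) / (m.factorial : ℝ)

/-- The function of `h` given by
`∫_{O(± h)} ∏_{i ∉ I} P_m(x_i) ∏_{i ∉ I} (∂/∂x_i)^m g(x) dx`; the signs are given by `ε`. -/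
def stdIntegral {ι E : Type*} [Fintype ι] [DecidableEq ι] [NormedAddCommGroup E] [NormedSpace ℝ E]
    (m : ℕ) (ε : ι → ℤˣ) (I : Finset ι) (g : (ι → ℝ) → E) (h : ι → ℝ) : E :=
  ∫ x in orthant (fun i => ((ε i : ℤ) : ℝ) * h i),
    (∏ i ∈ Iᶜ, periodicB m (x i)) • mixedPartial Iᶜ (fun _ => m) g x

/-- The remainder `R^st_m(g)` for the standard orthant, with `k = ⌊m/2⌋`: the sum over the proper
subsets `I` of the index set of
`(-1)^{(m-1)(n-|I|)} ∏_{i ∈ I} L^{2k}(∂/∂h_i)` applied to `stdIntegral` at `h = 0`. -/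
def stdRemainder {ι E : Type*} [Fintype ι] [DecidableEq ι] [NormedAddCommGroup E] [NormedSpace ℝ E]
    (m : ℕ) (ε : ι → ℤˣ) (g : (ι → ℝ) → E) : E :=
  ∑ I ∈ (Finset.univ : Finset ι).ssubsets,
    (-1 : ℝ) ^ ((m - 1) * (Fintype.card ι - I.card)) •
      prodOpL (m / 2) I (stdIntegral m ε I g) 0

/-- The remainder `S^m_Δ(f) = ∑_v (-1)^{#v} R_m^{C_v♯}(f)`, a sum over the vertices of `Δ`, where
`R_m^{C_v♯}(f)` is `R^st_m` of the pullback of `f` to the standard orthant. Here `ε v` is the choice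
of signs `±` used at the vertex `v`. -/
def remainder {E : Type*} [NormedAddCommGroup E] [NormedSpace ℝ E] {n : ℕ} (m : ℕ)
    (Δ : Set (Fin n → ℝ)) (ξ : Module.Dual ℝ (Fin n → ℝ))
    (ε : (v : Fin n → ℝ) → edgeVectors Δ v → ℤˣ) (f : (Fin n → ℝ) → E) : E :=
  ∑ᶠ v ∈ Δ.extremePoints ℝ,
    (-1 : ℝ) ^ flipCount Δ ξ v • stdRemainder m (ε v) (fun t => f (vertexChart Δ ξ v t))

/-- The multi-indices in `n` variables of order at least `p` and at most `q`. -/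
def multiIndices (n p q : ℕ) : Finset (Fin n → ℕ) :=
  (Fintype.piFinset fun _ : Fin n => Finset.range (q + 1)).filter
    fun a => p ≤ ∑ i, a i ∧ ∑ i, a i ≤ q

end EulerMaclaurin

end

open MeasureTheory

noncomputable section

namespace EulerMaclaurin

/-! ### Families of functions closed under partial derivatives -/

/-! Everything is reduced to dimension one. On a half-line, repeated integration by parts against
the periodic Bernoulli functions gives the formula with remainder
(`sum_halfStep_eq_intervalIntegral`). Applied coordinate by coordinate on an orthant it produces one
term for each set I of coordinates: L^{2k} acts in the coordinates of I, while P_m and an m-th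
derivative appear in the others. The full set gives the main term, the proper subsets give R^st
(`tsum_halfStep_eq`).

A simple polytope is a signed sum of its polarized tangent cones. This holds pointwise for the
weighted indicators (`polarSum_halfStep`) and almost everywhere, after the shift by a small h, for
the indicators of Δ(h) (`polarSum_indicator`, `ae_vertexProd_indicator`). Regularity makes every
cone unimodular, so the chart at a vertex carries lattice to lattice, Lebesgue measure to Lebesgue
measure and facet weights to product weights. Summing the orthant formulas over the vertices gives
the lattice sum on the left. On the right the main terms assemble into the operator applied to the
integral over Δ(h): at a vertex only the facets through it matter, shifting such a facet shifts the
orthant, and ∂/∂h_i becomes plus or minus a coordinate derivative under the integral. The sign is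
immaterial because L is even.

The polar decomposition rests on a counting argument. The signed sum of products over the vertices
is a multi-affine polynomial in one variable per facet. Its coefficients are indexed by sets of
facets with a common point in Δ, and each such set is counted at exactly one vertex, the ξ-minimal
vertex of the face (`existsUnique_min_vertex`). Hence the polynomial does not depend on ξ
(`polarSum_eq_sum`). For a point violating a facet inequality, ξ may then be taken near minus the
normal of that facet, and every product vanishes.

Once the formula is known, independence of ξ and of the signs is immediate, since the other two
terms do not involve them; both terms also vanish when f is supported off Δ.

The functions of h are differentiated only up to prescribed orders in each variable. `DerivSystem`
and `ev` let polynomials act as constant-coefficient operators, with `Room` ensuring that only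
available derivatives are used. -/

open MvPolynomial in
/-- The truncation `∑_{j ≤ k} b_{2j} / (2j)! q^{2j}` of `(q/2) / tanh (q/2)`. -/
def truncL {A : Type*} [CommRing A] [Algebra ℝ A] (k : ℕ) (q : A) : A :=
  ∑ j ∈ Finset.range (k + 1),
    ((bernoulli (2 * j) : ℝ) / ((2 * j).factorial : ℝ)) • q ^ (2 * j)

lemma truncL_neg {A : Type*} [CommRing A] [Algebra ℝ A] (k : ℕ) (q : A) :
    truncL k (-q) = truncL k q := by
  simp [truncL, pow_mul]

lemma truncL_zero {A : Type*} [CommRing A] [Algebra ℝ A] (k : ℕ) : truncL k (0 : A) = 1 := by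
  rw [truncL, Finset.sum_eq_single 0]
  · simp
  · intro j _ hj
    simp [hj]
  · simp

lemma map_truncL {A B : Type*} [CommRing A] [Algebra ℝ A] [CommRing B] [Algebra ℝ B]
    (φ : A →ₐ[ℝ] B) (k : ℕ) (q : A) : φ (truncL k q) = truncL k (φ q) := by
  simp [truncL]

section DerivSystem

variable {κ E : Type*} [DecidableEq κ] [NormedAddCommGroup E] [NormedSpace ℝ E]

/-- A family of functions indexed by multi-indices such that, within `U` and for multi-indices in
`R`, raising the index by `e_i` corresponds to the partial derivative `∂/∂h_i`. -/
structure DerivSystem (R : Set (κ →₀ ℕ)) (U : Set (κ → ℝ))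
    (F : (κ →₀ ℕ) → (κ → ℝ) → E) : Prop where
  cont : ∀ a ∈ R, ContinuousOn (F a) U
  deriv : ∀ a i, a + Finsupp.single i 1 ∈ R → ∀ h ∈ U,
    HasDerivAt (fun t => F a (Function.update h i t)) (F (a + Finsupp.single i 1) h) (h i)

/-- The linear extension of a family indexed by multi-indices to polynomials. -/
def ev (F : (κ →₀ ℕ) → (κ → ℝ) → E) : MvPolynomial κ ℝ →ₗ[ℝ] ((κ → ℝ) → E) :=
  (MvPolynomial.basisMonomials κ ℝ).constr ℝ F

omit [DecidableEq κ] in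
lemma ev_monomial (F : (κ →₀ ℕ) → (κ → ℝ) → E) (a : κ →₀ ℕ) :
    ev F (MvPolynomial.monomial a 1) = F a := by
  have := (MvPolynomial.basisMonomials κ ℝ).constr_basis ℝ F a
  simpa [ev] using this

omit [DecidableEq κ] in
lemma ev_one (F : (κ →₀ ℕ) → (κ → ℝ) → E) : ev F 1 = F 0 := ev_monomial F 0

omit [DecidableEq κ] in
lemma ev_eq_sum (F : (κ →₀ ℕ) → (κ → ℝ) → E) (p : MvPolynomial κ ℝ) :
    ev F p = ∑ a ∈ p.support, p.coeff a • F a := by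
  conv_lhs => rw [← MvPolynomial.support_sum_monomial_coeff p]
  rw [map_sum]
  refine Finset.sum_congr rfl fun a _ => ?_
  rw [← ev_monomial F a, ← map_smul, MvPolynomial.smul_monomial, smul_eq_mul, mul_one]

omit [DecidableEq κ] in
lemma ev_X_mul (F : (κ →₀ ℕ) → (κ → ℝ) → E) (i : κ) (p : MvPolynomial κ ℝ) :
    ev F (MvPolynomial.X i * p) =
      ∑ a ∈ p.support, p.coeff a • F (a + Finsupp.single i 1) := by
  conv_lhs => rw [← MvPolynomial.support_sum_monomial_coeff p]
  rw [Finset.mul_sum, map_sum]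
  refine Finset.sum_congr rfl fun a _ => ?_
  rw [← ev_monomial F (a + _), ← map_smul, MvPolynomial.smul_monomial, smul_eq_mul, mul_one,
    MvPolynomial.X, MvPolynomial.monomial_mul, one_mul, add_comm]

/-- All exponents of `p`, raised by `b`, lie in `R`. -/
def Room (R : Set (κ →₀ ℕ)) (b : κ →₀ ℕ) (p : MvPolynomial κ ℝ) : Prop :=
  ∀ a ∈ p.support, a + b ∈ R

variable {R : Set (κ →₀ ℕ)} {U : Set (κ → ℝ)} {F : (κ →₀ ℕ) → (κ → ℝ) → E}
  {b : κ →₀ ℕ} {p q : MvPolynomial κ ℝ}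

omit [DecidableEq κ] in
lemma Room.mono (hR : IsLowerSet R) {b' : κ →₀ ℕ} (h : Room R b p) (hb : b' ≤ b) :
    Room R b' p := fun a ha => hR (add_le_add_right hb a) (h a ha)

omit [DecidableEq κ] in
lemma Room.monomial {a : κ →₀ ℕ} {c : ℝ} (h : a + b ∈ R) :
    Room R b (MvPolynomial.monomial a c) := by
  intro a' ha'
  have := MvPolynomial.support_monomial_subset ha'
  rw [Finset.mem_singleton] at this
  rwa [this]

omit [DecidableEq κ] in
lemma Room.one (h : b ∈ R) : Room R b 1 := Room.monomial (a := 0) (by simpa using h)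

omit [DecidableEq κ] in
lemma Room.smul (h : Room R b p) (c : ℝ) : Room R b (c • p) :=
  fun a ha => h a (MvPolynomial.support_smul ha)

omit [DecidableEq κ] in
lemma Room.sum {J : Type*} {s : Finset J} {f : J → MvPolynomial κ ℝ}
    (h : ∀ j ∈ s, Room R b (f j)) : Room R b (∑ j ∈ s, f j) := by
  classical
  intro a ha
  obtain ⟨j, hj, haj⟩ := Finset.mem_biUnion.1 (MvPolynomial.support_sum ha)
  exact h j hj a haj

omit [DecidableEq κ] in
lemma Room.X_mul {i : κ} (h : Room R (b + Finsupp.single i 1) p) :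
    Room R b (MvPolynomial.X i * p) := by
  intro a ha
  rw [MvPolynomial.support_X_mul, Finset.mem_map] at ha
  obtain ⟨a', ha', rfl⟩ := ha
  have := h a' ha'
  simp only [addLeftEmbedding_apply]
  convert this using 1
  abel

omit [DecidableEq κ] in
lemma Room.X_pow_mul {i : κ} (c : ℕ) (h : Room R (b + Finsupp.single i c) p) :
    Room R b (MvPolynomial.X i ^ c * p) := by
  induction c generalizing b with
  | zero => simpa using h
  | succ c ih =>
    rw [pow_succ', mul_assoc]
    refine Room.X_mul (ih ?_)
    convert h using 1
    rw [Finsupp.single_add]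
    abel

omit [DecidableEq κ] in
lemma Room.truncL_mul (hR : IsLowerSet R) {i : κ} {k : ℕ}
    (h : Room R (b + Finsupp.single i (2 * k)) p) :
    Room R b (truncL k (MvPolynomial.X i) * p) := by
  rw [truncL, Finset.sum_mul]
  refine Room.sum fun j hj => ?_
  rw [smul_mul_assoc]
  refine (Room.X_pow_mul _ (h.mono hR ?_)).smul _
  have : j ≤ k := by simpa [Nat.lt_succ_iff] using hj
  gcongr

/-- A short coordinate segment through a point of an open set stays inside it. This allows
identities that hold only near `h = 0` to be differentiated. -/
lemma partialDeriv_congr (hU : IsOpen U) {f g : (κ → ℝ) → E} (hfg : Set.EqOn f g U) (i : κ) :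
    Set.EqOn (partialDeriv i f) (partialDeriv i g) U := by
  intro h hh
  refine Filter.EventuallyEq.deriv_eq ?_
  have hc : Continuous fun t => Function.update h i t := by fun_prop
  have : ∀ᶠ t in nhds (h i), Function.update h i t ∈ U :=
    hc.continuousAt.eventually_mem (hU.mem_nhds (by simpa using hh))
  filter_upwards [this] with t ht using hfg ht

lemma DerivSystem.hasDerivAt_ev (hF : DerivSystem R U F) {i : κ}
    (hp : Room R (Finsupp.single i 1) p) {h : κ → ℝ} (hh : h ∈ U) :
    HasDerivAt (fun t => ev F p (Function.update h i t)) (ev F (MvPolynomial.X i * p) h) (h i) := by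
  rw [ev_X_mul, ev_eq_sum]
  simp only [Finset.sum_apply, Pi.smul_apply]
  exact HasDerivAt.fun_sum fun a ha => (hF.deriv a i (hp a ha) h hh).const_smul (p.coeff a)

lemma DerivSystem.partialDeriv_eqOn (hF : DerivSystem R U F) (hU : IsOpen U) {i : κ}
    (hp : Room R (Finsupp.single i 1) p) {f : (κ → ℝ) → E} (hf : Set.EqOn f (ev F p) U) :
    Set.EqOn (partialDeriv i f) (ev F (MvPolynomial.X i * p)) U := fun _ hh =>
  (partialDeriv_congr hU hf i hh).trans (hF.hasDerivAt_ev hp hh).deriv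

omit [DecidableEq κ] in
lemma DerivSystem.continuousOn_ev [DecidableEq κ] (hF : DerivSystem R U F) (hp : Room R 0 p) :
    ContinuousOn (ev F p) U := by
  rw [ev_eq_sum]
  rw [Finset.sum_fn]
  refine continuousOn_finsetSum _ fun a ha => (hF.cont a ?_).const_smul (p.coeff a)
  simpa using hp a ha

lemma DerivSystem.iterate_partialDeriv_eqOn (hF : DerivSystem R U F) (hU : IsOpen U)
    (hR : IsLowerSet R) {i : κ} (l : ℕ) (hp : Room R (Finsupp.single i l) p)
    {f : (κ → ℝ) → E} (hf : Set.EqOn f (ev F p) U) :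
    Set.EqOn ((partialDeriv i)^[l] f) (ev F (MvPolynomial.X i ^ l * p)) U := by
  induction l with
  | zero => simpa using hf
  | succ l ih =>
    rw [Function.iterate_succ_apply', pow_succ', mul_assoc]
    refine hF.partialDeriv_eqOn hU (Room.X_pow_mul l (hp.mono hR ?_))
      (ih (hp.mono hR (by gcongr; omega)))
    rw [← Finsupp.single_add, add_comm]

lemma DerivSystem.opL_eqOn (hF : DerivSystem R U F) (hU : IsOpen U)
    (hR : IsLowerSet R) {i : κ} {k : ℕ} (hp : Room R (Finsupp.single i (2 * k)) p)
    {f : (κ → ℝ) → E} (hf : Set.EqOn f (ev F p) U) :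
    Set.EqOn (opL k i f) (ev F (truncL k (MvPolynomial.X i) * p)) U := by
  intro h hh
  rw [truncL, Finset.sum_mul, map_sum, Finset.sum_apply, opL]
  refine Finset.sum_congr rfl fun j hj => ?_
  have hj : j ≤ k := by simpa [Nat.lt_succ_iff] using hj
  rw [smul_mul_assoc, map_smul, Pi.smul_apply,
    hF.iterate_partialDeriv_eqOn hU hR _ (hp.mono hR (by gcongr)) hf hh]

omit [DecidableEq κ] in
lemma Room.list_truncL (hR : IsLowerSet R) {k : ℕ} (l : List κ)
    (hp : Room R (b + (l.map fun i => Finsupp.single i (2 * k)).sum) p) :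
    Room R b ((l.map fun i => truncL k (MvPolynomial.X i)).prod * p) := by
  induction l generalizing b with
  | nil => simpa using hp
  | cons i l ih =>
    rw [List.map_cons, List.prod_cons, mul_assoc]
    refine Room.truncL_mul hR (ih ?_)
    simpa [add_assoc] using hp

omit [DecidableEq κ] in
lemma Room.list_X_pow {c : κ → ℕ} (l : List κ)
    (hp : Room R (b + (l.map fun i => Finsupp.single i (c i)).sum) p) :
    Room R b ((l.map fun i => MvPolynomial.X i ^ c i).prod * p) := by
  induction l generalizing b with
  | nil => simpa using hp
  | cons i l ih =>
    rw [List.map_cons, List.prod_cons, mul_assoc]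
    refine Room.X_pow_mul _ (ih ?_)
    simpa [add_assoc] using hp

omit [DecidableEq κ] in
lemma Room.prod_truncL (hR : IsLowerSet R) {k : ℕ} (s : Finset κ)
    (hp : Room R (b + ∑ i ∈ s, Finsupp.single i (2 * k)) p) :
    Room R b ((∏ i ∈ s, truncL k (MvPolynomial.X i)) * p) := by
  rw [← Finset.prod_map_toList]
  refine Room.list_truncL hR _ ?_
  rwa [Finset.sum_map_toList]

omit [DecidableEq κ] in
lemma Room.prod_X_pow {c : κ → ℕ} (s : Finset κ)
    (hp : Room R (b + ∑ i ∈ s, Finsupp.single i (c i)) p) :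
    Room R b ((∏ i ∈ s, MvPolynomial.X i ^ c i) * p) := by
  rw [← Finset.prod_map_toList]
  refine Room.list_X_pow _ ?_
  rwa [Finset.sum_map_toList]

/-- Operators become factors in a commutative polynomial ring, so the arbitrary order chosen by
`Finset.toList` disappears from the result. -/
lemma DerivSystem.prodOpL_eqOn (hF : DerivSystem R U F) (hU : IsOpen U)
    (hR : IsLowerSet R) {k : ℕ} (s : Finset κ)
    (hp : Room R (∑ i ∈ s, Finsupp.single i (2 * k)) p)
    {f : (κ → ℝ) → E} (hf : Set.EqOn f (ev F p) U) :
    Set.EqOn (prodOpL k s f) (ev F ((∏ i ∈ s, truncL k (MvPolynomial.X i)) * p)) U := by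
  rw [← Finset.prod_map_toList, prodOpL]
  rw [← Finset.sum_map_toList] at hp
  generalize s.toList = l at hp ⊢
  induction l with
  | nil => simpa using hf
  | cons i l ih =>
    rw [List.map_cons, List.sum_cons] at hp
    rw [List.map_cons, List.prod_cons, mul_assoc, List.foldr_cons]
    exact hF.opL_eqOn hU hR (Room.list_truncL hR l hp) (ih (hp.mono hR le_add_self))

lemma DerivSystem.mixedPartial_eqOn (hF : DerivSystem R U F) (hU : IsOpen U)
    (hR : IsLowerSet R) (s : Finset κ) (c : κ → ℕ)
    (hp : Room R (∑ i ∈ s, Finsupp.single i (c i)) p)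
    {f : (κ → ℝ) → E} (hf : Set.EqOn f (ev F p) U) :
    Set.EqOn (mixedPartial s c f) (ev F ((∏ i ∈ s, MvPolynomial.X i ^ c i) * p)) U := by
  rw [← Finset.prod_map_toList, mixedPartial]
  rw [← Finset.sum_map_toList] at hp
  generalize s.toList = l at hp ⊢
  induction l with
  | nil => simpa using hf
  | cons i l ih =>
    rw [List.map_cons, List.sum_cons] at hp
    rw [List.map_cons, List.prod_cons, mul_assoc, List.foldr_cons]
    exact hF.iterate_partialDeriv_eqOn hU hR _ (Room.list_X_pow l hp)
      (ih (hp.mono hR le_add_self))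

lemma DerivSystem.foldr_partialDeriv_eqOn (hF : DerivSystem R U F) (hU : IsOpen U)
    (hR : IsLowerSet R) (w : List κ) (hw : (w.map fun i => Finsupp.single i 1).sum ∈ R)
    {f : (κ → ℝ) → E} (hf : Set.EqOn f (F 0) U) :
    Set.EqOn (w.foldr partialDeriv f) (F (w.map fun i => Finsupp.single i 1).sum) U := by
  induction w with
  | nil => simpa using hf
  | cons i l ih =>
    rw [List.map_cons, List.sum_cons, add_comm] at hw
    rw [List.map_cons, List.sum_cons, List.foldr_cons, add_comm]
    intro h hh
    rw [partialDeriv_congr hU (ih (hR le_self_add hw)) i hh]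
    exact (hF.deriv _ i hw h hh).deriv

lemma list_sum_single_apply (w : List κ) (i : κ) :
    (w.map fun i => Finsupp.single i 1).sum i = w.count i := by
  induction w with
  | nil => simp
  | cons j l ih =>
    rw [List.map_cons, List.sum_cons, Finsupp.add_apply, ih, List.count_cons, Finsupp.single_apply,
      add_comm]
    simp

/-- A word of partial derivatives acts through the multi-index counting its letters, so all
orderings are covered by the single family `F`. -/
lemma DerivSystem.hasContinuousPartials {r : κ → ℕ} (hF : DerivSystem {a | ∀ i, a i ≤ r i} U F)
    (hU : IsOpen U) (h0 : 0 ∈ U) {f : (κ → ℝ) → E} (hf : Set.EqOn f (F 0) U) :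
    HasContinuousPartials r f := by
  have hR : IsLowerSet {a : κ →₀ ℕ | ∀ i, a i ≤ r i} := fun a b hab ha i => (hab i).trans (ha i)
  refine ⟨U, hU, h0, fun w hw => ?_⟩
  have hw' : (w.map fun i => Finsupp.single i 1).sum ∈ {a : κ →₀ ℕ | ∀ i, a i ≤ r i} := by
    intro i
    rw [list_sum_single_apply]
    exact hw i
  have key := hF.foldr_partialDeriv_eqOn hU hR w hw' hf
  refine ⟨(hF.cont _ hw').congr key, fun i hi h hh => ?_⟩
  have hd := hF.deriv (w.map fun i => Finsupp.single i 1).sum i (by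
    intro j
    rw [Finsupp.add_apply, list_sum_single_apply, Finsupp.single_apply]
    split_ifs with hij
    · subst hij; omega
    · simpa using hw j) h hh
  refine (hd.congr_of_eventuallyEq ?_).differentiableAt
  have hc : Continuous fun t => Function.update h i t := by fun_prop
  have : ∀ᶠ t in nhds (h i), Function.update h i t ∈ U :=
    hc.continuousAt.eventually_mem (hU.mem_nhds (by simpa using hh))
  filter_upwards [this] with t ht using key ht

lemma DerivSystem.sum {J : Type*} {s : Finset J} {G : J → (κ →₀ ℕ) → (κ → ℝ) → E} (c : J → ℝ)
    (hG : ∀ j ∈ s, DerivSystem R U (G j)) :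
    DerivSystem R U (fun a h => ∑ j ∈ s, c j • G j a h) where
  cont a ha := continuousOn_finsetSum _ fun j hj => ((hG j hj).cont a ha).const_smul _
  deriv a i ha h hh := HasDerivAt.fun_sum fun j hj => ((hG j hj).deriv a i ha h hh).const_smul _

omit [DecidableEq κ] in
lemma ev_sum {J : Type*} {s : Finset J} (G : J → (κ →₀ ℕ) → (κ → ℝ) → E) (c : J → ℝ)
    (p : MvPolynomial κ ℝ) (h : κ → ℝ) :
    ev (fun a h => ∑ j ∈ s, c j • G j a h) p h = ∑ j ∈ s, c j • ev (G j) p h := by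
  simp only [ev_eq_sum, Finset.sum_apply, Pi.smul_apply, Finset.smul_sum]
  rw [Finset.sum_comm]
  refine Finset.sum_congr rfl fun j _ => Finset.sum_congr rfl fun a _ => ?_
  rw [smul_comm]

lemma DerivSystem.mono {R' : Set (κ →₀ ℕ)} {U' : Set (κ → ℝ)} (hF : DerivSystem R U F)
    (hR : R' ⊆ R) (hU : U' ⊆ U) : DerivSystem R' U' F where
  cont a ha := (hF.cont a (hR ha)).mono hU
  deriv a i ha h hh := hF.deriv a i (hR ha) h (hU hh)

end DerivSystem

/-! ### Families of derivatives depending only on some of the variables -/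

section Pullback

variable {ι κ E : Type*} [DecidableEq ι] [DecidableEq κ] [NormedAddCommGroup E] [NormedSpace ℝ E]

open Classical in
/-- The substitution `X_{e j} ↦ X_j` that sends the other variables to zero. -/
def restrictVars (e : ι → κ) : MvPolynomial κ ℝ →ₐ[ℝ] MvPolynomial ι ℝ :=
  MvPolynomial.aeval fun i => if h : ∃ j, e j = i then MvPolynomial.X h.choose else 0

omit [DecidableEq ι] [DecidableEq κ] in
lemma restrictVars_X {e : ι → κ} (he : e.Injective) (j : ι) :
    restrictVars e (MvPolynomial.X (e j)) = MvPolynomial.X j := by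
  have h : ∃ j', e j' = e j := ⟨j, rfl⟩
  rw [restrictVars, MvPolynomial.aeval_X, dif_pos h, he h.choose_spec]

omit [DecidableEq ι] [DecidableEq κ] in
lemma restrictVars_X_of_notMem {e : ι → κ} {i : κ} (hi : i ∉ Set.range e) :
    restrictVars e (MvPolynomial.X i) = 0 := by
  rw [restrictVars, MvPolynomial.aeval_X, dif_neg]
  simpa using hi

omit [DecidableEq ι] [DecidableEq κ] in
-- A monomial goes to the monomial in the surviving variables, or to zero as soon as a discarded
-- variable occurs. Bounds on each exponent are therefore inherited.
lemma support_restrictVars_monomial {e : ι → κ} (he : e.Injective) (a : κ →₀ ℕ) :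
    (restrictVars e (MvPolynomial.monomial a 1)).support ⊆ {a.comapDomain e he.injOn} := by
  classical
  induction a using Finsupp.induction_linear with
  | zero =>
    simp only [MvPolynomial.monomial_zero', map_one]
    refine (MvPolynomial.support_monomial_subset (s := 0)).trans ?_
    simp
  | add a b ha hb =>
    rw [← one_mul (1 : ℝ), ← MvPolynomial.monomial_mul, map_mul,
      Finsupp.comapDomain_add_of_injective he]
    refine (MvPolynomial.support_mul _ _).trans ((Finset.add_subset_add ha hb).trans ?_)
    simp
  | single i c =>
    rw [← MvPolynomial.X_pow_eq_monomial, map_pow]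
    by_cases hi : i ∈ Set.range e
    · obtain ⟨j, rfl⟩ := hi
      rw [restrictVars_X he, MvPolynomial.X_pow_eq_monomial]
      refine MvPolynomial.support_monomial_subset.trans ?_
      rw [Finset.singleton_subset_singleton]
      ext j'
      simp [Finsupp.single_apply]
    · rw [restrictVars_X_of_notMem hi]
      rcases eq_or_ne c 0 with rfl | hc
      · rw [pow_zero]
        refine (MvPolynomial.support_monomial_subset (s := 0)).trans ?_
        simp
      · simp [hc]

/-- The pull-back of a family of functions along `h ↦ h ∘ e`. -/
def pullbackFamily (e : ι → κ) (F : (ι →₀ ℕ) → (ι → ℝ) → E) (a : κ →₀ ℕ) (h : κ → ℝ) : E :=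
  ev F (restrictVars e (MvPolynomial.monomial a 1)) (h ∘ e)

omit [DecidableEq ι] [DecidableEq κ] in
lemma ev_pullbackFamily (e : ι → κ) (F : (ι →₀ ℕ) → (ι → ℝ) → E) (p : MvPolynomial κ ℝ)
    (h : κ → ℝ) : ev (pullbackFamily e F) p h = ev F (restrictVars e p) (h ∘ e) := by
  rw [ev_eq_sum, Finset.sum_apply]
  conv_rhs => rw [← MvPolynomial.support_sum_monomial_coeff p]
  rw [map_sum, map_sum, Finset.sum_apply]
  refine Finset.sum_congr rfl fun a _ => ?_
  have : MvPolynomial.monomial a (p.coeff a) = p.coeff a • MvPolynomial.monomial a (1 : ℝ) := by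
    rw [MvPolynomial.smul_monomial, smul_eq_mul, mul_one]
  rw [this, map_smul, map_smul]
  rfl

/-- A variable in the range of `e` is differentiated as before; along any other variable `h ∘ e` is
constant, which matches the substitution by zero. It is used with `e` listing the facets through a
vertex, the other facets not moving the cone there. -/
lemma DerivSystem.pullback {e : ι → κ} (he : e.Injective) {r : κ → ℕ}
    {F : (ι →₀ ℕ) → (ι → ℝ) → E} (hF : DerivSystem {a | ∀ i, a i ≤ r (e i)} Set.univ F) :
    DerivSystem {a | ∀ i, a i ≤ r i} Set.univ (pullbackFamily e F) where
  cont a ha := by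
    have h1 : ContinuousOn (ev F (restrictVars e (MvPolynomial.monomial a 1))) Set.univ := by
      refine hF.continuousOn_ev fun b hb => ?_
      have := support_restrictVars_monomial he a hb
      rw [Finset.mem_singleton] at this
      intro j
      simpa [this] using ha (e j)
    rw [← continuousOn_univ.symm] at h1 ⊢
    exact h1.comp (by fun_prop)
  deriv a i ha h _ := by
    have hmul : MvPolynomial.monomial (a + Finsupp.single i 1) (1 : ℝ)
        = MvPolynomial.X i * MvPolynomial.monomial a 1 := by
      rw [MvPolynomial.X, MvPolynomial.monomial_mul, one_mul, add_comm]
    unfold pullbackFamily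
    rw [hmul, map_mul]
    by_cases hi : i ∈ Set.range e
    · obtain ⟨j, rfl⟩ := hi
      rw [restrictVars_X he]
      have hroom : Room {a | ∀ i, a i ≤ r (e i)} (Finsupp.single j 1)
          (restrictVars e (MvPolynomial.monomial a 1)) := by
        intro b hb
        have := support_restrictVars_monomial he a hb
        rw [Finset.mem_singleton] at this
        intro j'
        simpa [this, Finsupp.single_apply, he.eq_iff] using ha (e j')
      have := hF.hasDerivAt_ev hroom (Set.mem_univ (h ∘ e))
      refine this.congr_of_eventuallyEq (Filter.Eventually.of_forall fun t => ?_)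
      simp only [Function.update_comp_eq_of_injective _ he]
    · rw [restrictVars_X_of_notMem hi, zero_mul, map_zero, Pi.zero_apply]
      refine (hasDerivAt_const (h i) (ev F (restrictVars e (MvPolynomial.monomial a 1)) (h ∘ e))
        ).congr_of_eventuallyEq (Filter.Eventually.of_forall fun t => ?_)
      simp only [Function.update_comp_eq_of_notMem_range _ _ hi]

end Pullback


/-! ### The Euler–Maclaurin formula on a half-line -/

/-- The weight `0`, `1/2`, `1` of a negative, zero, positive number. -/
def halfStep (s : ℝ) : ℝ := if s < 0 then 0 else if s = 0 then 1 / 2 else 1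

lemma halfStep_of_neg {s : ℝ} (hs : s < 0) : halfStep s = 0 := by simp [halfStep, hs]

lemma halfStep_of_pos {s : ℝ} (hs : 0 < s) : halfStep s = 1 := by
  simp [halfStep, hs.not_gt, hs.ne']

lemma halfStep_zero : halfStep 0 = 1 / 2 := by simp [halfStep]

lemma halfStep_nonneg (s : ℝ) : 0 ≤ halfStep s := by
  unfold halfStep; split_ifs <;> norm_num

/-- The value `1/2` at zero makes this symmetry exact on the boundary too. It is what lets weighted
cones be flipped along an edge. -/
lemma halfStep_neg (s : ℝ) : halfStep (-s) = 1 - halfStep s := by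
  rcases lt_trichotomy s 0 with h | rfl | h
  · rw [halfStep_of_neg h, halfStep_of_pos (by linarith)]; norm_num
  · rw [neg_zero, halfStep_zero]; norm_num
  · rw [halfStep_of_pos h, halfStep_of_neg (by linarith)]; norm_num

lemma measurable_periodicB (m : ℕ) : Measurable (periodicB m) :=
  ((continuous_bernoulliFun m).measurable.comp measurable_fract).div_const _

lemma exists_abs_periodicB_le (m : ℕ) : ∃ C : ℝ, ∀ x, |periodicB m x| ≤ C := by
  obtain ⟨C, hC⟩ := isCompact_Icc.exists_bound_of_continuousOn (s := Set.Icc (0 : ℝ) 1)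
    ((continuous_bernoulliFun m).div_const (m.factorial : ℝ)).continuousOn
  exact ⟨C, fun x => hC _ ⟨Int.fract_nonneg x, (Int.fract_lt_one x).le⟩⟩

lemma periodicB_add_int (m : ℕ) (x : ℝ) (z : ℤ) : periodicB m (x + z) = periodicB m x := by
  simp [periodicB]

/-- With the factorial in the denominator each function is exactly the derivative of the next, so
integration by parts creates no constants. -/
lemma hasDerivAt_bernoulliFun_div_factorial (m : ℕ) (c x : ℝ) :
    HasDerivAt (fun x => bernoulliFun (m + 1) (x - c) / ((m + 1).factorial : ℝ))
      (bernoulliFun m (x - c) / (m.factorial : ℝ)) x := by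
  have h := ((hasDerivAt_bernoulliFun (m + 1) (x - c)).comp_sub_const x c).div_const
    ((m + 1).factorial : ℝ)
  have he : bernoulliFun m (x - c) / (m.factorial : ℝ) =
      ((m + 1 : ℕ) : ℝ) * bernoulliFun (m + 1 - 1) (x - c) / ((m + 1).factorial : ℝ) := by
    rw [Nat.factorial_succ, Nat.add_sub_cancel]
    have : (m.factorial : ℝ) ≠ 0 := by positivity
    push_cast
    field_simp
  rw [he]
  exact h

section

variable {E : Type*} [NormedAddCommGroup E] [NormedSpace ℝ E]

lemma periodicB_eq_of_mem_Ioo {m j : ℕ} {x : ℝ} (hx : x ∈ Set.Ioo (j : ℝ) (j + 1)) :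
    periodicB m x = bernoulliFun m (x - j) / (m.factorial : ℝ) := by
  have : ⌊x⌋ = (j : ℤ) := by
    rw [Int.floor_eq_iff]
    exact ⟨by simpa using hx.1.le, by simpa using hx.2⟩
  rw [periodicB, Int.fract, this, Int.cast_natCast]

/-- Integration by parts on one period, where the periodic function is a polynomial. The boundary
values are those of the polynomial at 0 and 1, because for `m = 0` the periodic function `P_1` jumps
at the integers. -/
lemma integral_periodicB_unit [CompleteSpace E] (m j : ℕ) {φ φ' : ℝ → E}
    (hφ : ∀ t, HasDerivAt φ (φ' t) t) (hφ' : Continuous φ') :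
    ∫ x in (j : ℝ)..(j + 1), periodicB m x • φ x =
      (bernoulliFun (m + 1) 1 / ((m + 1).factorial : ℝ)) • φ (j + 1) -
      (bernoulliFun (m + 1) 0 / ((m + 1).factorial : ℝ)) • φ j -
      ∫ x in (j : ℝ)..(j + 1), periodicB (m + 1) x • φ' x := by
  have hc (l : ℕ) (ψ : ℝ → E) : ∫ x in (j : ℝ)..(j + 1), periodicB l x • ψ x =
      ∫ x in (j : ℝ)..(j + 1), (bernoulliFun l (x - j) / (l.factorial : ℝ)) • ψ x :=
    intervalIntegral.integral_congr_Ioo_of_le (by linarith) fun x hx => by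
      simp only [periodicB_eq_of_mem_Ioo hx]
  rw [hc, hc]
  have h := intervalIntegral.integral_smul_deriv_eq_deriv_smul (a := (j : ℝ)) (b := (j + 1 : ℝ))
    (fun x _ => hasDerivAt_bernoulliFun_div_factorial m j x) (fun x _ => hφ x)
    (Continuous.intervalIntegrable (by fun_prop) _ _) (hφ'.intervalIntegrable _ _)
  rw [h, add_sub_cancel_left, sub_self]
  abel

lemma integrable_periodicB_smul (m : ℕ) {φ : ℝ → E} (hφ : Continuous φ) (a b : ℝ) :
    IntervalIntegrable (fun x => periodicB m x • φ x) volume a b := by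
  obtain ⟨C, hC⟩ := exists_abs_periodicB_le m
  rw [intervalIntegrable_iff]
  exact Integrable.bdd_smul (intervalIntegrable_iff.1 (hφ.intervalIntegrable a b)) C
    (measurable_periodicB m).aestronglyMeasurable (Filter.Eventually.of_forall hC)

lemma integral_periodicB_eq [CompleteSpace E] (m N : ℕ) {φ φ' : ℝ → E}
    (hφ : ∀ t, HasDerivAt φ (φ' t) t) (hφ' : Continuous φ') :
    ∫ x in (0 : ℝ)..N, periodicB m x • φ x =
      ∑ j ∈ Finset.range N, ((bernoulliFun (m + 1) 1 / ((m + 1).factorial : ℝ)) • φ (j + 1) -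
        (bernoulliFun (m + 1) 0 / ((m + 1).factorial : ℝ)) • φ j) -
      ∫ x in (0 : ℝ)..N, periodicB (m + 1) x • φ' x := by
  have hcont : Continuous φ := continuous_iff_continuousAt.2 fun t => (hφ t).continuousAt
  have h1 := intervalIntegral.sum_integral_adjacent_intervals (a := fun j : ℕ => (j : ℝ)) (n := N)
    (μ := volume) (fun j _ => integrable_periodicB_smul m hcont (j : ℝ) (j + 1 : ℕ))
  have h2 := intervalIntegral.sum_integral_adjacent_intervals (a := fun j : ℕ => (j : ℝ)) (n := N)
    (μ := volume) (fun j _ => integrable_periodicB_smul (m + 1) hφ' (j : ℝ) (j + 1 : ℕ))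
  simp only [Nat.cast_zero, Nat.cast_add, Nat.cast_one] at h1 h2
  rw [← h1, ← h2, ← Finset.sum_sub_distrib]
  exact Finset.sum_congr rfl fun j _ => integral_periodicB_unit m j hφ hφ'

/-- The Euler–Maclaurin formula on `[0, N]` for a function `φ 0` with derivatives `φ 1, φ 2, …` all
vanishing at `N`. -/
lemma sum_halfStep_eq_intervalIntegral [CompleteSpace E] {m N : ℕ} (hm : 1 ≤ m) {φ : ℕ → ℝ → E}
    (hφ : ∀ l < m, ∀ t, HasDerivAt (φ l) (φ (l + 1) t) t) (hc : ∀ l ≤ m, Continuous (φ l))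
    (h0 : ∀ l ≤ m, φ l N = 0) :
    ∑ z ∈ Finset.range (N + 1), halfStep z • φ 0 z =
      ∑ j ∈ Finset.range (m / 2 + 1), ((bernoulli (2 * j) : ℝ) / ((2 * j).factorial : ℝ)) •
        (∫ x in (0 : ℝ)..N, φ (2 * j) x) +
      (-1 : ℝ) ^ (m - 1) • ∫ x in (0 : ℝ)..N, periodicB m x • φ m x := by
  induction m, hm using Nat.le_induction with
  | base =>
    -- As `P_0 = 1` and `B_1` takes the values `±1/2` at the ends, this is the trapezoidal rule. The
    -- weight at `N` is irrelevant because `φ 0` vanishes there.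
    have h := integral_periodicB_eq 0 N (hφ 0 one_pos) (hc 1 le_rfl)
    simp only [periodicB, bernoulliFun_zero, Nat.factorial_zero, Nat.cast_one, div_one, one_smul,
      zero_add, bernoulliFun_one, Nat.factorial_one] at h
    have hsum : ∑ z ∈ Finset.range (N + 1), halfStep z • φ 0 z =
        ∑ j ∈ Finset.range N, ((1 - 1 / 2 : ℝ) • φ 0 (j + 1) - (0 - 1 / 2 : ℝ) • φ 0 j) := by
      have h1 : ∑ z ∈ Finset.range (N + 1), halfStep z • φ 0 z =
          ∑ z ∈ Finset.range (N + 1), φ 0 z - (1 / 2 : ℝ) • φ 0 0 := by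
        rw [Finset.sum_range_succ', Finset.sum_range_succ']
        have : ∀ z : ℕ, halfStep ((z + 1 : ℕ) : ℝ) = 1 := fun z => halfStep_of_pos (by positivity)
        simp only [this, one_smul, Nat.cast_zero, halfStep_zero]
        module
      have h2 : ∑ j ∈ Finset.range N, ((1 - 1 / 2 : ℝ) • φ 0 (j + 1) - (0 - 1 / 2 : ℝ) • φ 0 j) =
          (1 / 2 : ℝ) • ∑ j ∈ Finset.range N, φ 0 ((j + 1 : ℕ) : ℝ) +
          (1 / 2 : ℝ) • ∑ j ∈ Finset.range N, φ 0 j := by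
        rw [← smul_add, ← Finset.sum_add_distrib, Finset.smul_sum]
        refine Finset.sum_congr rfl fun j _ => ?_
        push_cast
        module
      have h3 := Finset.sum_range_succ (fun z : ℕ => φ 0 (z : ℝ)) N
      have h4 := Finset.sum_range_succ' (fun z : ℕ => φ 0 (z : ℝ)) N
      rw [h0 0 zero_le_one, add_zero] at h3
      rw [h1, h2, ← h3]
      rw [eq_sub_of_add_eq h4.symm, Nat.cast_zero]
      module
    have hP : ∀ x, periodicB 1 x = Int.fract x - 1 / 2 := fun x => by simp [periodicB]
    simp only [hP, hsum]
    rw [sub_eq_iff_eq_add.1 h.symm]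
    simp
  | succ m hm ih =>
    rw [ih (fun l hl => hφ l (by omega)) (fun l hl => hc l (by omega)) fun l hl => h0 l (by omega)]
    have h := integral_periodicB_eq m N (hφ m (by omega)) (hc (m + 1) le_rfl)
    -- From degree two on the Bernoulli polynomial has equal end values, so the boundary terms
    -- telescope into the integral of `φ (m + 1)`.
    rw [bernoulliFun_endpoints_eq_of_ne_one (by omega : m + 1 ≠ 1)] at h
    have htel : ∑ j ∈ Finset.range N,
        ((bernoulliFun (m + 1) 0 / ((m + 1).factorial : ℝ)) • φ m (j + 1) -
          (bernoulliFun (m + 1) 0 / ((m + 1).factorial : ℝ)) • φ m j) =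
        (bernoulliFun (m + 1) 0 / ((m + 1).factorial : ℝ)) • ∫ x in (0 : ℝ)..N, φ (m + 1) x := by
      have hftc := intervalIntegral.integral_eq_sub_of_hasDerivAt (a := 0) (b := (N : ℝ))
        (fun t _ => hφ m (by omega) t) ((hc (m + 1) le_rfl).intervalIntegrable _ _)
      have := Finset.sum_range_sub (fun j : ℕ => φ m (j : ℝ)) N
      push_cast at this
      rw [hftc, ← this, Finset.smul_sum]
      simp only [smul_sub]
    rw [htel, bernoulliFun_eval_zero] at h
    rw [h, smul_sub, add_sub_assoc']
    have hpow : (-1 : ℝ) ^ (m + 1 - 1) = -(-1) ^ (m - 1) := by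
      obtain ⟨l, rfl⟩ := Nat.exists_eq_add_of_le' hm
      rw [Nat.add_sub_cancel, Nat.add_sub_cancel, pow_succ]
      ring
    rw [hpow, neg_smul, ← sub_eq_add_neg]
    congr 1
    -- For even `m` the new Bernoulli number has odd index at least 3 and vanishes, and `m / 2` does
    -- not change. For odd `m` the boundary term is precisely the next term of the truncated series.
    rcases Nat.even_or_odd m with hev | hodd
    · have hd : (m + 1) / 2 = m / 2 := by grind
      rw [hd, bernoulli_eq_zero_of_odd hev.add_one (by omega)]
      simp
    · have hd : (m + 1) / 2 = m / 2 + 1 := by grind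
      have hd2 : 2 * (m / 2 + 1) = m + 1 := by grind
      rw [hd, Finset.sum_range_succ _ (m / 2 + 1), hd2, Even.neg_one_pow (by grind)]
      simp

end


/-! ### Iterated partial derivatives of functions of class `C^N` -/

section Smooth

variable {ι E : Type*} [Fintype ι] [DecidableEq ι] [NormedAddCommGroup E] [NormedSpace ℝ E]

lemma hasDerivAt_comp_update {g : (ι → ℝ) → E} {x : ι → ℝ} (hg : DifferentiableAt ℝ g x) (i : ι) :
    HasDerivAt (fun t => g (Function.update x i t)) (fderiv ℝ g x (Pi.single i 1)) (x i) := by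
  have h1 : HasFDerivAt g (fderiv ℝ g x) (Function.update x i (x i)) := by
    rw [Function.update_eq_self]; exact hg.hasFDerivAt
  exact h1.comp_hasDerivAt (x i) (hasDerivAt_update x i (x i))

lemma partialDeriv_eq_fderiv {g : (ι → ℝ) → E} (hg : ContDiff ℝ 1 g) (i : ι) :
    partialDeriv i g = fun x => fderiv ℝ g x (Pi.single i 1) := by
  ext x
  exact (hasDerivAt_comp_update (hg.differentiable one_ne_zero x) i).deriv

lemma ContDiff.partialDeriv {N : ℕ} {g : (ι → ℝ) → E} (hg : ContDiff ℝ (N + 1 : ℕ) g) (i : ι) :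
    ContDiff ℝ N (partialDeriv i g) := by
  rw [partialDeriv_eq_fderiv (hg.of_le (by norm_cast; omega))]
  exact (hg.fderiv_right (m := N) (by norm_cast)).clm_apply contDiff_const

lemma partialDeriv_comm {g : (ι → ℝ) → E} (hg : ContDiff ℝ 2 g) (i j : ι) :
    partialDeriv i (partialDeriv j g) = partialDeriv j (partialDeriv i g) := by
  have h1 : ContDiff ℝ 1 g := hg.of_le (by norm_num)
  have h2 : ContDiff ℝ 1 (fderiv ℝ g) := hg.fderiv_right (by norm_num)
  have key (i j : ι) : partialDeriv i (partialDeriv j g) =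
      fun x => fderiv ℝ (fderiv ℝ g) x (Pi.single i 1) (Pi.single j 1) := by
    rw [partialDeriv_eq_fderiv (ContDiff.partialDeriv (N := 1) (by exact_mod_cast hg) j),
      partialDeriv_eq_fderiv h1]
    ext x
    rw [fderiv_clm_apply (h2.differentiable one_ne_zero x) (differentiableAt_const _)]
    simp
  rw [key, key]
  ext x
  exact (hg.contDiffAt.isSymmSndFDerivAt (by simp)).eq _ _

lemma ContDiff.foldr_partialDeriv {N : ℕ} (w : List ι) {g : (ι → ℝ) → E}
    (hg : ContDiff ℝ (N + w.length : ℕ) g) : ContDiff ℝ N (w.foldr EulerMaclaurin.partialDeriv g) := by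
  induction w generalizing N with
  | nil => simpa using hg
  | cons i l ih =>
    refine ContDiff.partialDeriv (ih ?_) i
    rw [List.length_cons] at hg
    exact hg.of_le (by norm_cast; omega)

/-- Symmetry of second derivatives is applied to adjacent swaps; the length bound leaves two orders
of differentiability after the letters applied earlier. -/
lemma foldr_partialDeriv_perm {w w' : List ι} (h : w.Perm w') {g : (ι → ℝ) → E}
    (hg : ContDiff ℝ (w.length : ℕ) g) :
    w.foldr partialDeriv g = w'.foldr partialDeriv g := by
  induction h with
  | nil => rfl
  | cons i _ ih =>
    rw [List.foldr_cons, List.foldr_cons, ih (hg.of_le (by simp))]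
  | swap i j l =>
    refine partialDeriv_comm ?_ _ _
    refine ContDiff.foldr_partialDeriv (N := 2) l (hg.of_le ?_)
    rw [List.length_cons, List.length_cons]
    norm_cast; omega
  | trans h1 _ ih1 ih2 => rw [ih1 hg, ih2 (h1.length_eq ▸ hg)]

/-- The iterated partial derivative `∂^a g`. -/
def multiD (g : (ι → ℝ) → E) (a : ι →₀ ℕ) : (ι → ℝ) → E :=
  (Finsupp.toMultiset a).toList.foldr partialDeriv g

omit [Fintype ι] in
lemma multiD_zero (g : (ι → ℝ) → E) : multiD g 0 = g := by simp [multiD]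

lemma multiD_eq_foldr {g : (ι → ℝ) → E} (w : List ι) (hg : ContDiff ℝ (w.length : ℕ) g) :
    w.foldr partialDeriv g = multiD g (Multiset.toFinsupp (w : Multiset ι)) := by
  refine foldr_partialDeriv_perm (Multiset.coe_eq_coe.1 ?_) hg
  simp

omit [Fintype ι] [DecidableEq ι] in
lemma length_toList_toMultiset (a : ι →₀ ℕ) : (Finsupp.toMultiset a).toList.length = a.degree := by
  rw [Multiset.length_toList, Finsupp.card_toMultiset]; rfl

lemma partialDeriv_multiD {g : (ι → ℝ) → E} {a : ι →₀ ℕ} {i : ι}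
    (hg : ContDiff ℝ (a.degree + 1 : ℕ) g) :
    partialDeriv i (multiD g a) = multiD g (a + Finsupp.single i 1) := by
  have := multiD_eq_foldr (i :: (Finsupp.toMultiset a).toList) (g := g) (by
    rwa [List.length_cons, length_toList_toMultiset])
  rw [List.foldr_cons] at this
  rw [multiD, this]
  congr 1
  rw [← Multiset.cons_coe, Multiset.coe_toList, ← Multiset.singleton_add, map_add,
    Multiset.toFinsupp_singleton, Finsupp.toMultiset_toFinsupp, add_comm]

lemma contDiff_multiD {g : (ι → ℝ) → E} {a : ι →₀ ℕ} {N : ℕ}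
    (hg : ContDiff ℝ (N + a.degree : ℕ) g) : ContDiff ℝ N (multiD g a) := by
  refine ContDiff.foldr_partialDeriv _ ?_
  rwa [length_toList_toMultiset]

omit [Fintype ι] [DecidableEq ι] in
lemma isLowerSet_degree_le (N : ℕ) : IsLowerSet {a : ι →₀ ℕ | a.degree ≤ N} :=
  fun _ _ hab ha => (Finsupp.degree_mono hab).trans ha

lemma derivSystem_multiD {N : ℕ} {g : (ι → ℝ) → E} (hg : ContDiff ℝ N g) :
    DerivSystem {a | a.degree ≤ N} Set.univ (multiD g) where
  cont a ha := by
    have : ContDiff ℝ (0 : ℕ) (multiD g a) :=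
      contDiff_multiD (hg.of_le (by norm_cast; simpa using ha))
    exact this.continuous.continuousOn
  deriv a i ha h _ := by
    have ha' : a.degree + 1 ≤ N := by simpa using ha
    have h1 : ContDiff ℝ (1 : ℕ) (multiD g a) :=
      contDiff_multiD (hg.of_le (by norm_cast; omega))
    rw [← partialDeriv_multiD (hg.of_le (by exact_mod_cast ha')), partialDeriv]
    exact (hasDerivAt_comp_update (h1.differentiable (by simp) h) i).differentiableAt.hasDerivAt

omit [Fintype ι] in
lemma tsupport_partialDeriv_subset (g : (ι → ℝ) → E) (i : ι) :
    tsupport (partialDeriv i g) ⊆ tsupport g := by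
  refine closure_minimal (fun x hx => ?_) (isClosed_tsupport g)
  by_contra hx'
  apply hx
  have := partialDeriv_congr (isClosed_tsupport g).isOpen_compl
    (f := g) (g := 0) (fun y hy => image_eq_zero_of_notMem_tsupport hy) i hx'
  rw [this]
  simp [partialDeriv]

omit [Fintype ι] in
lemma tsupport_multiD_subset (g : (ι → ℝ) → E) (a : ι →₀ ℕ) :
    tsupport (multiD g a) ⊆ tsupport g := by
  unfold multiD
  induction (Finsupp.toMultiset a).toList with
  | nil => rfl
  | cons i l ih => exact (tsupport_partialDeriv_subset _ i).trans ih

omit [Fintype ι] in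
lemma ev_multiD_eq_zero {g : (ι → ℝ) → E} {x : ι → ℝ} (hx : x ∉ tsupport g)
    (p : MvPolynomial ι ℝ) : ev (multiD g) p x = 0 := by
  rw [ev_eq_sum, Finset.sum_apply]
  refine Finset.sum_eq_zero fun a _ => ?_
  rw [Pi.smul_apply,
    image_eq_zero_of_notMem_tsupport fun h => hx (tsupport_multiD_subset g a h), smul_zero]

omit [Fintype ι] in
lemma hasCompactSupport_ev_multiD {g : (ι → ℝ) → E} (hg : HasCompactSupport g)
    (p : MvPolynomial ι ℝ) : HasCompactSupport (ev (multiD g) p) :=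
  HasCompactSupport.intro hg fun _ hx => ev_multiD_eq_zero hx p

lemma continuous_ev_multiD {N : ℕ} {g : (ι → ℝ) → E} (hg : ContDiff ℝ N g)
    {p : MvPolynomial ι ℝ} (hp : Room {a | a.degree ≤ N} 0 p) : Continuous (ev (multiD g) p) :=
  continuousOn_univ.1 ((derivSystem_multiD hg).continuousOn_ev hp)

end Smooth

/-! ### Integrals over shifted orthants -/

section Orthant

variable {ι E : Type*} [Fintype ι] [NormedAddCommGroup E] [NormedSpace ℝ E]

lemma measurableSet_orthant (h : ι → ℝ) : MeasurableSet (orthant h) := by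
  have : orthant h = ⋂ i, {t | 0 ≤ t i + h i} := by ext; simp [orthant]
  rw [this]
  exact MeasurableSet.iInter fun i =>
    measurableSet_le measurable_const ((measurable_pi_apply i).add_const _)

omit [Fintype ι] in
lemma integrable_bdd_smul {X : Type*} [TopologicalSpace X] [MeasurableSpace X]
    [OpensMeasurableSpace X] [SecondCountableTopologyEither X E] {ν : Measure X}
    [IsFiniteMeasureOnCompacts ν]
    {P : X → ℝ} {G : X → E} (hP : Measurable P) (hb : ∃ C : ℝ, ∀ x, |P x| ≤ C)
    (hG : Continuous G) (hc : HasCompactSupport G) : Integrable (fun x => P x • G x) ν := by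
  obtain ⟨C, hC⟩ := hb
  exact Integrable.bdd_smul (hG.integrable_of_hasCompactSupport hc) C hP.aestronglyMeasurable
    (Filter.Eventually.of_forall hC)

lemma ae_add_ne_zero (c : ι → ℝ) : ∀ᵐ x : ι → ℝ, ∀ i, x i + c i ≠ 0 := by
  classical
  rw [ae_all_iff]
  intro i
  have := Measure.ae_eval_ne (μ := fun _ : ι => (volume : Measure ℝ)) i (-c i)
  filter_upwards [this] with x hx h
  exact hx (eq_neg_of_add_eq_zero_left h)

/-- Dominated convergence: off the finitely many boundary hyperplanes, which are null sets,
membership in the orthant is locally constant in `h`. -/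
lemma continuous_setIntegral_orthant (s : ι → ℝ) {P : (ι → ℝ) → ℝ} {G : (ι → ℝ) → E}
    (hP : Measurable P) (hb : ∃ C : ℝ, ∀ x, |P x| ≤ C)
    (hG : Continuous G) (hc : HasCompactSupport G) :
    Continuous fun h : ι → ℝ => ∫ x in orthant (fun i => s i * h i), P x • G x := by
  rw [continuous_iff_continuousAt]
  intro h₀
  have hint : Integrable (fun x => P x • G x) := integrable_bdd_smul hP hb hG hc
  simp only [← integral_indicator (measurableSet_orthant _)]
  refine continuousAt_of_dominated (bound := fun x => ‖P x • G x‖)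
    (Filter.Eventually.of_forall fun h =>
      (hint.aestronglyMeasurable.indicator (measurableSet_orthant _)))
    (Filter.Eventually.of_forall fun h => Filter.Eventually.of_forall fun x =>
      norm_indicator_le_norm_self _ _) hint.norm ?_
  filter_upwards [ae_add_ne_zero fun i => s i * h₀ i] with x hx
  have hloc : ∀ᶠ h in nhds h₀,
      (x ∈ orthant (fun i => s i * h i) ↔ x ∈ orthant (fun i => s i * h₀ i)) := by
    have : ∀ i, ∀ᶠ h in nhds h₀, (0 ≤ x i + s i * h i ↔ 0 ≤ x i + s i * h₀ i) := by
      intro i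
      have hcont : Continuous fun h : ι → ℝ => x i + s i * h i := by fun_prop
      rcases lt_or_gt_of_ne (hx i) with hlt | hgt
      · filter_upwards [hcont.continuousAt.eventually_lt_const hlt] with h hh
        exact ⟨fun h1 => absurd h1 hh.not_ge, fun h1 => absurd h1 hlt.not_ge⟩
      · filter_upwards [hcont.continuousAt.eventually_const_lt hgt] with h hh
        exact ⟨fun _ => hgt.le, fun _ => hh.le⟩
    filter_upwards [Filter.eventually_all.2 this] with h hh
    exact forall_congr' hh
  refine ContinuousAt.congr (f := fun _ => (orthant fun i => s i * h₀ i).indicator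
    (fun x => P x • G x) x) continuousAt_const ?_
  filter_upwards [hloc] with h hh
  classical
  simp only [Set.indicator_apply, hh]

variable [DecidableEq ι]

/-- A translation in direction `i` moves the dependence on `t` from the domain into `G`. The factor
`P`, which need not be continuous, survives unchanged because it does not involve coordinate `i`. -/
lemma setIntegral_orthant_update (s : ι → ℝ) (P : (ι → ℝ) → ℝ) (G : (ι → ℝ) → E) {i : ι}
    (hPi : ∀ x t, P (Function.update x i t) = P x) (h : ι → ℝ) (t : ℝ) :
    ∫ x in orthant (fun j => s j * Function.update h i t j), P x • G x =
      ∫ x in orthant (fun j => s j * h j),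
        P x • G (Function.update x i (x i + s i * (h i - t))) := by
  classical
  have hup : ∀ x : ι → ℝ, x + Pi.single i (s i * (h i - t)) =
      Function.update x i (x i + s i * (h i - t)) := by
    intro x
    ext j
    rcases eq_or_ne j i with rfl | hj
    · simp
    · simp [hj]
  rw [← integral_indicator (measurableSet_orthant _), ← integral_indicator (measurableSet_orthant _),
    ← integral_add_right_eq_self _ (Pi.single i (s i * (h i - t)))]
  refine integral_congr_ae (Filter.Eventually.of_forall fun x => ?_)
  simp only [Set.indicator_apply]
  rw [hup, hPi]
  congr 1
  apply propext
  refine forall_congr' fun j => ?_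
  rcases eq_or_ne j i with rfl | hj
  · simp only [Function.update_self]
    ring_nf
  · simp [hj]

/-- After the translation the variable sits only inside `G`, and one differentiates under the
integral sign; the factor `-s i` is the inner derivative of the shift. -/
lemma hasDerivAt_setIntegral_orthant (s : ι → ℝ) {P : (ι → ℝ) → ℝ} {G G' : (ι → ℝ) → E} {i : ι}
    (hP : Measurable P) (hb : ∃ C : ℝ, ∀ x, |P x| ≤ C)
    (hPi : ∀ x t, P (Function.update x i t) = P x)
    (hG : Continuous G) (hc : HasCompactSupport G) (hG' : Continuous G')
    (hc' : HasCompactSupport G')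
    (hd : ∀ x, HasDerivAt (fun t => G (Function.update x i t)) (G' x) (x i)) (h : ι → ℝ) :
    HasDerivAt (fun t => ∫ x in orthant (fun j => s j * Function.update h i t j), P x • G x)
      (-s i • ∫ x in orthant (fun j => s j * h j), P x • G' x) (h i) := by
  simp only [setIntegral_orthant_update s P _ hPi]
  set y : ℝ → (ι → ℝ) → (ι → ℝ) := fun t x => Function.update x i (x i + s i * (h i - t)) with hy
  have hyc : ∀ t, Continuous (y t) := fun t => by rw [hy]; fun_prop
  have hy0 : ∀ x, y (h i) x = x := fun x => by simp [hy]
  obtain ⟨C, hC⟩ := hb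
  obtain ⟨C', hC'⟩ := hG'.bounded_above_of_compact_support hc'
  -- `K` collects all points that a shift of size at most `|s i|` moves into the support of `G'`. It
  -- is compact, which makes a constant on `K` an integrable bound uniform in `t` within distance 1.
  set K : Set (ι → ℝ) := (fun z : (ι → ℝ) × ℝ => z.1 - Pi.single i z.2) ''
    (tsupport G' ×ˢ Set.Icc (-|s i|) |s i|) with hK
  have hKc : IsCompact K := by
    refine (IsCompact.prod hc' isCompact_Icc).image ?_
    exact continuous_fst.sub ((continuous_single i).comp continuous_snd)
  have hmemK : ∀ x, ∀ t ∈ Metric.ball (h i) 1, G' (y t x) ≠ 0 → x ∈ K := by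
    intro x t ht hne
    refine ⟨(y t x, s i * (h i - t)), ⟨subset_tsupport _ hne, ?_⟩, ?_⟩
    · rw [Set.mem_Icc, ← abs_le, abs_mul]
      rw [Metric.mem_ball, dist_comm, Real.dist_eq] at ht
      exact mul_le_of_le_one_right (abs_nonneg _) ht.le
    · ext j
      rcases eq_or_ne j i with rfl | hj
      · simp [hy]
      · simp [hy, hj]
  have key := hasDerivAt_integral_of_dominated_loc_of_deriv_le
    (μ := volume.restrict (orthant fun j => s j * h j)) (x₀ := h i) (s := Metric.ball (h i) 1)
    (F := fun t x => P x • G (y t x)) (F' := fun t x => P x • -s i • G' (y t x))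
    (bound := K.indicator fun _ => C * (|s i| * C')) (Metric.ball_mem_nhds _ one_pos)
    (Filter.Eventually.of_forall fun t =>
      (hP.aestronglyMeasurable.smul (hG.comp (hyc t)).aestronglyMeasurable))
    (by simpa only [hy0] using integrable_bdd_smul hP ⟨C, hC⟩ hG hc)
    (hP.aestronglyMeasurable.smul
      ((hG'.comp (hyc (h i))).aestronglyMeasurable.const_smul (-s i)))
    (Filter.Eventually.of_forall fun x t ht => ?_)
    ((integrable_indicator_iff hKc.measurableSet).2
      (integrableOn_const (hs := ((Measure.restrict_apply_le _ _).trans_lt hKc.measure_lt_top).ne)))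
    (Filter.Eventually.of_forall fun x t _ => ?_)
  · have h2 := key.2
    simp only [hy0] at h2
    convert h2 using 1
    rw [← integral_smul]
    exact integral_congr_ae (Filter.Eventually.of_forall fun x => smul_comm _ _ _)
  · by_cases hx : G' (y t x) = 0
    · simp only [hx, smul_zero, norm_zero]
      refine Set.indicator_nonneg (fun _ _ => ?_) _
      have := (abs_nonneg _).trans (hC x)
      have := (norm_nonneg _).trans (hC' x)
      positivity
    · rw [Set.indicator_of_mem (hmemK x t ht hx), norm_smul, norm_smul, norm_neg]
      have h0 : 0 ≤ C := (abs_nonneg _).trans (hC x)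
      exact mul_le_mul (hC x) (mul_le_mul_of_nonneg_left (hC' _) (abs_nonneg _))
        (by positivity) h0
  · have h1 := hd (y t x)
    have h2 : HasDerivAt (fun t => x i + s i * (h i - t)) (-s i) t := by
      have := (((hasDerivAt_id t).const_sub (h i)).const_mul (s i)).const_add (x i)
      simpa using this
    have h3 : y t x i = x i + s i * (h i - t) := by simp [hy]
    rw [h3] at h1
    have h4 := (HasDerivAt.scomp t h1 h2).const_smul (P x)
    refine h4.congr_of_eventuallyEq (Filter.Eventually.of_forall fun τ => ?_)
    simp [hy]

/-- The family of `h`-derivatives of `∫_{t_i + s_i h_i ≥ 0} P ∂^b g`. -/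
def orthantFamily (s : ι → ℝ) (P : (ι → ℝ) → ℝ) (g : (ι → ℝ) → E) (b a : ι →₀ ℕ) (h : ι → ℝ) : E :=
  (a.prod fun i c => (-s i) ^ c) •
    ∫ x in orthant (fun i => s i * h i), P x • multiD g (b + a) x

lemma integrable_smul_ev_multiD {N : ℕ} {g : (ι → ℝ) → E} (hg : ContDiff ℝ N g)
    (hc : HasCompactSupport g) {P : (ι → ℝ) → ℝ} (hP : Measurable P)
    (hb : ∃ C : ℝ, ∀ x, |P x| ≤ C) {p : MvPolynomial ι ℝ}
    (hp : Room {a | a.degree ≤ N} 0 p) {ν : Measure (ι → ℝ)} [IsFiniteMeasureOnCompacts ν] :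
    Integrable (fun x => P x • ev (multiD g) p x) ν :=
  integrable_bdd_smul hP hb (continuous_ev_multiD hg hp) (hasCompactSupport_ev_multiD hc p)

/-- Differentiation is allowed exactly in the directions with `r i ≠ 0`, where the weight is
constant; `hN` ensures that `g` has all the derivatives which then fall on it. -/
lemma derivSystem_orthantFamily {N : ℕ} {g : (ι → ℝ) → E} (hg : ContDiff ℝ N g)
    (hc : HasCompactSupport g) (s : ι → ℝ) {P : (ι → ℝ) → ℝ} (hP : Measurable P)
    (hb : ∃ C : ℝ, ∀ x, |P x| ≤ C) {r : ι → ℕ} {b : ι →₀ ℕ}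
    (hPr : ∀ i, r i ≠ 0 → ∀ x t, P (Function.update x i t) = P x)
    (hN : ∀ a : ι →₀ ℕ, (∀ i, a i ≤ r i) → (b + a).degree ≤ N) :
    DerivSystem {a | ∀ i, a i ≤ r i} Set.univ (orthantFamily s P g b) := by
  have hcont : ∀ a : ι →₀ ℕ, (∀ i, a i ≤ r i) → Continuous (multiD g (b + a)) := fun a ha =>
    continuousOn_univ.1 ((derivSystem_multiD hg).cont _ (hN a ha))
  have hcs : ∀ a : ι →₀ ℕ, HasCompactSupport (multiD g (b + a)) := fun a =>
    hc.mono' ((subset_tsupport _).trans (tsupport_multiD_subset g _))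
  refine ⟨fun a ha => ?_, fun a i ha h _ => ?_⟩
  · exact ((continuous_setIntegral_orthant s hP hb (hcont a ha) (hcs a)).const_smul _).continuousOn
  · have hai : a i + 1 ≤ r i := by simpa using ha i
    have ha' : ∀ j, a j ≤ r j := fun j => le_trans (by simp) (ha j)
    have h1 := hasDerivAt_setIntegral_orthant s hP hb (hPr i (by omega)) (hcont a ha') (hcs a)
      (hcont _ ha) (hcs _) (fun x => by
        rw [← add_assoc]
        exact (derivSystem_multiD hg).deriv (b + a) i (by
          rw [add_assoc]; exact hN _ ha) x (Set.mem_univ x)) h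
    have h2 := h1.const_smul (a.prod fun i c => (-s i) ^ c)
    unfold orthantFamily
    rw [Finsupp.prod_add_index' (fun _ => pow_zero _) (fun _ _ _ => pow_add _ _ _),
      Finsupp.prod_single_index (by exact pow_zero _), pow_one, mul_smul]
    exact h2

/-- The substitution `X_i ↦ -s_i X_i`. -/
def flipVars (s : ι → ℝ) : MvPolynomial ι ℝ →ₐ[ℝ] MvPolynomial ι ℝ :=
  MvPolynomial.aeval fun i => (-s i) • MvPolynomial.X i

omit [Fintype ι] [DecidableEq ι] in
lemma flipVars_monomial (s : ι → ℝ) (a : ι →₀ ℕ) :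
    flipVars s (MvPolynomial.monomial a 1) =
      (a.prod fun i c => (-s i) ^ c) • MvPolynomial.monomial a 1 := by
  rw [flipVars, MvPolynomial.aeval_monomial, map_one, one_mul]
  simp only [smul_pow, MvPolynomial.smul_eq_C_mul (_ ^ _), Finsupp.prod_mul]
  rw [MvPolynomial.monomial_eq, map_one, one_mul, MvPolynomial.smul_eq_C_mul, map_finsuppProd]

omit [Fintype ι] [DecidableEq ι] in
-- Only even powers occur in `truncL`. This is the reason why the signs in the definition of the
-- remainder do not matter.
lemma flipVars_truncL {s : ι → ℝ} {i : ι} (hs : s i = 1 ∨ s i = -1) (k : ℕ) :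
    flipVars s (truncL k (MvPolynomial.X i)) = truncL k (MvPolynomial.X i) := by
  rw [map_truncL, flipVars, MvPolynomial.aeval_X]
  rcases hs with h | h
  · rw [h, neg_smul, one_smul, truncL_neg]
  · rw [h, neg_neg, one_smul]

/-- Polynomials in `∂/∂h` pass under the integral as polynomials in `∂/∂x`, each variable picking up
the factor `-s i`; the monomial in `b` is the derivative already present in the integrand. -/
lemma ev_orthantFamily {N : ℕ} {g : (ι → ℝ) → E} (hg : ContDiff ℝ N g)
    (hc : HasCompactSupport g) (s : ι → ℝ) {P : (ι → ℝ) → ℝ} (hP : Measurable P)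
    (hb : ∃ C : ℝ, ∀ x, |P x| ≤ C) {b : ι →₀ ℕ} {p : MvPolynomial ι ℝ}
    (hp : Room {a | a.degree ≤ N} b p) (h : ι → ℝ) :
    ev (orthantFamily s P g b) p h = ∫ x in orthant (fun i => s i * h i),
      P x • ev (multiD g) (MvPolynomial.monomial b 1 * flipVars s p) x := by
  have h1 : MvPolynomial.monomial b 1 * flipVars s p = ∑ a ∈ p.support,
      (p.coeff a * a.prod fun i c => (-s i) ^ c) • MvPolynomial.monomial (b + a) (1 : ℝ) := by
    conv_lhs => rw [← MvPolynomial.support_sum_monomial_coeff p]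
    rw [map_sum, Finset.mul_sum]
    refine Finset.sum_congr rfl fun a _ => ?_
    have : MvPolynomial.monomial a (p.coeff a) = p.coeff a • MvPolynomial.monomial a (1 : ℝ) := by
      rw [MvPolynomial.smul_monomial, smul_eq_mul, mul_one]
    rw [this, map_smul, flipVars_monomial, smul_smul, mul_smul_comm, MvPolynomial.monomial_mul,
      one_mul]
  rw [h1, map_sum, ev_eq_sum]
  simp only [map_smul, ev_monomial, Finset.sum_apply, Pi.smul_apply, Finset.smul_sum]
  rw [integral_finsetSum]
  · refine Finset.sum_congr rfl fun a _ => ?_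
    simp only [smul_comm (P _)]
    rw [integral_smul, orthantFamily, smul_smul]
  · intro a ha
    simp only [smul_comm (P _)]
    refine Integrable.smul _ ?_
    have := integrable_smul_ev_multiD hg hc hP hb (p := MvPolynomial.monomial (b + a) 1)
      (Room.monomial (by simpa [add_comm] using hp a ha)) (ν := volume.restrict
        (orthant fun i => s i * h i))
    simpa only [ev_monomial] using this

end Orthant

/-! ### The integrals in the definition of the remainder -/

section StdIntegral

variable {ι E : Type*} [Fintype ι] [DecidableEq ι] [NormedAddCommGroup E] [NormedSpace ℝ E]

/-- The product of the operators `L^{2k}` for `i ∈ I` and `(∂/∂x_i)^m` for `i ∉ I`. -/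
def mixedPoly (ι : Type*) [Fintype ι] [DecidableEq ι] (m k : ℕ) (I J : Finset ι) :
    MvPolynomial ι ℝ :=
  (∏ i ∈ I, truncL k (MvPolynomial.X i)) * ∏ i ∈ J, MvPolynomial.X i ^ m

omit [Fintype ι] [DecidableEq ι] in
lemma measurable_prod_periodicB (m : ℕ) (J : Finset ι) :
    Measurable fun x : ι → ℝ => ∏ i ∈ J, periodicB m (x i) :=
  Finset.measurable_prod _ fun i _ => (measurable_periodicB m).comp (measurable_pi_apply i)

omit [Fintype ι] [DecidableEq ι] in
lemma exists_abs_prod_periodicB_le (m : ℕ) (J : Finset ι) :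
    ∃ C : ℝ, ∀ x : ι → ℝ, |∏ i ∈ J, periodicB m (x i)| ≤ C := by
  obtain ⟨C, hC⟩ := exists_abs_periodicB_le m
  refine ⟨∏ i ∈ J, C, fun x => ?_⟩
  rw [Finset.abs_prod]
  exact Finset.prod_le_prod (fun _ _ => abs_nonneg _) fun i _ => hC _

omit [Fintype ι] [DecidableEq ι] in
lemma sum_single_degree (I : Finset ι) (c : ℕ) :
    (∑ i ∈ I, Finsupp.single i c).degree = c * I.card := by
  rw [map_sum]
  simp [mul_comm]

lemma mixedPoly_room {m k N : ℕ} {I J : Finset ι} {b : ι →₀ ℕ} (hb : b.degree + (2 * k * I.card + m * J.card) ≤ N) :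
    Room {a | a.degree ≤ N} b (mixedPoly ι m k I J) := by
  refine Room.prod_truncL (isLowerSet_degree_le N) I ?_
  rw [← mul_one (∏ i ∈ J, _)]
  refine Room.prod_X_pow J (Room.one ?_)
  simp only [Set.mem_ofPred_eq, map_add, sum_single_degree]
  omega

omit [Fintype ι] [DecidableEq ι] in
lemma prod_X_pow_eq_monomial (J : Finset ι) (m : ℕ) :
    ∏ i ∈ J, (MvPolynomial.X i : MvPolynomial ι ℝ) ^ m =
      MvPolynomial.monomial (∑ i ∈ J, Finsupp.single i m) 1 := by
  simp [MvPolynomial.monomial_sum_one, MvPolynomial.X_pow_eq_monomial]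

lemma mixedPartial_eq_multiD {g : (ι → ℝ) → E} (J : Finset ι) (m : ℕ)
    (hg : ContDiff ℝ (m * J.card : ℕ) g) :
    mixedPartial J (fun _ => m) g = multiD g (∑ i ∈ J, Finsupp.single i m) := by
  have := (derivSystem_multiD hg).mixedPartial_eqOn isOpen_univ (isLowerSet_degree_le _) J
    (fun _ => m) (p := 1) (Room.one (sum_single_degree J m).le) (f := g) (by
      rw [ev_one, multiD_zero]; exact fun _ _ => rfl)
  rw [mul_one, prod_X_pow_eq_monomial, ev_monomial] at this
  exact funext fun x => this (Set.mem_univ x)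

omit [Fintype ι] in
lemma prod_periodicB_update {m : ℕ} {J : Finset ι} {i : ι} (hi : i ∉ J) (x : ι → ℝ) (t : ℝ) :
    ∏ j ∈ J, periodicB m (Function.update x i t j) = ∏ j ∈ J, periodicB m (x j) :=
  Finset.prod_congr rfl fun j hj => by
    rw [Function.update_of_ne (ne_of_mem_of_not_mem hj hi)]

omit [Fintype ι] in
lemma degree_le_of_forall_le {I : Finset ι} {c : ℕ} {a : ι →₀ ℕ}
    (ha : ∀ i, a i ≤ if i ∈ I then c else 0) : a.degree ≤ c * I.card := by
  rw [← sum_single_degree]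
  refine Finsupp.degree_mono fun i => (ha i).trans ?_
  rw [Finsupp.finsetSum_apply]
  simp only [Finsupp.single_apply, Finset.sum_ite_eq']
  rfl

/-- Since `2⌊m/2⌋ ≤ m`, every coordinate costs at most `m` derivatives. This is where the hypothesis
of class `C^{mn}` comes from. -/
lemma card_compl_add_card (I : Finset ι) (m : ℕ) :
    m * Iᶜ.card + 2 * (m / 2) * I.card ≤ m * Fintype.card ι := by
  rw [← Finset.card_compl_add_card I, mul_add]
  gcongr
  omega

lemma stdIntegral_eq_orthantFamily {m : ℕ} {g : (ι → ℝ) → E}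
    (hg : ContDiff ℝ (m * Fintype.card ι : ℕ) g) (ε : ι → ℤˣ) (I : Finset ι) :
    stdIntegral m ε I g = orthantFamily (fun i => ((ε i : ℤ) : ℝ))
      (fun x => ∏ i ∈ Iᶜ, periodicB m (x i)) g (∑ i ∈ Iᶜ, Finsupp.single i m) 0 := by
  have := card_compl_add_card I m
  ext h
  simp only [stdIntegral, orthantFamily, Finsupp.prod_zero_index, one_smul, add_zero]
  rw [mixedPartial_eq_multiD _ _ (hg.of_le (by norm_cast; omega))]

/-- The periodic factors live in the coordinates outside `I` and the derivatives in `h` are taken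
only inside `I`, so the two never meet. -/
lemma derivSystem_stdIntegral {m : ℕ} {g : (ι → ℝ) → E}
    (hg : ContDiff ℝ (m * Fintype.card ι : ℕ) g) (hc : HasCompactSupport g) (s : ι → ℝ)
    (I : Finset ι) : DerivSystem {a | ∀ i, a i ≤ if i ∈ I then 2 * (m / 2) else 0} Set.univ
      (orthantFamily s (fun x => ∏ i ∈ Iᶜ, periodicB m (x i)) g
        (∑ i ∈ Iᶜ, Finsupp.single i m)) := by
  refine derivSystem_orthantFamily hg hc s (measurable_prod_periodicB m _)
    (exists_abs_prod_periodicB_le m _) (fun i hi x t => ?_) fun a ha => ?_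
  · refine prod_periodicB_update ?_ x t
    simp only [Finset.mem_compl, not_not]
    by_contra h
    simp [h] at hi
  · rw [map_add, sum_single_degree]
    have := card_compl_add_card I m
    have := degree_le_of_forall_le ha
    omega

lemma hasContinuousPartials_stdIntegral {m : ℕ} {g : (ι → ℝ) → E}
    (hg : ContDiff ℝ (m * Fintype.card ι : ℕ) g) (hc : HasCompactSupport g) (ε : ι → ℤˣ)
    (I : Finset ι) :
    HasContinuousPartials (fun i => if i ∈ I then 2 * (m / 2) else 0) (stdIntegral m ε I g) := by
  refine (derivSystem_stdIntegral hg hc (fun i => ((ε i : ℤ) : ℝ)) I).hasContinuousPartials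
    isOpen_univ (Set.mem_univ _) ?_
  rw [stdIntegral_eq_orthantFamily hg]
  exact fun _ _ => rfl

lemma units_cast_eq (ε : ℤˣ) : ((ε : ℤ) : ℝ) = 1 ∨ ((ε : ℤ) : ℝ) = -1 := by
  rcases Int.units_eq_one_or ε with rfl | rfl <;> simp

lemma ev_orthantFamily_prod_truncL {m : ℕ} {g : (ι → ℝ) → E}
    (hg : ContDiff ℝ (m * Fintype.card ι : ℕ) g) (hc : HasCompactSupport g) {s : ι → ℝ}
    (hs : ∀ i, s i = 1 ∨ s i = -1) (I : Finset ι) (h : ι → ℝ) :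
    ev (orthantFamily s (fun x => ∏ i ∈ Iᶜ, periodicB m (x i)) g (∑ i ∈ Iᶜ, Finsupp.single i m))
      (∏ i ∈ I, truncL (m / 2) (MvPolynomial.X i)) h =
    ∫ x in orthant (fun i => s i * h i), (∏ i ∈ Iᶜ, periodicB m (x i)) •
      ev (multiD g) (mixedPoly ι m (m / 2) I Iᶜ) x := by
  have := card_compl_add_card I m
  rw [ev_orthantFamily hg hc s (measurable_prod_periodicB m _) (exists_abs_prod_periodicB_le m _),
    map_prod, mixedPoly, mul_comm, prod_X_pow_eq_monomial,
    Finset.prod_congr rfl fun i _ => flipVars_truncL (hs i) (m / 2)]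
  rw [← mul_one (∏ i ∈ I, _)]
  refine Room.prod_truncL (isLowerSet_degree_le _) I (Room.one ?_)
  simp only [Set.mem_ofPred_eq, map_add, sum_single_degree]
  omega

/-- The operators `L^{2k}(∂/∂h_i)` act on `stdIntegral` as differential operators under the
integral; in particular the result does not depend on the signs. -/
lemma prodOpL_stdIntegral {m : ℕ} {g : (ι → ℝ) → E}
    (hg : ContDiff ℝ (m * Fintype.card ι : ℕ) g) (hc : HasCompactSupport g) (ε : ι → ℤˣ)
    (I : Finset ι) :
    prodOpL (m / 2) I (stdIntegral m ε I g) 0 = ∫ x in orthant 0,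
      (∏ i ∈ Iᶜ, periodicB m (x i)) • ev (multiD g) (mixedPoly ι m (m / 2) I Iᶜ) x := by
  have hlow : IsLowerSet {a : ι →₀ ℕ | ∀ i, a i ≤ if i ∈ I then 2 * (m / 2) else 0} :=
    fun a b hab ha i => (hab i).trans (ha i)
  have h := (derivSystem_stdIntegral hg hc (fun i => ((ε i : ℤ) : ℝ)) I).prodOpL_eqOn isOpen_univ
    hlow (k := m / 2) I (p := 1) (Room.one (fun i => by
      rw [Finsupp.finsetSum_apply]
      simp only [Finsupp.single_apply, Finset.sum_ite_eq']
      rfl)) (f := stdIntegral m ε I g) (by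
      rw [ev_one, stdIntegral_eq_orthantFamily hg]; exact fun _ _ => rfl) (Set.mem_univ 0)
  rw [h, mul_one, ev_orthantFamily_prod_truncL hg hc (fun i => units_cast_eq (ε i))]
  simp only [Pi.zero_apply, mul_zero]
  rfl

end StdIntegral


/-! ### The Euler–Maclaurin formula for the standard orthant -/

section Fubini

variable {ι E : Type*} [Fintype ι] [DecidableEq ι] [NormedAddCommGroup E] [NormedSpace ℝ E]

/-- Fubini with one coordinate split off. The placeholder `0` at position `i` is overwritten by
`Function.update`. -/
lemma integral_pi_eq_integral_update (μ : ι → Measure ℝ) [∀ i, SigmaFinite (μ i)] (i : ι)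
    {G : (ι → ℝ) → E} (hG : Integrable G (Measure.pi μ)) :
    ∫ x, G x ∂Measure.pi μ =
      ∫ y : {j // ¬ j = i} → ℝ, ∫ t, G (Function.update
        (fun j => if h : j = i then 0 else y ⟨j, h⟩) i t) ∂μ i
        ∂Measure.pi (fun j : {j // ¬ j = i} => μ j) := by
  have hmp := (measurePreserving_piEquivPiSubtypeProd μ (fun j => j = i)).symm
  rw [← hmp.integral_comp', integral_prod_symm
    (fun z => G ((MeasurableEquiv.piEquivPiSubtypeProd (fun _ => ℝ) fun j => j = i).symm z))
    ((hmp.integrable_comp_emb (MeasurableEquiv.measurableEmbedding _)).2 hG)]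
  refine integral_congr_ae (Filter.Eventually.of_forall fun y => ?_)
  have hmp2 := (measurePreserving_piUnique (fun j : {j // j = i} => μ j)).symm
  simp only
  refine Eq.trans (Eq.trans ?_ (hmp2.integral_comp' (fun a => G
    ((MeasurableEquiv.piEquivPiSubtypeProd (fun _ => ℝ) fun j => j = i).symm (a, y)))).symm) ?_
  · congr!
  refine integral_congr_ae (Filter.Eventually.of_forall fun t => ?_)
  simp only
  congr 1
  ext j
  by_cases hj : j = i
  · subst hj
    simp [MeasurableEquiv.piEquivPiSubtypeProd, Equiv.piEquivPiSubtypeProd]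
  · simp [MeasurableEquiv.piEquivPiSubtypeProd, Equiv.piEquivPiSubtypeProd, hj]

/-- To exchange the measure in a single coordinate it suffices to compare integrals along lines in
that direction. This is how a one-dimensional summation formula enters a product. -/
lemma integral_pi_congr_update (μ : ι → Measure ℝ) [∀ i, SigmaFinite (μ i)] (μ' : ι → Measure ℝ)
    [∀ i, SigmaFinite (μ' i)] (i : ι) (hμ : ∀ j, j ≠ i → μ j = μ' j) {G G' : (ι → ℝ) → E}
    (hG : Integrable G (Measure.pi μ)) (hG' : Integrable G' (Measure.pi μ'))
    (h : ∀ x : ι → ℝ, ∫ t, G (Function.update x i t) ∂μ i =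
      ∫ t, G' (Function.update x i t) ∂μ' i) :
    ∫ x, G x ∂Measure.pi μ = ∫ x, G' x ∂Measure.pi μ' := by
  rw [integral_pi_eq_integral_update μ i hG, integral_pi_eq_integral_update μ' i hG']
  have : (fun j : {j // ¬ j = i} => μ j) = fun j : {j // ¬ j = i} => μ' j :=
    funext fun j => hμ j j.2
  simp only [h, this]

end Fubini

/-! ### Replacing sums by integrals one coordinate at a time -/

section EulerMaclaurin

/-- The measure `∑_{0 ≤ z ≤ N}' δ_z`, the atom at `z = 0` having weight `1/2`. -/
def sumMeasure (N : ℕ) : Measure ℤ :=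
  ∑ z ∈ Finset.range (N + 1), ENNReal.ofReal (halfStep z) • Measure.dirac (z : ℤ)

instance isFiniteMeasure_sumMeasure (N : ℕ) : IsFiniteMeasure (sumMeasure N) := by
  refine ⟨?_⟩
  rw [sumMeasure, Measure.finsetSum_apply]
  refine ENNReal.sum_lt_top.2 fun z _ => ?_
  simp

lemma sumMeasure_real_singleton {N : ℕ} {a : ℤ} (ha : a ≤ N) :
    (sumMeasure N).real {a} = halfStep a := by
  have h1 : sumMeasure N {a} = ENNReal.ofReal (halfStep a) := by
    rw [sumMeasure, Measure.finsetSum_apply]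
    simp only [Measure.smul_apply, smul_eq_mul, Measure.dirac_apply, Set.indicator_apply,
      Set.mem_singleton_iff, Pi.one_apply, mul_ite, mul_one, mul_zero]
    rcases lt_or_ge a 0 with h | h
    · rw [halfStep_of_neg (by exact_mod_cast h), Finset.sum_eq_zero]
      · simp
      · intro z _
        rw [if_neg (by omega)]
    · lift a to ℕ using h
      rw [Finset.sum_eq_single a]
      · simp
      · intro z _ hz
        rw [if_neg (by exact_mod_cast hz)]
      · intro h
        simp only [Finset.mem_range] at h
        omega
  rw [Measure.real, h1, ENNReal.toReal_ofReal (halfStep_nonneg _)]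

variable {ι E : Type*} [Fintype ι] [NormedAddCommGroup E] [NormedSpace ℝ E]

lemma integral_map_sumMeasure [CompleteSpace E] (N : ℕ) (G : ℝ → E) :
    ∫ t, G t ∂(sumMeasure N).map (fun z : ℤ => (z : ℝ)) =
      ∑ z ∈ Finset.range (N + 1), halfStep z • G z := by
  have hme : MeasurableEmbedding (fun z : ℤ => (z : ℝ)) :=
    Int.isClosedEmbedding_coe_real.measurableEmbedding
  rw [hme.integral_map, sumMeasure, integral_finsetSum_measure]
  · refine Finset.sum_congr rfl fun z _ => ?_
    rw [integral_smul_measure, integral_dirac, ENNReal.toReal_ofReal (halfStep_nonneg _)]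
    simp
  · intro z _
    exact (integrable_dirac (by simp)).smul_measure ENNReal.ofReal_ne_top

/-- The lattice sum is written as an integral for a product measure, so that sums and Lebesgue
integrals obey the same Fubini argument. Truncation at `N` is harmless because `g` vanishes beyond
it. -/
lemma integral_pi_sumMeasure [CompleteSpace E] {N : ℕ} {g : (ι → ℝ) → E}
    (hg : Continuous g) (hc : HasCompactSupport g) (hN : ∀ x, ∀ i, (N : ℝ) ≤ x i → g x = 0) :
    ∫ x, g x ∂Measure.pi (fun _ : ι => (sumMeasure N).map (fun z : ℤ => (z : ℝ))) =
      ∑' z : ι → ℤ, (∏ i, halfStep (z i)) • g (fun i => (z i : ℝ)) := by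
  have hme : Measurable (fun z : ℤ => (z : ℝ)) := measurable_of_countable _
  have hme' : Measurable (fun (z : ι → ℤ) (i : ι) => (z i : ℝ)) := measurable_of_countable _
  rw [← Measure.pi_map_pi (fun _ => hme.aemeasurable),
    integral_map hme'.aemeasurable hg.aestronglyMeasurable, integral_countable]
  · refine tsum_congr fun z => ?_
    by_cases hz : ∀ i, z i ≤ N
    · congr 1
      rw [Measure.real, Measure.pi_singleton, ENNReal.toReal_prod]
      exact Finset.prod_congr rfl fun i _ => sumMeasure_real_singleton (hz i)
    · push Not at hz
      obtain ⟨i, hi⟩ := hz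
      rw [hN _ i (by exact_mod_cast hi.le), smul_zero, smul_zero]
  · refine (integrable_map_measure hg.aestronglyMeasurable hme'.aemeasurable).1 ?_
    rw [Measure.pi_map_pi (fun _ => hme.aemeasurable)]
    exact hg.integrable_of_hasCompactSupport hc

lemma setIntegral_Ici_eq_intervalIntegral {N : ℕ} {ψ : ℝ → E} (h : ∀ t, (N : ℝ) ≤ t → ψ t = 0) :
    ∫ t in Set.Ici 0, ψ t = ∫ t in (0 : ℝ)..N, ψ t := by
  rw [integral_Ici_eq_integral_Ioi, intervalIntegral.integral_of_le (Nat.cast_nonneg N)]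
  refine setIntegral_eq_of_subset_of_forall_sdiff_eq_zero measurableSet_Ioi
    Set.Ioc_subset_Ioi_self fun t ht => h t ?_
  by_contra hlt
  exact ht.2 ⟨ht.1, (not_le.1 hlt).le⟩

/-- Lebesgue measure on `[0, ∞)` in the coordinates in `S` and the weighted counting measure in the
other coordinates. -/
def mixedMeasure [DecidableEq ι] (N : ℕ) (S : Finset ι) (i : ι) : Measure ℝ :=
  if i ∈ S then volume.restrict (Set.Ici 0) else (sumMeasure N).map (fun z : ℤ => (z : ℝ))

instance sigmaFinite_mixedMeasure [DecidableEq ι] (N : ℕ) (S : Finset ι) (i : ι) :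
    SigmaFinite (mixedMeasure N S i) := by
  unfold mixedMeasure; split_ifs <;> infer_instance

instance isLocallyFiniteMeasure_mixedMeasure [DecidableEq ι] (N : ℕ) (S : Finset ι) (i : ι) :
    IsLocallyFiniteMeasure (mixedMeasure N S i) := by
  unfold mixedMeasure; split_ifs <;> infer_instance

variable [DecidableEq ι] [CompleteSpace E]

/-- The half-line formula in coordinate `i`, with all others frozen. The periodic factors already
present have indices in `J`, which excludes `i`, and are constants along the line. -/
lemma integral_mixedMeasure_insert {m M N : ℕ} (hm : 1 ≤ m) {g : (ι → ℝ) → E}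
    (hg : ContDiff ℝ M g) (hc : HasCompactSupport g)
    (hN : ∀ x ∈ tsupport g, ∀ i, x i < N) {S J : Finset ι} {i : ι} (hS : i ∉ S) (hJ : i ∉ J)
    {p : MvPolynomial ι ℝ} (hp : Room {a | a.degree ≤ M} (Finsupp.single i m) p) :
    ∫ x, (∏ j ∈ J, periodicB m (x j)) • ev (multiD g) p x ∂Measure.pi (mixedMeasure N S) =
      (∫ x, (∏ j ∈ J, periodicB m (x j)) • ev (multiD g) (truncL (m / 2) (MvPolynomial.X i) * p) x
        ∂Measure.pi (mixedMeasure N (insert i S))) +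
      (-1 : ℝ) ^ (m - 1) • ∫ x, (∏ j ∈ insert i J, periodicB m (x j)) •
        ev (multiD g) (MvPolynomial.X i ^ m * p) x
          ∂Measure.pi (mixedMeasure N (insert i S)) := by
  have hlow := isLowerSet_degree_le (ι := ι) M
  have hrl : ∀ l ≤ m, Room {a : ι →₀ ℕ | a.degree ≤ M} 0 (MvPolynomial.X i ^ l * p) := fun l hl =>
    Room.X_pow_mul l (hp.mono hlow (by rw [zero_add]; gcongr))
  have hcl : ∀ l ≤ m, Continuous (ev (multiD g) (MvPolynomial.X i ^ l * p)) := fun l hl =>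
    continuous_ev_multiD hg (hrl l hl)
  have hrp : Room {a : ι →₀ ℕ | a.degree ≤ M} 0 p := hp.mono hlow (by simp)
  have hrL : Room {a : ι →₀ ℕ | a.degree ≤ M} 0 (truncL (m / 2) (MvPolynomial.X i) * p) :=
    Room.truncL_mul hlow (hp.mono hlow (by
      rw [zero_add, Finsupp.single_le_single]; omega))
  have hi1 := integrable_smul_ev_multiD hg hc (measurable_prod_periodicB m J)
    (exists_abs_prod_periodicB_le m J) hrL (ν := Measure.pi (mixedMeasure N (insert i S)))
  have hi2 := integrable_smul_ev_multiD hg hc (measurable_prod_periodicB m (insert i J))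
    (exists_abs_prod_periodicB_le m (insert i J)) (hrl m le_rfl)
    (ν := Measure.pi (mixedMeasure N (insert i S)))
  rw [← integral_smul]
  refine Eq.trans ?_ (integral_add hi1 (hi2.smul _))
  refine integral_pi_congr_update _ _ i (fun j hj => ?_)
    (integrable_smul_ev_multiD hg hc (measurable_prod_periodicB m J)
      (exists_abs_prod_periodicB_le m J) hrp) (hi1.add (hi2.smul _)) fun x => ?_
  · simp [mixedMeasure, hj]
  · have hvan : ∀ q t, (N : ℝ) ≤ t → ev (multiD g) q (Function.update x i t) = 0 := fun q t ht =>
      ev_multiD_eq_zero (fun hmem => by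
        have := hN _ hmem i
        rw [Function.update_self] at this
        linarith) q
    have hcu : Continuous (Function.update x i) := by fun_prop
    set φ : ℕ → ℝ → E := fun l t =>
      ev (multiD g) (MvPolynomial.X i ^ l * p) (Function.update x i t) with hφ
    have hderiv : ∀ l < m, ∀ t, HasDerivAt (φ l) (φ (l + 1) t) t := by
      intro l hl t
      have hroom : Room {a : ι →₀ ℕ | a.degree ≤ M} (Finsupp.single i 1)
          (MvPolynomial.X i ^ l * p) := by
        refine Room.X_pow_mul l (hp.mono hlow ?_)
        rw [← Finsupp.single_add, Finsupp.single_le_single]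
        omega
      have := (derivSystem_multiD hg).hasDerivAt_ev hroom (Set.mem_univ (Function.update x i t))
      rw [Function.update_self] at this
      simpa [hφ, pow_succ', mul_assoc] using this
    have h1 := sum_halfStep_eq_intervalIntegral (N := N) hm hderiv
      (fun l hl => (hcl l hl).comp hcu) (fun l _ => hvan _ _ le_rfl)
    have hmu : mixedMeasure N S i = (sumMeasure N).map (fun z : ℤ => (z : ℝ)) := by
      simp [mixedMeasure, hS]
    have hmu' : mixedMeasure N (insert i S) i = volume.restrict (Set.Ici 0) := by
      simp [mixedMeasure]
    have hprod : ∀ t, ∏ j ∈ J, periodicB m (Function.update x i t j) =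
      ∏ j ∈ J, periodicB m (x j) := fun t => prod_periodicB_update hJ x t
    simp only [Finset.prod_insert hJ, hprod, Function.update_self]
    rw [hmu, hmu', integral_map_sumMeasure, setIntegral_Ici_eq_intervalIntegral
      (fun t ht => by simp only [hvan _ t ht, smul_zero, add_zero]),
      intervalIntegral.integral_add, intervalIntegral.integral_smul,
      intervalIntegral.integral_smul]
    · simp only [mul_comm (periodicB m _), mul_smul, intervalIntegral.integral_smul,
        smul_comm (halfStep _)]
      have h2 : ∑ z ∈ Finset.range (N + 1),
          halfStep z • ev (multiD g) p (Function.update x i z) =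
          ∑ z ∈ Finset.range (N + 1), halfStep z • φ 0 z := by simp [hφ]
      rw [← Finset.smul_sum, h2, h1, smul_add, smul_comm ((-1 : ℝ) ^ (m - 1))]
      congr 2
      have h3 : ∀ t, ev (multiD g) (truncL (m / 2) (MvPolynomial.X i) * p)
          (Function.update x i t) = ∑ j ∈ Finset.range (m / 2 + 1),
            ((bernoulli (2 * j) : ℝ) / ((2 * j).factorial : ℝ)) • φ (2 * j) t := fun t => by
        simp [truncL, Finset.sum_mul, hφ]
      simp only [h3]
      rw [intervalIntegral.integral_finsetSum]
      · simp only [intervalIntegral.integral_smul]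
      · intro j hj
        have : j ≤ m / 2 := by simpa [Nat.lt_succ_iff] using hj
        exact (((hcl (2 * j) (by omega)).comp hcu).const_smul _).intervalIntegrable _ _
    · exact (((continuous_ev_multiD hg hrL).comp hcu).const_smul _).intervalIntegrable _ _
    · have := ((integrable_periodicB_smul m ((hcl m le_rfl).comp hcu) 0 (N : ℝ)).smul
        (∏ j ∈ J, periodicB m (x j))).smul ((-1 : ℝ) ^ (m - 1))
      refine this.congr fun t _ => ?_
      simp [mul_comm (periodicB m t), mul_smul]

/-- Induction on the set `S` of coordinates already converted. A new coordinate contributes either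
the operator `L^{2k}`, and joins `I`, or a periodic factor with an `m`-th derivative; this is the
recursion for subsets of `insert i S`. -/
lemma integral_pi_mixedMeasure {m N : ℕ} (hm : 1 ≤ m) {g : (ι → ℝ) → E}
    (hg : ContDiff ℝ (m * Fintype.card ι : ℕ) g) (hc : HasCompactSupport g)
    (hN : ∀ x ∈ tsupport g, ∀ i, x i < N) (S : Finset ι) :
    ∫ x, g x ∂Measure.pi (mixedMeasure N ∅) =
      ∑ I ∈ S.powerset, (-1 : ℝ) ^ ((m - 1) * (S \ I).card) •
        ∫ x, (∏ i ∈ S \ I, periodicB m (x i)) •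
          ev (multiD g) (mixedPoly ι m (m / 2) I (S \ I)) x ∂Measure.pi (mixedMeasure N S) := by
  induction S using Finset.induction_on with
  | empty => simp [mixedPoly, ev_one, multiD_zero]
  | insert i S hi ih =>
    rw [ih, Finset.sum_powerset_insert hi, ← Finset.sum_add_distrib]
    refine Finset.sum_congr rfl fun I hI => ?_
    rw [Finset.mem_powerset] at hI
    have hiI : i ∉ I := fun h => hi (hI h)
    have e1 : insert i S \ insert i I = S \ I := by
      ext j; simp only [Finset.mem_sdiff, Finset.mem_insert]
      grind
    have e2 : insert i S \ I = insert i (S \ I) := Finset.insert_sdiff_of_notMem _ hiI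
    have hiJ : i ∉ S \ I := fun h => hi (Finset.mem_sdiff.1 h).1
    have hcard : I.card + (S \ I).card + 1 ≤ Fintype.card ι := by
      rw [← Finset.card_union_of_disjoint Finset.disjoint_sdiff,
        Finset.union_sdiff_of_subset hI, ← Finset.card_insert_of_notMem hi]
      exact Finset.card_le_univ _
    rw [integral_mixedMeasure_insert hm hg hc hN hi hiJ (mixedPoly_room ?_), smul_add, e1, e2,
      Finset.card_insert_of_notMem hiJ, mul_add, mul_one, pow_add, mul_smul, add_comm]
    · congr 4
      · ext x
        simp only [mixedPoly, Finset.prod_insert hiJ]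
        congr 3
        ring_nf
      · ext x
        rw [mixedPoly, mixedPoly, Finset.prod_insert hiI, mul_assoc]
    · rw [Finsupp.degree_single]
      calc m + (2 * (m / 2) * I.card + m * (S \ I).card)
          ≤ m + (m * I.card + m * (S \ I).card) := by gcongr; omega
        _ = m * (I.card + (S \ I).card + 1) := by ring
        _ ≤ _ := by gcongr

/-- The Euler–Maclaurin formula with remainder for the standard orthant. -/
theorem tsum_halfStep_eq {m : ℕ} (hm : 1 ≤ m) {g : (ι → ℝ) → E}
    (hg : ContDiff ℝ (m * Fintype.card ι : ℕ) g) (hc : HasCompactSupport g) (ε : ι → ℤˣ) :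
    ∑' z : ι → ℤ, (∏ i, halfStep (z i)) • g (fun i => (z i : ℝ)) =
      (∫ x in orthant 0, ev (multiD g) (∏ i, truncL (m / 2) (MvPolynomial.X i)) x) +
        stdRemainder m ε g := by
  obtain ⟨N, hN⟩ : ∃ N : ℕ, ∀ x ∈ tsupport g, ∀ i, x i < N := by
    obtain ⟨C, hC⟩ := hc.isCompact.isBounded.exists_norm_le
    obtain ⟨N, hN⟩ := exists_nat_gt C
    exact ⟨N, fun x hx i => (((le_abs_self _).trans (norm_le_pi_norm x i)).trans
      (hC x hx)).trans_lt hN⟩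
  have h := integral_pi_mixedMeasure hm hg hc hN Finset.univ
  have hmu : mixedMeasure N (∅ : Finset ι) =
      fun _ => (sumMeasure N).map (fun z : ℤ => (z : ℝ)) := by
    ext1 i; simp [mixedMeasure]
  have hmu' : Measure.pi (mixedMeasure N (Finset.univ : Finset ι)) =
      volume.restrict (orthant 0) := by
    have : mixedMeasure N (Finset.univ : Finset ι) =
        fun _ => volume.restrict (Set.Ici (0 : ℝ)) := by
      ext1 i; simp [mixedMeasure]
    rw [this, ← Measure.restrict_pi_pi, ← volume_pi]
    congr 1
    ext x
    simp [orthant, Pi.le_def]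
  rw [hmu, integral_pi_sumMeasure hg.continuous hc (fun x i hx =>
    image_eq_zero_of_notMem_tsupport fun hmem => (hN x hmem i).not_ge hx), hmu'] at h
  -- The subset consisting of all coordinates carries no periodic factor and is the main term; the
  -- proper subsets form the remainder.
  rw [h, Finset.powerset_univ, ← Finset.insert_erase (Finset.mem_univ (Finset.univ : Finset ι)),
    Finset.sum_insert (Finset.notMem_erase _ _), stdRemainder]
  congr 1
  · simp [mixedPoly]
  · refine Finset.sum_congr ?_ fun I _ => ?_
    · ext I
      simp [Finset.ssubset_univ_iff]
    · rw [prodOpL_stdIntegral hg hc, ← Finset.compl_eq_univ_sdiff, Finset.card_compl]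

end EulerMaclaurin


/-! ### Edges of a polytope at a vertex -/

section ExposedRays

open scoped NNReal

variable {V : Type*} [AddCommGroup V] [Module ℝ V]

lemma convex_span_nnreal (T : Set V) : Convex ℝ (Submodule.span ℝ≥0 T : Set V) := by
  intro x hx y hy a b ha hb _
  have h1 := Submodule.smul_mem (Submodule.span ℝ≥0 T) (⟨a, ha⟩ : ℝ≥0) hx
  have h2 := Submodule.smul_mem (Submodule.span ℝ≥0 T) (⟨b, hb⟩ : ℝ≥0) hy
  exact add_mem h1 h2

/-- An extreme point is not a convex combination of the remaining generators. In geometric terms,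
the cone of directions at a vertex contains no line. -/
lemma zero_notMem_convexHull_sub {S : Set V} {v : V} (hv : v ∈ (convexHull ℝ S).extremePoints ℝ) :
    (0 : V) ∉ convexHull ℝ ((fun s => s - v) '' (S \ {v})) := by
  intro h0
  rw [(convex_convexHull ℝ S).mem_extremePoints_iff_mem_sdiff_convexHull_sdiff] at hv
  refine hv.2 (convexHull_mono (s := S \ {v})
    (Set.sdiff_subset_sdiff_left (subset_convexHull ℝ S)) ?_)
  have himg : (fun s => s - v) '' (S \ {v}) = (AffineEquiv.constVAdd ℝ V (-v)) '' (S \ {v}) := by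
    refine Set.image_congr fun s _ => ?_
    simp [sub_eq_neg_add]
  rw [himg] at h0
  have := (AffineMap.image_convexHull (AffineEquiv.constVAdd ℝ V (-v)).toAffineMap (S \ {v}))
  rw [AffineEquiv.coe_toAffineMap] at this
  rw [← this] at h0
  obtain ⟨w, hw, hw0⟩ := h0
  have : w = v := by
    have : -v + w = 0 := by simpa using hw0
    rwa [neg_add_eq_zero, eq_comm] at this
  rwa [this] at hw

variable [TopologicalSpace V] [IsTopologicalAddGroup V] [ContinuousSMul ℝ V] [T2Space V]
  [LocallyConvexSpace ℝ V]

/-- At a vertex of a polytope, the cone of directions is generated by vectors that lie on exposed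
rays. -/
lemma exists_exposed_rays {S : Set V} (hS : S.Finite) {v : V}
    (hv : v ∈ (convexHull ℝ S).extremePoints ℝ) :
    ∃ T : Finset V, (∀ s ∈ T, s ≠ 0 ∧ v + s ∈ S) ∧
      (∀ x ∈ convexHull ℝ S, ∃ c : V → ℝ, (∀ t, 0 ≤ c t) ∧ x - v = ∑ t ∈ T, c t • t) ∧
      ∀ s ∈ T, ∃ l : StrongDual ℝ V, l s = 0 ∧ ∀ t ∈ T, t ≠ s → l t < 0 := by
  classical
  set T₀ : Finset V := (hS.toFinset.erase v).image fun s => s - v with hT₀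
  have hT₀' : (T₀ : Set V) = (fun s => s - v) '' (S \ {v}) := by
    rw [hT₀]
    ext x
    simp [and_comm]
  have hzero := zero_notMem_convexHull_sub hv
  rw [← hT₀'] at hzero
  -- A generating set of the cone of least cardinality contains no redundant direction, which forces
  -- each of its members to be extremal.
  obtain ⟨T, hT, hmin⟩ := Finset.exists_min_image
    (T₀.powerset.filter fun T : Finset V => (T₀ : Set V) ⊆ Submodule.span ℝ≥0 (T : Set V)) Finset.card
    ⟨T₀, by simp⟩
  rw [Finset.mem_filter, Finset.mem_powerset] at hT
  obtain ⟨hTT₀, hspan⟩ := hT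
  have hTmem : ∀ s ∈ T, s ≠ 0 ∧ v + s ∈ S := by
    intro s hs
    have : s ∈ (T₀ : Set V) := hTT₀ hs
    rw [hT₀'] at this
    obtain ⟨w, ⟨hw, hwv⟩, rfl⟩ := this
    exact ⟨sub_ne_zero.2 hwv, by simpa using hw⟩
  refine ⟨T, hTmem, fun x hx => ?_, fun s hs => ?_⟩
  · have hsub : convexHull ℝ S ⊆ (fun x => x - v) ⁻¹' (Submodule.span ℝ≥0 (T : Set V) : Set V) := by
      refine convexHull_min (fun s hs => ?_) ?_
      · rcases eq_or_ne s v with rfl | hsv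
        · simp
        · refine hspan ?_
          rw [hT₀']
          exact ⟨s, ⟨hs, hsv⟩, rfl⟩
      · simp only [sub_eq_neg_add]
        exact (convex_span_nnreal _).translate_preimage_right (-v)
    obtain ⟨c, -, hc⟩ := Submodule.mem_span_finset.1 (hsub hx)
    exact ⟨fun t => c t, fun t => (c t).2, hc.symm⟩
  -- The hull of the other generators misses the line through `s`. A common point `c • s` with `c ≤
  -- 0` would put zero in the convex hull of the directions; with `c > 0` it would make `s`
  -- redundant. Separating the two sets yields the functional.
  · have hdisj : Disjoint (convexHull ℝ (T.erase s : Set V)) (Submodule.span ℝ {s} : Set V) := by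
      rw [Set.disjoint_left]
      intro y hy hys
      obtain ⟨c, rfl⟩ := Submodule.mem_span_singleton.1 hys
      rcases le_or_gt c 0 with hc | hc
      · refine hzero ?_
        have h1 : c • s ∈ convexHull ℝ (T₀ : Set V) :=
          convexHull_mono (fun t ht => hTT₀ (Finset.mem_of_mem_erase ht)) hy
        have h2 : s ∈ convexHull ℝ (T₀ : Set V) := subset_convexHull ℝ _ (hTT₀ hs)
        have h3 : 0 < 1 - c := by linarith
        have := (convex_convexHull ℝ (T₀ : Set V)) h1 h2 (a := 1 / (1 - c)) (b := -c / (1 - c))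
          (by positivity) (div_nonneg (by linarith) h3.le) (by field_simp; ring)
        convert this using 1
        rw [smul_smul, ← add_smul]
        have : 1 / (1 - c) * c + -c / (1 - c) = 0 := by ring
        rw [this, zero_smul]
      · have h1 : c • s ∈ Submodule.span ℝ≥0 (T.erase s : Set V) :=
          convexHull_min Submodule.subset_span (convex_span_nnreal _) hy
        have h2 : s ∈ Submodule.span ℝ≥0 (T.erase s : Set V) := by
          have := Submodule.smul_mem _ (c⁻¹).toNNReal h1
          rwa [NNReal.smul_def, Real.coe_toNNReal _ (inv_nonneg.2 hc.le),
            inv_smul_smul₀ hc.ne'] at this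
        have h3 : (T₀ : Set V) ⊆ Submodule.span ℝ≥0 (T.erase s : Set V) := by
          refine hspan.trans ?_
          rw [SetLike.coe_subset_coe, Submodule.span_le]
          intro t ht
          rcases eq_or_ne t s with rfl | hts
          · exact h2
          · exact Submodule.subset_span (Finset.mem_coe.2 (Finset.mem_erase.2 ⟨hts, ht⟩))
        have h4 := hmin (T.erase s) (Finset.mem_filter.2
          ⟨Finset.mem_powerset.2 ((Finset.erase_subset _ _).trans hTT₀), h3⟩)
        exact absurd h4 (not_le.2 (Finset.card_erase_lt_of_mem hs))
    obtain ⟨l, a, b, hla, hab, hlb⟩ := geometric_hahn_banach_compact_closed (convex_convexHull ℝ _)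
      ((T.erase s).finite_toSet.isCompact_convexHull ℝ) (Submodule.span ℝ {s}).convex
      (Submodule.closed_of_finiteDimensional _) hdisj
    have hb0 : b < 0 := by simpa using hlb 0 (Submodule.zero_mem _)
    -- A linear functional bounded below on a line vanishes on it.
    have hls : l s = 0 := by
      by_contra hne
      have := hlb ((b / l s) • s) (Submodule.smul_mem _ _ (Submodule.mem_span_singleton_self s))
      rw [map_smul, smul_eq_mul, div_mul_cancel₀ _ hne] at this
      exact lt_irrefl _ this
    refine ⟨l, hls, fun t ht hts => ?_⟩
    have := hla t (subset_convexHull ℝ _ (Finset.mem_coe.2 (Finset.mem_erase.2 ⟨hts, ht⟩)))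
    linarith

end ExposedRays

/-! ### The lattice basis formed by the edges at a vertex -/

section Vertex

variable {n : ℕ}

lemma intVec_smul (c : ℤ) (z : Fin n → ℤ) : intVec (c • z) = (c : ℝ) • intVec z := by
  ext i; simp [intVec]

lemma intVec_injective : Function.Injective (intVec : (Fin n → ℤ) → Fin n → ℝ) := by
  intro z w h
  ext i
  have := congrFun h i
  simpa [intVec] using this

/-- The edge cut out by an exposed ray. -/
lemma isFace_ray {Δ : Set (Fin n → ℝ)} {v s : Fin n → ℝ} {T : Finset (Fin n → ℝ)} (hv : v ∈ Δ)
    (hT : ∀ x ∈ Δ, ∃ c : (Fin n → ℝ) → ℝ, (∀ t, 0 ≤ c t) ∧ x - v = ∑ t ∈ T, c t • t)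
    (hs : s ∈ T) (hs0 : s ≠ 0) (hvs : v + s ∈ Δ) {l : StrongDual ℝ (Fin n → ℝ)} (hls : l s = 0)
    (hl : ∀ t ∈ T, t ≠ s → l t < 0) :
    {x ∈ Δ | ∃ c : ℝ, 0 ≤ c ∧ x = v + c • s} ∈ edgesAt Δ v ∧
      vectorSpan ℝ {x ∈ Δ | ∃ c : ℝ, 0 ≤ c ∧ x = v + c • s} = Submodule.span ℝ {s} := by
  classical
  set E := {x ∈ Δ | ∃ c : ℝ, 0 ≤ c ∧ x = v + c • s} with hE
  have hvE : v ∈ E := ⟨hv, 0, le_rfl, by simp⟩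
  have hvsE : v + s ∈ E := ⟨hvs, 1, zero_le_one, by simp⟩
  -- All generators except `s` strictly decrease `l`, so the maximum of `l` over the polytope is
  -- attained only along the ray.
  have hle : ∀ x ∈ Δ, l x ≤ l v ∧ (l x = l v → x ∈ E) := by
    intro x hx
    obtain ⟨c, hc, hxc⟩ := hT x hx
    have h1 : l x - l v = ∑ t ∈ T, c t * l t := by
      rw [← map_sub, hxc, map_sum]
      simp
    have hterm : ∀ t ∈ T, c t * l t ≤ 0 := fun t ht => by
      rcases eq_or_ne t s with rfl | hts
      · simp [hls]
      · exact mul_nonpos_of_nonneg_of_nonpos (hc t) (hl t ht hts).le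
    refine ⟨by linarith [Finset.sum_nonpos hterm], fun heq => ⟨hx, c s, hc s, ?_⟩⟩
    rw [heq, sub_self, eq_comm, Finset.sum_eq_zero_iff_of_nonpos hterm] at h1
    rw [← sub_eq_iff_eq_add', hxc, Finset.sum_eq_single_of_mem s hs]
    intro t ht hts
    have := h1 t ht
    rw [mul_eq_zero, or_iff_left (hl t ht hts).ne] at this
    rw [this, zero_smul]
  have hspan : vectorSpan ℝ E = Submodule.span ℝ {s} := by
    rw [vectorSpan_eq_span_vsub_set_right ℝ hvE]
    refine le_antisymm (Submodule.span_le.2 ?_) (Submodule.span_le.2 ?_)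
    · rintro _ ⟨x, ⟨-, c, -, rfl⟩, rfl⟩
      simpa using Submodule.smul_mem _ c (Submodule.mem_span_singleton_self s)
    · rw [Set.singleton_subset_iff]
      exact Submodule.subset_span ⟨v + s, hvsE, by simp⟩
  refine ⟨⟨⟨⟨v, hvE⟩, fun _ => ⟨l, ?_⟩⟩, ?_, hvE⟩, hspan⟩
  · ext x
    constructor
    · rintro ⟨hx, c, hc, rfl⟩
      refine ⟨hx, fun y hy => ?_⟩
      rw [map_add, map_smul, hls, smul_zero, add_zero]
      exact (hle y hy).1
    · rintro ⟨hx, hmax⟩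
      exact (hle x hx).2 (le_antisymm (hle x hx).1 (hmax v hv))
  · rw [faceDim, hspan, finrank_span_singleton hs0]

/-- The integral coordinate functional of a basis of `ℤⁿ`, as an integer vector. -/
def dualVec {J : Type*} (b : Module.Basis J ℤ (Fin n → ℤ)) (i : J) (j : Fin n) : ℤ :=
  b.repr (Pi.single j 1) i

lemma sum_dualVec_mul {J : Type*} (b : Module.Basis J ℤ (Fin n → ℤ)) (i : J) (z : Fin n → ℤ) :
    ∑ j, dualVec b i j * z j = b.repr z i := by
  conv_rhs => rw [← Finset.univ_sum_single z, map_sum, Finsupp.finsetSum_apply]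
  refine Finset.sum_congr rfl fun j _ => ?_
  have : (Pi.single j (z j) : Fin n → ℤ) = z j • Pi.single j 1 := by
    rw [← Pi.single_smul]; simp
  rw [this, map_smul, Finsupp.smul_apply, smul_eq_mul, mul_comm, dualVec]

/-- The pairing of an integer covector with a real vector. -/
def pairing (u : Fin n → ℤ) : (Fin n → ℝ) →ₗ[ℝ] ℝ :=
  ∑ j, (u j : ℝ) • LinearMap.proj j

lemma pairing_apply (u : Fin n → ℤ) (x : Fin n → ℝ) : pairing u x = ∑ j, (u j : ℝ) * x j := by
  simp [pairing]

lemma pairing_intVec (u z : Fin n → ℤ) : pairing u (intVec z) = ((∑ j, u j * z j : ℤ) : ℝ) := by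
  simp [pairing_apply, intVec]

lemma pairing_dualVec_basis {J : Type*} [DecidableEq J] (b : Module.Basis J ℤ (Fin n → ℤ))
    (i j : J) : pairing (dualVec b i) (intVec (b j)) = if i = j then 1 else 0 := by
  rw [pairing_intVec, sum_dualVec_mul, b.repr_self, Finsupp.single_apply]
  simp [eq_comm]

lemma isPrimitive_of_repr_eq {J : Type*} (b : Module.Basis J ℤ (Fin n → ℤ)) (i : J)
    {z : Fin n → ℤ} (hz : IsUnit (b.repr z i)) : IsPrimitive z := by
  rintro c w hc rfl
  rw [map_smul, Finsupp.smul_apply, smul_eq_mul] at hz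
  have := Int.isUnit_iff.1 (isUnit_of_mul_isUnit_left hz)
  omega

lemma IsPrimitive.eq_one_or_eq_neg_one {z w : Fin n → ℤ} {r : ℤ} (hz : IsPrimitive z)
    (h : z = r • w) : r = 1 ∨ r = -1 := by
  by_contra! hr
  rcases lt_trichotomy r 0 with h0 | rfl | h0
  · exact hz (-r) (-w) (by omega) (by rw [h]; simp)
  · exact hz 2 0 (by omega) (by rw [h]; simp)
  · exact hz r w (by omega) h

/-- At a vertex of a regular lattice polytope the primitive edge vectors form a basis of the
lattice, and near the vertex the polytope coincides with the cone they generate. -/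
theorem IsRegularLatticePolytope.exists_edge_basis {Δ : Set (Fin n → ℝ)}
    (hΔ : IsRegularLatticePolytope Δ) {v : Fin n → ℝ} (hv : v ∈ Δ.extremePoints ℝ) :
    ∃ b : Module.Basis (edgesAt Δ v) ℤ (Fin n → ℤ),
      edgeVectorSet Δ v = Set.range b ∧
      (∀ i, ∀ x ∈ Δ, 0 ≤ pairing (dualVec b i) (x - v)) ∧
      ∀ i, ∃ t : ℝ, 0 < t ∧ v + t • intVec (b i) ∈ Δ := by
  classical
  obtain ⟨S, hS, -, hΔS⟩ := hΔ.polytope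
  obtain ⟨T, hT1, hT2, hT3⟩ := exists_exposed_rays hS (hΔS ▸ hv)
  rw [← hΔS] at hT2
  obtain ⟨b, hb⟩ := hΔ.regular v hv
  have hvΔ : v ∈ Δ := hv.1
  have hvs : ∀ s ∈ T, v + s ∈ Δ := fun s hs => hΔS ▸ subset_convexHull ℝ S (hT1 s hs).2
  set ray : (Fin n → ℝ) → Set (Fin n → ℝ) := fun s => {x ∈ Δ | ∃ c : ℝ, 0 ≤ c ∧ x = v + c • s}
    with hray
  have hedge : ∀ s ∈ T, ray s ∈ edgesAt Δ v ∧ vectorSpan ℝ (ray s) = Submodule.span ℝ {s} := by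
    intro s hs
    obtain ⟨l, hl0, hl⟩ := hT3 s hs
    exact isFace_ray hvΔ hT2 hs (hT1 s hs).1 (hvs s hs) hl0 hl
  have hcoef : ∀ s, ∀ hs : s ∈ T, ∃ a : ℝ, a ≠ 0 ∧ s = a • intVec (b ⟨ray s, (hedge s hs).1⟩) := by
    intro s hs
    have h1 := hb ⟨ray s, (hedge s hs).1⟩
    replace h1 := (hedge s hs).2.symm.trans h1
    have h2 : s ∈ Submodule.span ℝ {intVec (b ⟨ray s, (hedge s hs).1⟩)} :=
      h1 ▸ Submodule.mem_span_singleton_self s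
    obtain ⟨a, ha⟩ := Submodule.mem_span_singleton.1 h2
    refine ⟨a, ?_, ha.symm⟩
    rintro rfl
    exact (hT1 s hs).1 (by rw [← ha, zero_smul])
  have hpair : ∀ E : edgesAt Δ v, ∀ s, ∀ hs : s ∈ T, ray s ≠ E.1 →
      pairing (dualVec b E) s = 0 := by
    intro E s hs hne
    obtain ⟨a, -, ha⟩ := hcoef s hs
    rw [ha, map_smul, pairing_dualVec_basis, if_neg, smul_zero]
    exact fun h => hne (congrArg Subtype.val h).symm
  -- If no generator lay along the edge `E`, the coordinate dual to its basis vector would vanish on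
  -- all of `Δ - v`. The edge would collapse to the vertex, contradicting dimension one.
  have hsurj : ∀ E : edgesAt Δ v, ∃ s ∈ T, ray s = E.1 := by
    intro E
    by_contra! hno
    obtain ⟨hface, hdim, hvE⟩ := E.2
    have hzero : ∀ x ∈ E.1, x - v = 0 := by
      intro x hx
      have hxΔ : x ∈ Δ := by
        obtain ⟨l, hl⟩ := hface.2 hface.1
        rw [hl] at hx
        exact hx.1
      have h1 : x - v ∈ Submodule.span ℝ {intVec (b E)} := by
        rw [← hb E]
        exact vsub_mem_vectorSpan ℝ hx hvE
      obtain ⟨c, hc⟩ := Submodule.mem_span_singleton.1 h1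
      obtain ⟨d, -, hd⟩ := hT2 x hxΔ
      have h2 : pairing (dualVec b E) (x - v) = 0 := by
        rw [hd, map_sum]
        refine Finset.sum_eq_zero fun s hs => ?_
        rw [map_smul, hpair E s hs (hno s hs), smul_zero]
      rw [← hc, map_smul, pairing_dualVec_basis, if_pos rfl, smul_eq_mul, mul_one] at h2
      rw [← hc, h2, zero_smul]
    rw [faceDim, vectorSpan_eq_span_vsub_set_right ℝ hvE] at hdim
    have : Submodule.span ℝ ((fun x => x -ᵥ v) '' E.1) = ⊥ := by
      rw [Submodule.span_eq_bot]
      rintro _ ⟨x, hx, rfl⟩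
      exact hzero x hx
    rw [this, finrank_bot] at hdim
    exact zero_ne_one hdim
  -- Regularity provides basis vectors only up to sign. The sign is now fixed so that each of them
  -- points into the polytope.
  have hsgn : ∀ E : edgesAt Δ v, ∃ σ : ℤˣ, ∃ s ∈ T, ∃ a : ℝ, 0 < a ∧ ray s = E.1 ∧
      s = a • intVec ((σ : ℤ) • b E) := by
    intro E
    obtain ⟨s, hs, hsE⟩ := hsurj E
    obtain ⟨a, ha0, ha⟩ := hcoef s hs
    have hE : (⟨ray s, (hedge s hs).1⟩ : edgesAt Δ v) = E := Subtype.ext hsE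
    rw [hE] at ha
    rcases lt_or_gt_of_ne ha0 with h | h
    · refine ⟨-1, s, hs, -a, by linarith, hsE, ?_⟩
      rw [intVec_smul, smul_smul]
      simpa using ha
    · refine ⟨1, s, hs, a, h, hsE, ?_⟩
      simpa using ha
  choose σ s hsT a ha hsE hsa using hsgn
  have hwE : ∀ E, b.unitsSMul σ E = (σ E : ℤ) • b E := fun E => Module.Basis.unitsSMul_apply E
  refine ⟨b.unitsSMul σ, ?_, fun E x hx => ?_, fun E => ⟨a E, ha E, ?_⟩⟩
  · ext α
    constructor
    · rintro ⟨hα, E, hE, t, ht, htE⟩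
      obtain ⟨-, c, hc, hceq⟩ : v + t • intVec α ∈ ray (s ⟨E, hE⟩) := by rwa [hsE ⟨E, hE⟩]
      rw [add_right_inj, hsa ⟨E, hE⟩, ← hwE] at hceq
      set w := b.unitsSMul σ ⟨E, hE⟩ with hw
      have h1 : intVec α = (c * a ⟨E, hE⟩ / t) • intVec w := by
        rw [← inv_smul_smul₀ ht.ne' (intVec α), hceq, smul_smul, smul_smul]
        congr 1
        ring
      have h2 : c * a ⟨E, hE⟩ / t = (((b.unitsSMul σ).repr α ⟨E, hE⟩ : ℤ) : ℝ) := by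
        rw [← sum_dualVec_mul, ← pairing_intVec, h1, map_smul, hw, pairing_dualVec_basis,
          if_pos rfl, smul_eq_mul, mul_one]
      rw [h2, ← intVec_smul] at h1
      have h3 := intVec_injective h1
      have h4 : (0 : ℝ) ≤ (((b.unitsSMul σ).repr α ⟨E, hE⟩ : ℤ) : ℝ) := by
        rw [← h2]
        have := ha ⟨E, hE⟩
        positivity
      rcases hα.eq_one_or_eq_neg_one h3 with h5 | h5
      · exact ⟨⟨E, hE⟩, by rw [h3, h5, one_smul]⟩
      · rw [h5] at h4
        norm_num at h4
    · rintro ⟨E, rfl⟩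
      refine ⟨isPrimitive_of_repr_eq (b.unitsSMul σ) E (by simp), E.1, E.2, a E, ha E, ?_⟩
      rw [hwE, ← hsa, ← hsE]
      exact ⟨hvs _ (hsT E), 1, zero_le_one, by rw [one_smul]⟩
  · obtain ⟨c, hc, hxc⟩ := hT2 x hx
    rw [hxc, map_sum]
    refine Finset.sum_nonneg fun s' hs' => ?_
    rw [map_smul, smul_eq_mul]
    refine mul_nonneg (hc s') ?_
    have hs'E := hsE ⟨ray s', (hedge s' hs').1⟩
    set E' : edgesAt Δ v := ⟨ray s', (hedge s' hs').1⟩ with hE'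
    have hmem : v + s' ∈ ray (s E') := by
      rw [hs'E]
      exact ⟨hvs s' hs', 1, zero_le_one, by rw [one_smul]⟩
    obtain ⟨-, c', hc', hceq⟩ := hmem
    rw [add_right_inj] at hceq
    rw [hceq, hsa, ← hwE, map_smul, map_smul, pairing_dualVec_basis]
    have := ha E'
    simp only [smul_eq_mul]
    split_ifs <;> positivity
  · rw [hwE, ← hsa]
    exact hvs _ (hsT E)

end Vertex


/-! ### Facets at a vertex -/

section Facets

variable {n d : ℕ}

/-- The expansion of integer vectors in the lattice basis extends to real ones by linearity, the
standard basis vectors being integral. -/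
lemma eq_sum_pairing_dualVec {J : Type*} [Fintype J] (b : Module.Basis J ℤ (Fin n → ℤ))
    (x : Fin n → ℝ) : x = ∑ i, pairing (dualVec b i) x • intVec (b i) := by
  have hz : ∀ z : Fin n → ℤ, intVec z = ∑ i, pairing (dualVec b i) (intVec z) • intVec (b i) := by
    intro z
    conv_lhs => rw [← b.sum_repr z]
    have : ∀ s : Finset J, intVec (∑ i ∈ s, b.repr z i • b i) =
        ∑ i ∈ s, intVec (b.repr z i • b i) := fun s => by
      ext j; simp [intVec]
    rw [this]
    refine Finset.sum_congr rfl fun i _ => ?_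
    rw [intVec_smul, pairing_intVec, sum_dualVec_mul]
  have hlin : (LinearMap.id : (Fin n → ℝ) →ₗ[ℝ] (Fin n → ℝ)) =
      ∑ i, (pairing (dualVec b i)).smulRight (intVec (b i)) := by
    refine LinearMap.pi_ext' fun j => LinearMap.ext_ring ?_
    have : (Pi.single j 1 : Fin n → ℝ) = intVec (Pi.single j 1) := by
      ext k
      rcases eq_or_ne k j with rfl | h
      · simp [intVec]
      · simp [intVec, h]
    simp only [LinearMap.coe_comp, Function.comp_apply, LinearMap.coe_single, LinearMap.id_coe, id,
      LinearMap.sum_apply, LinearMap.smulRight_apply]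
    rw [this]
    exact hz _
  have := LinearMap.congr_fun hlin x
  simpa using this

/-- At a vertex the edge vectors form a lattice basis. -/
lemma IsRegularLatticePolytope.exists_basis {Δ : Set (Fin n → ℝ)}
    (hΔ : IsRegularLatticePolytope Δ) {v : Fin n → ℝ} (hv : v ∈ Δ.extremePoints ℝ) :
    ∃ b : Module.Basis (edgeVectors Δ v) ℤ (Fin n → ℤ), (∀ α, b α = α.1) ∧
      (∀ α, ∀ x ∈ Δ, 0 ≤ pairing (dualVec b α) (x - v)) ∧
      ∀ α : edgeVectors Δ v, ∃ t : ℝ, 0 < t ∧ v + t • intVec α.1 ∈ Δ := by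
  classical
  obtain ⟨b, hb, hnn, ht⟩ := hΔ.exists_edge_basis hv
  have : Finite (edgesAt Δ v) := Module.Finite.finite_basis b
  have hfin : (edgeVectorSet Δ v).Finite := hb ▸ Set.finite_range b
  have hmem : ∀ α, α ∈ edgeVectors Δ v ↔ α ∈ Set.range b := by
    intro α
    rw [edgeVectors, dif_pos hfin, Set.Finite.mem_toFinset, hb]
  let eqv : edgesAt Δ v ≃ edgeVectors Δ v :=
    (Equiv.ofInjective b b.injective).trans (Equiv.subtypeEquivRight fun α => (hmem α).symm)
  have hα : ∀ α, b.reindex eqv α = α.1 := by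
    intro α
    rw [Module.Basis.reindex_apply]
    have : (eqv (eqv.symm α)).1 = b (eqv.symm α) := rfl
    rw [← this, Equiv.apply_symm_apply]
  have hdual : ∀ α, dualVec (b.reindex eqv) α = dualVec b (eqv.symm α) := by
    intro α
    ext j
    simp [dualVec]
  refine ⟨b.reindex eqv, hα, fun α x hx => hdual α ▸ hnn _ x hx, fun α => ?_⟩
  rw [← hα, Module.Basis.reindex_apply]
  exact ht _

/-- The value at `x` of the `i`-th defining affine function of a facet presentation. -/
def slack (u : Fin d → Fin n → ℤ) (μ : Fin d → ℝ) (i : Fin d) (x : Fin n → ℝ) : ℝ :=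
  pairing (u i) x + μ i

lemma mem_dilated {u : Fin d → Fin n → ℤ} {μ h : Fin d → ℝ} {x : Fin n → ℝ} :
    x ∈ dilated (fun i => intVec (u i)) μ h ↔ ∀ i, 0 ≤ slack u μ i x + h i := by
  simp [dilated, slack, pairing_apply, intVec]

lemma slack_add (u : Fin d → Fin n → ℤ) (μ : Fin d → ℝ) (i : Fin d) (x y : Fin n → ℝ) :
    slack u μ i (x + y) = slack u μ i x + pairing (u i) y := by
  rw [slack, slack, map_add]; ring

variable {Δ : Set (Fin n → ℝ)} {u : Fin d → Fin n → ℤ} {μ : Fin d → ℝ}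

lemma IsFacetPresentation.mem_iff (hu : IsFacetPresentation Δ u μ) {x : Fin n → ℝ} :
    x ∈ Δ ↔ ∀ i, 0 ≤ slack u μ i x := by
  conv_lhs => rw [hu.eq_inter]
  rw [mem_dilated]
  simp

/-- No half-space of a facet presentation is redundant. -/
lemma IsFacetPresentation.exists_violating (hu : IsFacetPresentation Δ u μ) (i : Fin d) :
    ∃ x, (∀ j ≠ i, 0 ≤ slack u μ j x) ∧ slack u μ i x < 0 := by
  by_contra! hno
  obtain ⟨d', rfl⟩ : ∃ d', d = d' + 1 := ⟨d - 1, by have := i.2; omega⟩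
  have := hu.minimal d' (fun j => intVec (u (i.succAbove j))) (fun j => μ (i.succAbove j)) (by
    ext x
    have h := mem_dilated (u := fun j => u (i.succAbove j)) (μ := fun j => μ (i.succAbove j))
      (h := 0) (x := x)
    rw [h, hu.mem_iff]
    constructor
    · intro hx j
      simpa [slack] using hx (i.succAbove j)
    · intro hx
      have hx' : ∀ j ≠ i, 0 ≤ slack u μ j x := by
        intro j hj
        obtain ⟨k, rfl⟩ := Fin.exists_succAbove_eq hj
        simpa [slack] using hx k
      intro j
      rcases eq_or_ne j i with rfl | hj
      · exact hno x hx'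
      · exact hx' j hj)
  omega

/-- Every facet of the tangent cone at a vertex occurs among the facets. -/
lemma IsFacetPresentation.exists_facet (hu : IsFacetPresentation Δ u μ) {v : Fin n → ℝ}
    (hv : v ∈ Δ) {J : Type*} [Fintype J] (b : Module.Basis J ℤ (Fin n → ℤ))
    (hnn : ∀ i, ∀ x ∈ Δ, 0 ≤ pairing (dualVec b i) (x - v))
    (ht : ∀ i, ∃ t : ℝ, 0 < t ∧ v + t • intVec (b i) ∈ Δ) (α : J) :
    ∃ i, u i = dualVec b α ∧ slack u μ i v = 0 := by
  classical
  have hvs := hu.mem_iff.1 hv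
  have hpos : ∀ i, slack u μ i v = 0 → ∀ β, 0 ≤ pairing (u i) (intVec (b β)) := by
    intro i hi β
    obtain ⟨t, ht0, htΔ⟩ := ht β
    have := hu.mem_iff.1 htΔ i
    rw [slack_add, hi, zero_add, map_smul, smul_eq_mul] at this
    exact nonneg_of_mul_nonneg_right this ht0
  obtain ⟨i, hi0, hβ, hα⟩ : ∃ i, slack u μ i v = 0 ∧
      (∀ β ≠ α, pairing (u i) (intVec (b β)) = 0) ∧ 0 < pairing (u i) (intVec (b α)) := by
    by_contra! hno
    -- A test curve of order δ along the other edges and of order `-δ²` along `α`. If every facet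
    -- through `v` that vanishes on the other edges were nonpositive on `α`, the curve would remain
    -- in Δ for small positive δ, although its `α`-coordinate is negative.
    set y : ℝ → Fin n → ℝ := fun δ =>
      δ • ∑ β ∈ Finset.univ.erase α, intVec (b β) - δ ^ 2 • intVec (b α) with hy
    have hyΔ : ∀ᶠ δ in nhdsWithin (0 : ℝ) (Set.Ioi 0), ∀ i, 0 ≤ slack u μ i (v + y δ) := by
      rw [Filter.eventually_all]
      intro i
      have hval : ∀ δ, slack u μ i (v + y δ) = slack u μ i v + δ *
          (∑ β ∈ Finset.univ.erase α, pairing (u i) (intVec (b β)) -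
            δ * pairing (u i) (intVec (b α))) := by
        intro δ
        rw [slack_add, hy]
        simp only [map_sub, map_smul, map_sum, smul_eq_mul]
        ring
      rcases (hvs i).eq_or_lt with h0 | h0
      · by_cases hex : ∃ β ≠ α, pairing (u i) (intVec (b β)) ≠ 0
        · obtain ⟨β, hβα, hβ⟩ := hex
          have hsum : 0 < ∑ β ∈ Finset.univ.erase α, pairing (u i) (intVec (b β)) :=
            Finset.sum_pos' (fun γ _ => hpos i h0.symm γ)
              ⟨β, by simpa using hβα, (hpos i h0.symm β).lt_of_ne' hβ⟩
          have hc : Continuous fun δ : ℝ => ∑ β ∈ Finset.univ.erase α,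
            pairing (u i) (intVec (b β)) - δ * pairing (u i) (intVec (b α)) := by fun_prop
          have h1 : ∀ᶠ δ in nhds (0 : ℝ), 0 < ∑ β ∈ Finset.univ.erase α,
            pairing (u i) (intVec (b β)) - δ * pairing (u i) (intVec (b α)) :=
            hc.continuousAt.eventually_const_lt (by simpa using hsum)
          filter_upwards [nhdsWithin_le_nhds h1, self_mem_nhdsWithin] with δ h2 h3
          rw [hval, ← h0, zero_add]
          exact (mul_pos h3 h2).le
        · push Not at hex
          have h1 := le_antisymm (hno i h0.symm hex) (hpos i h0.symm α)
          refine Filter.Eventually.of_forall fun δ => ?_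
          rw [hval, h1, ← h0, Finset.sum_eq_zero fun β hβ => hex β (Finset.ne_of_mem_erase hβ)]
          simp
      · have hc : Continuous fun δ : ℝ => slack u μ i (v + y δ) := by
          simp only [hval]; fun_prop
        refine nhdsWithin_le_nhds ?_
        have h1 : ∀ᶠ δ in nhds (0 : ℝ), 0 < slack u μ i (v + y δ) :=
          hc.continuousAt.eventually_const_lt (by simpa only [hval, zero_mul, add_zero] using h0)
        filter_upwards [h1] with δ hδ using hδ.le
    obtain ⟨δ, hδ, hδ0⟩ := (hyΔ.and self_mem_nhdsWithin).exists
    have h1 := hnn α _ (hu.mem_iff.2 hδ)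
    rw [add_sub_cancel_left, hy] at h1
    simp only [map_sub, map_smul, map_sum, smul_eq_mul, pairing_dualVec_basis] at h1
    rw [Finset.sum_eq_zero fun β hβ => if_neg (Finset.ne_of_mem_erase hβ).symm] at h1
    simp only [if_true, mul_zero, mul_one, zero_sub] at h1
    have : 0 < δ ^ 2 := pow_pos hδ0 2
    linarith
  refine ⟨i, ?_, hi0⟩
  -- A covector vanishing on all other basis vectors is an integer multiple of the dual one.
  -- Primitivity leaves the factor `±1`, and positivity on `b α` excludes the minus sign.
  set c : ℤ := ∑ j, u i j * b α j with hc
  have hmul : u i = c • dualVec b α := by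
    ext j
    have h1 : ∑ β, b.repr (Pi.single j 1) β • b β = Pi.single j 1 := b.sum_repr _
    have h2 : u i j = ∑ k, u i k * (Pi.single j 1 : Fin n → ℤ) k := by
      simp [Pi.single_apply]
    rw [h2, ← h1]
    simp only [Finset.sum_apply, Pi.smul_apply, smul_eq_mul, Finset.mul_sum]
    rw [Finset.sum_comm, Finset.sum_eq_single α]
    · rw [hc, Finset.sum_mul]
      exact Finset.sum_congr rfl fun k _ => by rw [dualVec]; ring
    · intro β _ hβα
      have h3 := hβ β hβα
      rw [pairing_intVec, Int.cast_eq_zero] at h3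
      have : ∀ k, u i k * (b.repr (Pi.single j 1) β * b β k) =
          b.repr (Pi.single j 1) β * (u i k * b β k) := fun k => by ring
      simp only [this]
      rw [← Finset.mul_sum, h3, mul_zero]
    · simp
  rw [pairing_intVec, ← hc, Int.cast_pos] at hα
  rcases (hu.primitive i).eq_one_or_eq_neg_one hmul with h | h
  · rw [hmul, h, one_smul]
  · omega

/-- The combinatorial data of a simple lattice polytope at a vertex: the facet opposite to each edge
vector, the normals of these facets being dual to the edge vectors. -/
structure VertexFrame (Δ : Set (Fin n → ℝ)) (u : Fin d → Fin n → ℤ) (μ : Fin d → ℝ)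
    (v : Fin n → ℝ) where
  facet : edgeVectors Δ v → Fin d
  facet_injective : facet.Injective
  pairing_facet : ∀ α β, pairing (u (facet α)) (intVec β.1) = if α = β then 1 else 0
  slack_eq_zero_iff : ∀ i, slack u μ i v = 0 ↔ i ∈ Set.range facet
  eq_add_sum : ∀ x, x = v + ∑ α, slack u μ (facet α) x • intVec α.1
  exists_mem : ∀ α : edgeVectors Δ v, ∃ t : ℝ, 0 < t ∧ v + t • intVec α.1 ∈ Δ
  card_eq : Fintype.card (edgeVectors Δ v) = n

/-- Each edge vector already has its dual facet. No further facet can pass through the vertex,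
because its inequality would follow from those of the tangent cone and be redundant. -/
theorem nonempty_vertexFrame (hΔ : IsRegularLatticePolytope Δ) (hu : IsFacetPresentation Δ u μ)
    {v : Fin n → ℝ} (hv : v ∈ Δ.extremePoints ℝ) : Nonempty (VertexFrame Δ u μ v) := by
  classical
  obtain ⟨b, hbα, hnn, ht⟩ := hΔ.exists_basis hv
  have hfac := hu.exists_facet hv.1 b hnn (fun α => by rw [hbα]; exact ht α)
  choose e he hev using hfac
  have hdual : ∀ α β, pairing (u (e α)) (intVec β.1) = if α = β then 1 else 0 := by
    intro α β
    rw [he, ← hbα β, pairing_dualVec_basis]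
  have hinj : e.Injective := by
    intro α β h
    have h1 := hdual α β
    have h2 := hdual β β
    rw [if_pos rfl, ← h, h1] at h2
    by_contra hne
    rw [if_neg hne] at h2
    exact zero_ne_one h2
  have hslack : ∀ α x, slack u μ (e α) x = pairing (dualVec b α) (x - v) := by
    intro α x
    have h1 := hev α
    rw [slack] at h1
    rw [slack, map_sub, ← he]
    linarith
  have hexp : ∀ x, x = v + ∑ α, slack u μ (e α) x • intVec α.1 := by
    intro x
    have := eq_sum_pairing_dualVec b (x - v)
    simp only [hslack]
    rw [← sub_eq_iff_eq_add']
    simpa only [hbα] using this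
  -- A repeated inequality would be redundant, against the minimality of `d`.
  have huniq : ∀ i j, u i = u j → μ i = μ j → i = j := by
    intro i j h1 h2
    by_contra hne
    obtain ⟨x, hx, hxi⟩ := hu.exists_violating i
    have := hx j (Ne.symm hne)
    rw [slack, ← h1, ← h2] at this
    exact absurd hxi this.not_gt
  refine ⟨⟨e, hinj, hdual, fun i => ⟨fun hi => ?_, ?_⟩, hexp, ht, ?_⟩⟩
  · by_cases hex : ∃ α, u i = u (e α)
    · obtain ⟨α, hα⟩ := hex
      refine ⟨α, (huniq _ _ hα ?_).symm⟩
      have h1 := hev α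
      rw [slack] at h1 hi
      rw [← hα] at h1
      linarith
    · push Not at hex
      exfalso
      -- The point `x` satisfies every inequality but the `i`-th, hence lies in the cone of the edge
      -- vectors at `v`, where a normal tight at `v` is nonnegative.
      obtain ⟨x, hx, hxi⟩ := hu.exists_violating i
      rw [hexp x, slack_add, hi, zero_add, map_sum] at hxi
      refine absurd hxi (not_lt.2 (Finset.sum_nonneg fun α _ => ?_))
      rw [map_smul, smul_eq_mul]
      refine mul_nonneg (hx _ fun h => hex α (by rw [h])) ?_
      obtain ⟨t, ht0, htΔ⟩ := ht α
      have := hu.mem_iff.1 htΔ i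
      rw [slack_add, hi, zero_add, map_smul, smul_eq_mul] at this
      exact nonneg_of_mul_nonneg_right this ht0
  · rintro ⟨α, rfl⟩
    exact hev α
  · rw [← Module.finrank_eq_card_basis b, Module.finrank_fin_fun]

end Facets


/-! ### The polar decomposition of a simple polytope -/

section PolarDecomposition

variable {n d : ℕ} {Δ : Set (Fin n → ℝ)} {u : Fin d → Fin n → ℤ} {μ : Fin d → ℝ}

lemma IsPolytope.isCompact (h : IsPolytope Δ) : IsCompact Δ := by
  obtain ⟨S, hS, -, rfl⟩ := h
  exact hS.isCompact_convexHull ℝ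

lemma IsPolytope.nonempty (h : IsPolytope Δ) : Δ.Nonempty := by
  obtain ⟨S, -, hS, rfl⟩ := h
  exact hS.convexHull

lemma IsPolytope.finite_extremePoints (h : IsPolytope Δ) : (Δ.extremePoints ℝ).Finite := by
  obtain ⟨S, hS, -, rfl⟩ := h
  exact hS.subset extremePoints_convexHull_subset

lemma continuous_slack (u : Fin d → Fin n → ℤ) (μ : Fin d → ℝ) (i : Fin d) :
    Continuous (slack u μ i) :=
  ((pairing (u i)).continuous_of_finiteDimensional).add continuous_const

lemma slack_combo (u : Fin d → Fin n → ℤ) (μ : Fin d → ℝ) (i : Fin d) {a b : ℝ} (hab : a + b = 1)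
    (x y : Fin n → ℝ) :
    slack u μ i (a • x + b • y) = a * slack u μ i x + b * slack u μ i y := by
  simp only [slack, map_add, map_smul, smul_eq_mul]
  linear_combination (-μ i) * hab

/-- A linear functional attains its minimum over a face in a vertex. -/
lemma IsFacetPresentation.exists_vertex_min (hu : IsFacetPresentation Δ u μ) (hΔ : IsPolytope Δ)
    (K : Finset (Fin d)) (hK : ∃ x ∈ Δ, ∀ i ∈ K, slack u μ i x = 0)
    (ξ : Module.Dual ℝ (Fin n → ℝ)) :
    ∃ w ∈ Δ.extremePoints ℝ, (∀ i ∈ K, slack u μ i w = 0) ∧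
      ∀ y ∈ Δ, (∀ i ∈ K, slack u μ i y = 0) → ξ w ≤ ξ y := by
  have hξ : Continuous ξ := ξ.continuous_of_finiteDimensional
  set F : Set (Fin n → ℝ) := Δ ∩ {x | ∀ i ∈ K, slack u μ i x = 0} with hF
  have hFc : IsCompact F := by
    refine hΔ.isCompact.inter_right ?_
    simp only [Set.ofPred_forall]
    exact isClosed_biInter fun i _ => isClosed_eq (continuous_slack u μ i) continuous_const
  obtain ⟨x₀, hx₀, hK₀⟩ := hK
  obtain ⟨z, hzF, hz⟩ := hFc.exists_isMinOn ⟨x₀, hx₀, hK₀⟩ hξ.continuousOn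
  have hM : IsCompact (F ∩ {x | ξ x ≤ ξ z}) :=
    hFc.inter_right (isClosed_le hξ continuous_const)
  -- The minimizers of `ξ` on the face form a compact extreme subset of Δ. It has an extreme point,
  -- which is then a vertex of Δ itself.
  have hext : IsExtreme ℝ Δ (F ∩ {x | ξ x ≤ ξ z}) := by
    refine ⟨fun x hx => hx.1.1, ?_⟩
    rintro x hx y hy w ⟨⟨hwΔ, hwK⟩, hwz⟩ ⟨a, b, ha, hb, hab, rfl⟩
    have hxy : ∀ i ∈ K, slack u μ i x = 0 ∧ slack u μ i y = 0 := by
      intro i hi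
      have h1 := hwK i hi
      rw [slack_combo u μ i hab] at h1
      have h2 := mul_nonneg ha.le (hu.mem_iff.1 hx i)
      have h3 := mul_nonneg hb.le (hu.mem_iff.1 hy i)
      have h4 : a * slack u μ i x = 0 := by linarith
      have h5 : b * slack u μ i y = 0 := by linarith
      exact ⟨(mul_eq_zero.1 h4).resolve_left ha.ne', (mul_eq_zero.1 h5).resolve_left hb.ne'⟩
    refine ⟨⟨hx, fun i hi => (hxy i hi).1⟩, ?_⟩
    have h1 : ξ z ≤ ξ y := hz ⟨hy, fun i hi => (hxy i hi).2⟩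
    rw [Set.mem_ofPred_eq, map_add, map_smul, map_smul, smul_eq_mul, smul_eq_mul] at hwz
    have h2 := mul_le_mul_of_nonneg_left h1 hb.le
    have h3 : a * ξ x ≤ a * ξ z := by
      have : a * ξ z + b * ξ z = ξ z := by rw [← add_mul, hab, one_mul]
      linarith
    exact le_of_mul_le_mul_left h3 ha
  obtain ⟨w, hw⟩ := hM.extremePoints_nonempty ⟨z, hzF, le_refl (ξ z)⟩
  refine ⟨w, hext.extremePoints_subset_extremePoints hw, hw.1.1.2, fun y hy hyK => ?_⟩
  exact hw.1.2.trans (hz ⟨hy, hyK⟩)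

variable (fr : ∀ v : Δ.extremePoints ℝ, VertexFrame Δ u μ v)

/-- On every face a polarizing functional is increasing along the edges at exactly one vertex. -/
lemma existsUnique_min_vertex (hu : IsFacetPresentation Δ u μ) (hΔ : IsPolytope Δ)
    {ξ : Module.Dual ℝ (Fin n → ℝ)} (hξ : IsPolarizing Δ ξ) (K : Finset (Fin d))
    (hK : ∃ x ∈ Δ, ∀ i ∈ K, slack u μ i x = 0) :
    ∃! v : Δ.extremePoints ℝ, (∀ i ∈ K, slack u μ i v.1 = 0) ∧
      ∀ α, (fr v).facet α ∉ K → 0 < ξ (intVec α.1) := by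
  obtain ⟨w, hw, hwK, hmin⟩ := hu.exists_vertex_min hΔ K hK ξ
  have hflip : ∀ α, (fr ⟨w, hw⟩).facet α ∉ K → 0 < ξ (intVec α.1) := by
    intro α hα
    obtain ⟨t, ht0, ht⟩ := (fr ⟨w, hw⟩).exists_mem α
    have h1 := hmin _ ht fun i hi => by
      obtain ⟨β, rfl⟩ := ((fr ⟨w, hw⟩).slack_eq_zero_iff i).1 (hwK i hi)
      rw [slack_add, hwK _ hi, map_smul, (fr ⟨w, hw⟩).pairing_facet,
        if_neg (by rintro rfl; exact hα hi)]
      simp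
    rw [map_add, map_smul, smul_eq_mul, le_add_iff_nonneg_right] at h1
    exact (nonneg_of_mul_nonneg_right h1 ht0).lt_of_ne' (hξ w hw _ α.2)
  refine ⟨⟨w, hw⟩, ⟨hwK, hflip⟩, ?_⟩
  -- Expanding in the edge vectors at `v`, a point of the face has nonnegative coordinates along
  -- edges on which `ξ` is positive. Hence `v` minimizes `ξ` on the face, and equality of values
  -- forces all coordinates to vanish.
  · have hle : ∀ v v' : Δ.extremePoints ℝ, (∀ α, (fr v).facet α ∉ K → 0 < ξ (intVec α.1)) →
        (∀ i ∈ K, slack u μ i v'.1 = 0) → ξ v.1 ≤ ξ v'.1 ∧ (ξ v'.1 ≤ ξ v.1 → v' = v) := by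
      intro v v' hv hv'
      have hterm : ∀ α, 0 ≤ slack u μ ((fr v).facet α) v'.1 * ξ (intVec α.1) := by
        intro α
        by_cases hα : (fr v).facet α ∈ K
        · rw [hv' _ hα, zero_mul]
        · exact mul_nonneg (hu.mem_iff.1 v'.2.1 _) (hv α hα).le
      have hexp := (fr v).eq_add_sum v'.1
      have hval : ξ v'.1 = ξ v.1 + ∑ α, slack u μ ((fr v).facet α) v'.1 * ξ (intVec α.1) := by
        conv_lhs => rw [hexp]
        simp
      refine ⟨by rw [hval]; exact le_add_of_nonneg_right (Finset.sum_nonneg fun α _ => hterm α),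
        fun h => ?_⟩
      have h0 : ∑ α, slack u μ ((fr v).facet α) v'.1 * ξ (intVec α.1) = 0 :=
        le_antisymm (by linarith) (Finset.sum_nonneg fun α _ => hterm α)
      rw [Finset.sum_eq_zero_iff_of_nonneg fun α _ => hterm α] at h0
      refine Subtype.ext ?_
      rw [hexp]
      conv_rhs => rw [← add_zero v.1]
      congr 1
      refine Finset.sum_eq_zero fun α hα => ?_
      by_cases hαK : (fr v).facet α ∈ K
      · rw [hv' _ hαK, zero_smul]
      · rw [(mul_eq_zero.1 (h0 α hα)).resolve_right (hv α hαK).ne', zero_smul]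
    rintro v ⟨hvK, hv⟩
    exact (hle ⟨w, hw⟩ v hflip hvK).2 ((hle v ⟨w, hw⟩ hv hwK).1)

/-- The contribution of a flipped edge vector. -/
def flipInd (ξ : Module.Dual ℝ (Fin n → ℝ)) (α : Fin n → ℤ) : ℝ :=
  if 0 < ξ (intVec α) then 1 else 0

/-- The polarized product at a vertex, as a function of one number for each facet. -/
def vertexProd (ξ : Module.Dual ℝ (Fin n → ℝ)) {v : Fin n → ℝ} (fr : VertexFrame Δ u μ v)
    (p : Fin d → ℝ) : ℝ :=
  ∏ α, (p (fr.facet α) - flipInd ξ α.1)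

/-- Expanding the product selects a set of facets at the vertex. Its complement must consist of
flipped edges, which is the condition singling out one vertex per face. -/
lemma vertexProd_eq_sum (ξ : Module.Dual ℝ (Fin n → ℝ)) {v : Fin n → ℝ}
    (fr : VertexFrame Δ u μ v) (p : Fin d → ℝ) :
    vertexProd ξ fr p = ∑ K : Finset (Fin d), ((∏ i ∈ K, p i) * (-1) ^ (n - K.card)) *
      if (∀ i ∈ K, slack u μ i v = 0) ∧ ∀ α, fr.facet α ∉ K → 0 < ξ (intVec α.1)
        then 1 else 0 := by
  classical
  simp only [vertexProd, sub_eq_add_neg]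
  rw [Fintype.prod_add]
  refine Fintype.sum_of_injective (fun t : Finset (edgeVectors Δ v) =>
    t.map ⟨fr.facet, fr.facet_injective⟩) (Finset.map_injective _) _ _ ?_ ?_
  · intro K hK
    rw [if_neg, mul_zero]
    rintro ⟨h, -⟩
    refine hK ⟨K.preimage fr.facet fr.facet_injective.injOn, ?_⟩
    ext i
    simp only [Finset.mem_map, Finset.mem_preimage, Function.Embedding.coeFn_mk]
    constructor
    · rintro ⟨α, hα, rfl⟩
      exact hα
    · intro hi
      obtain ⟨α, rfl⟩ := (fr.slack_eq_zero_iff i).1 (h i hi)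
      exact ⟨α, hi, rfl⟩
  · intro t
    have h1 : ∀ i ∈ t.map ⟨fr.facet, fr.facet_injective⟩, slack u μ i v = 0 := by
      intro i hi
      obtain ⟨α, -, rfl⟩ := Finset.mem_map.1 hi
      exact (fr.slack_eq_zero_iff _).2 ⟨α, rfl⟩
    have h2 : ∀ α, fr.facet α ∉ t.map ⟨fr.facet, fr.facet_injective⟩ ↔ α ∈ tᶜ := by
      intro α
      rw [Finset.mem_compl, not_iff_not]
      exact Finset.mem_map' ⟨fr.facet, fr.facet_injective⟩
    have h3 : ∏ α ∈ tᶜ, -flipInd ξ α.1 = (-1) ^ (tᶜ).card *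
        if ∀ α ∈ tᶜ, 0 < ξ (intVec α.1) then 1 else 0 := by
      rw [Finset.prod_neg]
      congr 1
      simp only [flipInd]
      rw [Finset.prod_ite_zero, Finset.prod_const_one]
      congr
    have h4 : ((∀ i ∈ t.map ⟨fr.facet, fr.facet_injective⟩, slack u μ i v = 0) ∧
        ∀ α, fr.facet α ∉ t.map ⟨fr.facet, fr.facet_injective⟩ → 0 < ξ (intVec α.1)) ↔
        ∀ α ∈ tᶜ, 0 < ξ (intVec α.1) := by
      simp only [and_iff_right h1, h2]
    rw [h3, if_congr h4 rfl rfl, Finset.prod_map, Finset.card_map, Finset.card_compl, fr.card_eq,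
      mul_assoc]
    rfl

/-- The sum over the vertices of the polarized products. -/
def polarSum [Fintype (Δ.extremePoints ℝ)] (ξ : Module.Dual ℝ (Fin n → ℝ))
    (fr : ∀ v : Δ.extremePoints ℝ, VertexFrame Δ u μ v) (p : Fin d → ℝ) : ℝ :=
  ∑ v, vertexProd ξ (fr v) p

open Classical in
-- After the sums are interchanged, a set `K` with a common point in Δ is counted at exactly one
-- vertex and any other `K` nowhere. The right-hand side no longer contains `ξ`.
lemma polarSum_eq_sum [Fintype (Δ.extremePoints ℝ)] (hu : IsFacetPresentation Δ u μ)
    (hΔ : IsPolytope Δ) {ξ : Module.Dual ℝ (Fin n → ℝ)} (hξ : IsPolarizing Δ ξ) (p : Fin d → ℝ) :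
    polarSum ξ fr p = ∑ K : Finset (Fin d), (∏ i ∈ K, p i) *
      if ∃ x ∈ Δ, ∀ i ∈ K, slack u μ i x = 0 then (-1) ^ (n - K.card) else 0 := by
  simp only [polarSum, vertexProd_eq_sum]
  rw [Finset.sum_comm]
  refine Finset.sum_congr rfl fun K _ => ?_
  rw [← Finset.mul_sum, mul_assoc]
  congr 1
  by_cases hK : ∃ x ∈ Δ, ∀ i ∈ K, slack u μ i x = 0
  · obtain ⟨w, hw, huniq⟩ := existsUnique_min_vertex fr hu hΔ hξ K hK
    rw [if_pos hK, Finset.sum_eq_single w, if_pos hw, mul_one]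
    · exact fun v _ hv => if_neg fun h => hv (huniq v h)
    · simp
  · rw [if_neg hK, Finset.sum_eq_zero, mul_zero]
    exact fun v _ => if_neg fun h => hK ⟨v.1, v.2.1, h.1⟩

lemma polarSum_congr [Fintype (Δ.extremePoints ℝ)] (hu : IsFacetPresentation Δ u μ)
    (hΔ : IsPolytope Δ) {ξ ξ' : Module.Dual ℝ (Fin n → ℝ)} (hξ : IsPolarizing Δ ξ)
    (hξ' : IsPolarizing Δ ξ') (p : Fin d → ℝ) : polarSum ξ fr p = polarSum ξ' fr p := by
  rw [polarSum_eq_sum fr hu hΔ hξ, polarSum_eq_sum fr hu hΔ hξ']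

/-- A flipped edge makes a factor `1 - 1` appear, so the only vertex to contribute is the one with
no flipped edge. That is the maximum of `ξ`, found as the minimum of `-ξ`. -/
lemma polarSum_one [Fintype (Δ.extremePoints ℝ)] (hu : IsFacetPresentation Δ u μ)
    (hΔ : IsPolytope Δ) {ξ : Module.Dual ℝ (Fin n → ℝ)} (hξ : IsPolarizing Δ ξ) :
    polarSum ξ fr 1 = 1 := by
  have hneg : IsPolarizing Δ (-ξ) := fun v hv α hα => by simpa using hξ v hv α hα
  obtain ⟨x, hx⟩ := hΔ.nonempty
  obtain ⟨w, ⟨-, hw⟩, huniq⟩ := existsUnique_min_vertex fr hu hΔ hneg ∅ ⟨x, hx, by simp⟩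
  rw [polarSum, Finset.sum_eq_single w]
  · refine Finset.prod_eq_one fun α _ => ?_
    have := hw α (by simp)
    rw [LinearMap.neg_apply, neg_pos] at this
    simp [flipInd, this.not_gt]
  · intro v _ hv
    by_contra hne
    refine hv (huniq v ⟨by simp, fun α _ => ?_⟩)
    have h1 := Finset.prod_ne_zero_iff.1 hne α (Finset.mem_univ _)
    rw [LinearMap.neg_apply, neg_pos]
    refine lt_of_le_of_ne (not_lt.1 fun h => h1 ?_) (hξ v.1 v.2 _ α.2)
    simp [flipInd, h]
  · simp

/-- If some half-space is violated then the polarized products cancel. -/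
lemma polarSum_eq_zero [Fintype (Δ.extremePoints ℝ)] (hu : IsFacetPresentation Δ u μ)
    (hΔ : IsPolytope Δ) {ξ : Module.Dual ℝ (Fin n → ℝ)} (hξ : IsPolarizing Δ ξ) {h : Fin d → ℝ}
    (hh : ∀ v : Δ.extremePoints ℝ,
      v.1 - ∑ α, h ((fr v).facet α) • intVec α.1 ∈ dilated (fun i => intVec (u i)) μ h)
    {x : Fin n → ℝ} {i : Fin d} (hi : slack u μ i x + h i < 0) {p : Fin d → ℝ}
    (hp0 : ∀ j, slack u μ j x + h j < 0 → p j = 0)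
    (hp1 : ∀ j, 0 < slack u μ j x + h j → p j = 1) : polarSum ξ fr p = 0 := by
  set y : Δ.extremePoints ℝ → Fin n → ℝ :=
    fun v => v.1 - ∑ α, h ((fr v).facet α) • intVec α.1 with hy
  -- The sum does not depend on the polarization, which is now chosen near minus the violated
  -- normal. A small multiple of `ξ` keeps it polarizing, and it still increases strictly from each
  -- shifted vertex `y v` to `x`.
  obtain ⟨t, ht⟩ : ∃ t : ℝ, IsPolarizing Δ (-pairing (u i) + t • ξ) ∧
      ∀ v, 0 < (-pairing (u i) + t • ξ) (x - y v) := by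
    have hev : ∀ᶠ t in nhdsWithin (0 : ℝ) (Set.Ioi 0),
        (∀ v : Δ.extremePoints ℝ, ∀ α : edgeVectors Δ v.1,
          (-pairing (u i) + t • ξ) (intVec α.1) ≠ 0) ∧
        ∀ v, 0 < (-pairing (u i) + t • ξ) (x - y v) := by
      refine Filter.Eventually.and ?_ ?_
      · rw [Filter.eventually_all]
        intro v
        rw [Filter.eventually_all]
        intro α
        simp only [LinearMap.add_apply, LinearMap.neg_apply, LinearMap.smul_apply, smul_eq_mul]
        by_cases h0 : pairing (u i) (intVec α.1) = 0
        · filter_upwards [self_mem_nhdsWithin] with t ht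
          rw [h0, neg_zero, zero_add]
          exact mul_ne_zero (ne_of_gt ht) (hξ v.1 v.2 _ α.2)
        · refine nhdsWithin_le_nhds ?_
          have hc : Continuous fun t : ℝ =>
            -pairing (u i) (intVec α.1) + t * ξ (intVec α.1) := by fun_prop
          exact hc.continuousAt.eventually_ne (by simpa using h0)
      · rw [Filter.eventually_all]
        intro v
        refine nhdsWithin_le_nhds ?_
        have hc : Continuous fun t : ℝ => (-pairing (u i) + t • ξ) (x - y v) := by
          simp only [LinearMap.add_apply, LinearMap.neg_apply, LinearMap.smul_apply, smul_eq_mul]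
          fun_prop
        refine hc.continuousAt.eventually_const_lt ?_
        have h1 := mem_dilated.1 (hh v) i
        have h2 : slack u μ i x = slack u μ i (y v) + pairing (u i) (x - y v) := by
          rw [← slack_add, add_sub_cancel]
        change 0 ≤ slack u μ i (y v) + h i at h1
        simp only [LinearMap.add_apply, LinearMap.neg_apply, LinearMap.smul_apply, smul_eq_mul,
          zero_mul, add_zero]
        linarith
    obtain ⟨t, ht1, ht2⟩ := hev.exists
    exact ⟨t, fun v hv α hα => ht1 ⟨v, hv⟩ ⟨α, hα⟩, ht2⟩
  obtain ⟨hpol, hpos⟩ := ht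
  rw [polarSum_congr fr hu hΔ hξ hpol]
  set η := -pairing (u i) + t • ξ
  refine Finset.sum_eq_zero fun v _ => ?_
  have hexp : x - y v =
      ∑ α, (slack u μ ((fr v).facet α) x + h ((fr v).facet α)) • intVec α.1 := by
    conv_lhs => rw [(fr v).eq_add_sum x]
    simp only [hy, add_smul, Finset.sum_add_distrib]
    abel
  have h1 := hpos v
  rw [hexp, map_sum] at h1
  -- Some edge contributes positively to this increase. Its coordinate and the value of the
  -- functional on it have the same strict sign, so the corresponding factor is `1 - 1` or `0 - 0`.
  obtain ⟨α, -, hα⟩ := Finset.exists_lt_of_sum_lt (s := Finset.univ)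
    (f := fun _ : edgeVectors Δ v.1 => (0 : ℝ)) (by simpa using h1)
  refine Finset.prod_eq_zero (Finset.mem_univ α) ?_
  rcases mul_pos_iff.1 hα with ⟨h2, h3⟩ | ⟨h2, h3⟩
  · rw [hp1 _ h2, flipInd, if_pos h3, sub_self]
  · rw [hp0 _ h2, flipInd, if_neg h3.not_gt, sub_self]

/-- The vertices of the shifted polytopes are feasible for small shifts. -/
lemma eventually_shifted_vertices_mem [Finite (Δ.extremePoints ℝ)]
    (hu : IsFacetPresentation Δ u μ) : ∀ᶠ h : Fin d → ℝ in nhds 0, ∀ v : Δ.extremePoints ℝ,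
      v.1 - ∑ α, h ((fr v).facet α) • intVec α.1 ∈ dilated (fun i => intVec (u i)) μ h := by
  rw [Filter.eventually_all]
  intro v
  simp only [mem_dilated]
  rw [Filter.eventually_all]
  intro i
  rcases (hu.mem_iff.1 v.2.1 i).eq_or_lt with h0 | h0
  · obtain ⟨β, rfl⟩ := ((fr v).slack_eq_zero_iff i).1 h0.symm
    refine Filter.Eventually.of_forall fun h => ?_
    rw [sub_eq_add_neg, slack_add, ← h0, map_neg, map_sum]
    simp [(fr v).pairing_facet]
  · have hc : Continuous fun h : Fin d → ℝ =>
        slack u μ i (v.1 - ∑ α, h ((fr v).facet α) • intVec α.1) + h i :=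
      ((continuous_slack u μ i).comp (by fun_prop)).add (continuous_apply i)
    have h1 : ∀ᶠ h in nhds (0 : Fin d → ℝ),
        0 < slack u μ i (v.1 - ∑ α, h ((fr v).facet α) • intVec α.1) + h i :=
      hc.continuousAt.eventually_const_lt (by simpa using h0)
    exact h1.mono fun h hh => hh.le

/-- The polar decomposition of the shifted polytopes. -/
theorem polarSum_indicator [Fintype (Δ.extremePoints ℝ)] (hu : IsFacetPresentation Δ u μ)
    (hΔ : IsPolytope Δ) {ξ : Module.Dual ℝ (Fin n → ℝ)} (hξ : IsPolarizing Δ ξ) {h : Fin d → ℝ}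
    (hh : ∀ v : Δ.extremePoints ℝ,
      v.1 - ∑ α, h ((fr v).facet α) • intVec α.1 ∈ dilated (fun i => intVec (u i)) μ h)
    (x : Fin n → ℝ) :
    polarSum ξ fr (fun i => if 0 ≤ slack u μ i x + h i then 1 else 0) =
      (dilated (fun i => intVec (u i)) μ h).indicator 1 x := by
  by_cases hx : x ∈ dilated (fun i => intVec (u i)) μ h
  · rw [Set.indicator_of_mem hx, Pi.one_apply]
    refine Eq.trans ?_ (polarSum_one fr hu hΔ hξ)
    congr 1
    ext i
    rw [if_pos (mem_dilated.1 hx i), Pi.one_apply]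
  · rw [Set.indicator_of_notMem hx]
    rw [mem_dilated] at hx
    push Not at hx
    obtain ⟨i, hi⟩ := hx
    refine polarSum_eq_zero fr hu hΔ hξ hh hi (fun j hj => if_neg hj.not_ge)
      fun j hj => if_pos hj.le

/-- The weighted polar decomposition. -/
theorem polarSum_halfStep [Fintype (Δ.extremePoints ℝ)] (hu : IsFacetPresentation Δ u μ)
    (hΔ : IsPolytope Δ) {ξ : Module.Dual ℝ (Fin n → ℝ)} (hξ : IsPolarizing Δ ξ) (x : Fin n → ℝ) :
    polarSum ξ fr (fun i => halfStep (slack u μ i x)) = ∏ i, halfStep (slack u μ i x) := by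
  classical
  by_cases hx : x ∈ Δ
  · have hx' := hu.mem_iff.1 hx
    set A : Finset (Fin d) := {i | slack u μ i x = 0} with hA
    have hstep : ∀ i, halfStep (slack u μ i x) = if i ∈ A then 1 / 2 else 1 := by
      intro i
      rcases (hx' i).eq_or_lt with h0 | h0
      · rw [← h0, halfStep_zero, if_pos (by simp [hA, ← h0])]
      · rw [halfStep_of_pos h0, if_neg (by simp [hA, h0.ne'])]
    -- Moving the facets of `T` inwards by a small `δ` expels `x` unless `T` is empty. The
    -- unweighted decomposition of the shifted polytope then evaluates the polynomial at the 0-1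
    -- vector of `T`.
    have hT : ∀ T ⊆ A, polarSum ξ fr (fun i => if i ∈ T then 0 else 1) =
        if T = ∅ then 1 else 0 := by
      intro T hTA
      obtain ⟨δ, hδ0, hδ⟩ : ∃ δ : ℝ, 0 < δ ∧ ∀ v : Δ.extremePoints ℝ,
          v.1 - ∑ α, (fun i => if i ∈ T then -δ else 0) ((fr v).facet α) • intVec α.1 ∈
            dilated (fun i => intVec (u i)) μ (fun i => if i ∈ T then -δ else 0) := by
        have hc : Continuous fun δ : ℝ => (fun i => if i ∈ T then -δ else 0 : Fin d → ℝ) := by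
          refine continuous_pi fun i => ?_
          by_cases hi : i ∈ T
          · simp only [hi, if_true]; fun_prop
          · simp only [hi, if_false]; fun_prop
        have h1 := hc.continuousAt (x := 0)
        have h2 : (fun i => if i ∈ T then -(0 : ℝ) else 0 : Fin d → ℝ) = 0 := by
          ext i; simp
        rw [ContinuousAt, h2] at h1
        have h3 := h1.eventually (eventually_shifted_vertices_mem fr hu)
        obtain ⟨δ, hδ, hδ0⟩ := ((h3.filter_mono (nhdsWithin_le_nhds (s := Set.Ioi 0))).and
          self_mem_nhdsWithin).exists
        exact ⟨δ, hδ0, hδ⟩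
      have h4 := polarSum_indicator fr hu hΔ hξ hδ x
      have h5 : ∀ i, 0 ≤ slack u μ i x + (if i ∈ T then -δ else 0) ↔ i ∉ T := by
        intro i
        by_cases hi : i ∈ T
        · have : slack u μ i x = 0 := by simpa [hA] using hTA hi
          simp [hi, this, hδ0]
        · simp [hi, hx' i]
      simp only [h5, ite_not] at h4
      rw [h4, Set.indicator_apply]
      simp only [mem_dilated, h5, Pi.one_apply, Finset.eq_empty_iff_forall_notMem]
    -- A weight `1/2` is the mean of the values 0 and 1. As the polynomial is multi-affine, its
    -- value at the half weights is the mean over all `T ⊆ A` of the values just found, and only the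
    -- empty `T` contributes.
    have hprod : ∀ K : Finset (Fin d), ∏ i ∈ K, halfStep (slack u μ i x) =
        (1 / 2) ^ A.card * ∑ T ∈ A.powerset, ∏ i ∈ K, (if i ∈ T then 0 else 1 : ℝ) := by
      intro K
      have h1 : ∀ T ∈ A.powerset, ∏ i ∈ K, (if i ∈ T then 0 else 1 : ℝ) =
          if T ∈ (A \ K).powerset then 1 else 0 := by
        intro T hT
        by_cases h : T ∈ (A \ K).powerset
        · rw [if_pos h, Finset.prod_eq_one]
          intro i hi
          rw [if_neg]
          intro hiT
          exact (Finset.mem_sdiff.1 (Finset.mem_powerset.1 h hiT)).2 hi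
        · rw [if_neg h]
          rw [Finset.mem_powerset, Finset.not_subset] at h
          obtain ⟨i, hiT, hi⟩ := h
          have : i ∈ K := by
            by_contra hiK
            exact hi (Finset.mem_sdiff.2 ⟨Finset.mem_powerset.1 hT hiT, hiK⟩)
          exact Finset.prod_eq_zero this (if_pos hiT)
      rw [Finset.sum_congr rfl h1, Finset.sum_ite_mem, Finset.inter_eq_right.2
        (Finset.powerset_mono.2 Finset.sdiff_subset), Finset.sum_const, Finset.card_powerset,
        nsmul_eq_mul, mul_one, ← Finset.card_sdiff_add_card_inter A K]
      simp only [hstep]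
      rw [Finset.prod_ite_mem, Finset.prod_const, Finset.inter_comm, pow_add]
      push_cast
      rw [mul_right_comm, ← mul_pow]
      norm_num
    rw [polarSum_eq_sum fr hu hΔ hξ]
    have h6 : ∑ T ∈ A.powerset, polarSum ξ fr (fun i => if i ∈ T then 0 else 1) = 1 := by
      rw [Finset.sum_congr rfl fun T hTA => hT T (Finset.mem_powerset.1 hTA),
        Finset.sum_ite_eq' A.powerset ∅ fun _ => (1 : ℝ), if_pos (Finset.empty_mem_powerset A)]
    simp only [polarSum_eq_sum fr hu hΔ hξ] at h6
    have h7 : ∏ i, halfStep (slack u μ i x) = (1 / 2) ^ A.card := by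
      simp only [hstep]
      rw [Finset.prod_ite_mem, Finset.univ_inter, Finset.prod_const]
    rw [Finset.sum_comm] at h6
    refine Eq.trans ?_ ((congrArg (fun t => (1 / 2 : ℝ) ^ A.card * t) h6).trans
      ((mul_one _).trans h7.symm))
    rw [Finset.mul_sum]
    refine Finset.sum_congr rfl fun K _ => ?_
    rw [hprod, ← Finset.sum_mul, mul_assoc]
  · have hx' := hx
    rw [hu.mem_iff] at hx
    push Not at hx
    obtain ⟨i, hi⟩ := hx
    rw [Finset.prod_eq_zero (Finset.mem_univ i) (halfStep_of_neg hi)]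
    refine polarSum_eq_zero fr hu hΔ hξ (h := 0) (x := x) (i := i) (fun v => ?_) (by simpa using hi)
      (fun j hj => halfStep_of_neg (by simpa using hj))
      (fun j hj => halfStep_of_pos (by simpa using hj))
    simpa [← hu.eq_inter] using v.2.1

end PolarDecomposition


/-! ### The weighted characteristic function -/

section WeightedChar

variable {n d : ℕ} {Δ : Set (Fin n → ℝ)} {u : Fin d → Fin n → ℤ} {μ : Fin d → ℝ}

/-- From a relative interior point a segment coming from anywhere in the set can be prolonged a
little. -/
lemma exists_add_smul_mem_of_mem_intrinsicInterior {F : Set (Fin n → ℝ)} {x y : Fin n → ℝ}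
    (hx : x ∈ intrinsicInterior ℝ F) (hy : y ∈ F) : ∃ δ : ℝ, 0 < δ ∧ x + δ • (x - y) ∈ F := by
  obtain ⟨x', hx', rfl⟩ := mem_intrinsicInterior.1 hx
  have hmem : ∀ δ : ℝ, x'.1 + δ • (x'.1 - y) ∈ affineSpan ℝ F := by
    intro δ
    have := AffineMap.lineMap_mem (-δ) x'.2 (subset_affineSpan ℝ F hy)
    rwa [AffineMap.lineMap_apply_module', add_comm, neg_smul, ← smul_neg, neg_sub] at this
  have hc : Continuous fun δ : ℝ => (⟨x'.1 + δ • (x'.1 - y), hmem δ⟩ : affineSpan ℝ F) :=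
    Continuous.subtype_mk (by fun_prop) _
  have h0 : (⟨x'.1 + (0 : ℝ) • (x'.1 - y), hmem 0⟩ : affineSpan ℝ F) = x' := by
    ext1; simp
  have h1 : ∀ᶠ δ in nhds (0 : ℝ), (⟨x'.1 + δ • (x'.1 - y), hmem δ⟩ : affineSpan ℝ F) ∈
      ((↑) ⁻¹' F : Set (affineSpan ℝ F)) := by
    refine (hc.continuousAt (x := 0)).eventually ?_
    change ∀ᶠ z in nhds (⟨x'.1 + (0 : ℝ) • (x'.1 - y), hmem 0⟩ : affineSpan ℝ F), _
    rw [h0]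
    exact mem_interior_iff_mem_nhds.1 hx'
  obtain ⟨δ, hδ, hδ0⟩ := ((h1.filter_mono (nhdsWithin_le_nhds (s := Set.Ioi 0))).and
    self_mem_nhdsWithin).exists
  exact ⟨δ, hδ0, hδ⟩

/-- The points of `Δ` on all the facets in `A`. -/
def facetInter (Δ : Set (Fin n → ℝ)) (u : Fin d → Fin n → ℤ) (μ : Fin d → ℝ)
    (A : Finset (Fin d)) : Set (Fin n → ℝ) :=
  {y ∈ Δ | ∀ i ∈ A, slack u μ i y = 0}

variable (hu : IsFacetPresentation Δ u μ)
include hu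

/-- The sum of the slacks over `A` is nonnegative on Δ and vanishes only where all of them do; the
exposing functional is minus the sum of the normals. -/
lemma IsFacetPresentation.isExposed_facetInter (A : Finset (Fin d)) :
    IsExposed ℝ Δ (facetInter Δ u μ A) := by
  rintro ⟨x, hx, hxA⟩
  refine ⟨LinearMap.toContinuousLinearMap (-∑ i ∈ A, pairing (u i)), ?_⟩
  have hval : ∀ y, (-∑ i ∈ A, pairing (u i)) y = ∑ i ∈ A, μ i - ∑ i ∈ A, slack u μ i y := by
    intro y
    simp [slack, Finset.sum_add_distrib]
  ext y
  simp only [facetInter, Set.mem_ofPred_eq, LinearMap.coe_toContinuousLinearMap', hval,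
    sub_le_sub_iff_left]
  refine and_congr_right fun hy => ⟨fun h z hz => ?_, fun h => ?_⟩
  · rw [Finset.sum_eq_zero h]
    exact Finset.sum_nonneg fun i _ => hu.mem_iff.1 hz i
  · have h1 := h x hx
    rw [Finset.sum_eq_zero hxA] at h1
    exact (Finset.sum_eq_zero_iff_of_nonneg fun i _ => hu.mem_iff.1 hy i).1
      (le_antisymm h1 (Finset.sum_nonneg fun i _ => hu.mem_iff.1 hy i))

/-- Small displacements along the face through `x` stay in the face. -/
lemma IsFacetPresentation.exists_add_smul_mem {A : Finset (Fin d)} {x w : Fin n → ℝ}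
    (hA : ∀ i, i ∈ A ↔ slack u μ i x = 0) (hx : x ∈ Δ) (hw : ∀ i ∈ A, pairing (u i) w = 0) :
    ∃ δ : ℝ, 0 < δ ∧ x + δ • w ∈ facetInter Δ u μ A := by
  have hev : ∀ᶠ δ in nhds (0 : ℝ), ∀ i, 0 ≤ slack u μ i (x + δ • w) := by
    rw [Filter.eventually_all]
    intro i
    rcases (hu.mem_iff.1 hx i).eq_or_lt with h0 | h0
    · refine Filter.Eventually.of_forall fun δ => ?_
      rw [slack_add, map_smul, hw i ((hA i).2 h0.symm), smul_zero, add_zero]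
      exact h0.le
    · have hc : Continuous fun δ : ℝ => slack u μ i (x + δ • w) :=
        (continuous_slack u μ i).comp (by fun_prop)
      have h1 : ∀ᶠ δ in nhds (0 : ℝ), 0 < slack u μ i (x + δ • w) :=
        hc.continuousAt.eventually_const_lt (by simpa using h0)
      exact h1.mono fun δ hδ => hδ.le
  obtain ⟨δ, hδ, hδ0⟩ := ((hev.filter_mono (nhdsWithin_le_nhds (s := Set.Ioi 0))).and
    self_mem_nhdsWithin).exists
  refine ⟨δ, hδ0, hu.mem_iff.2 hδ, fun i hi => ?_⟩
  rw [slack_add, map_smul, hw i hi, smul_zero, add_zero]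
  exact (hA i).1 hi

/-- The active constraints hold with equality on the whole affine span, and the inactive ones are
strict at `x`, hence on a neighbourhood. -/
lemma IsFacetPresentation.mem_intrinsicInterior_facetInter {A : Finset (Fin d)} {x : Fin n → ℝ}
    (hA : ∀ i, i ∈ A ↔ slack u μ i x = 0) (hx : x ∈ Δ) :
    x ∈ intrinsicInterior ℝ (facetInter Δ u μ A) := by
  have hxF : x ∈ facetInter Δ u μ A := ⟨hx, fun i hi => (hA i).1 hi⟩
  have hspan : ∀ y ∈ affineSpan ℝ (facetInter Δ u μ A), ∀ i ∈ A, slack u μ i y = 0 := by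
    intro y hy i hi
    refine affineSpan_induction (p := fun y => slack u μ i y = 0) hy (fun z hz => hz.2 i hi) ?_
    · intro c p q r hp hq hr
      simp only [slack, vsub_eq_sub, vadd_eq_add, map_add, map_smul, map_sub, smul_eq_mul] at *
      linear_combination c * hp - c * hq + hr
  refine mem_intrinsicInterior.2 ⟨⟨x, subset_affineSpan ℝ _ hxF⟩, ?_, rfl⟩
  rw [mem_interior]
  refine ⟨{y | ∀ i, i ∉ A → 0 < slack u μ i y.1}, ?_, ?_, ?_⟩
  · intro y hy
    refine ⟨hu.mem_iff.2 fun i => ?_, hspan y.1 y.2⟩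
    by_cases hi : i ∈ A
    · exact (hspan y.1 y.2 i hi).ge
    · exact (hy i hi).le
  · simp only [Set.ofPred_forall]
    refine isOpen_iInter_of_finite fun i => isOpen_iInter_of_finite fun _ => ?_
    exact isOpen_lt continuous_const ((continuous_slack u μ i).comp continuous_subtype_val)
  · intro i hi
    exact (hu.mem_iff.1 hx i).lt_of_ne' fun h => hi ((hA i).2 h)

/-- Both inclusions prolong a segment beyond `x`. A slack vanishing at `x` cannot be positive
elsewhere on `F`, and the exposing functional of `F`, maximal at `x`, cannot be smaller at a point
of the facet intersection. -/
lemma IsFacetPresentation.eq_facetInter {A : Finset (Fin d)} {x : Fin n → ℝ}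
    (hA : ∀ i, i ∈ A ↔ slack u μ i x = 0) {F : Set (Fin n → ℝ)} (hF : IsFace Δ F)
    (hx : x ∈ intrinsicInterior ℝ F) : F = facetInter Δ u μ A := by
  obtain ⟨l, hl⟩ := hF.2 hF.1
  have hxF := intrinsicInterior_subset hx
  have hxF' := hxF
  rw [hl] at hxF'
  refine Set.Subset.antisymm (fun y hy => ?_) fun y hy => ?_
  · have hyΔ : y ∈ Δ := hF.2.subset hy
    refine ⟨hyΔ, fun i hi => ?_⟩
    obtain ⟨δ, hδ0, hδ⟩ := exists_add_smul_mem_of_mem_intrinsicInterior hx hy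
    have h1 := hu.mem_iff.1 (hF.2.subset hδ) i
    have h2 : slack u μ i (x + δ • (x - y)) = -(δ * slack u μ i y) := by
      rw [slack_add, (hA i).1 hi, map_smul, map_sub, smul_eq_mul]
      have h3 := (hA i).1 hi
      rw [slack] at h3 ⊢
      linear_combination δ * h3
    rw [h2, neg_nonneg] at h1
    exact le_antisymm (nonpos_of_mul_nonpos_right h1 hδ0) (hu.mem_iff.1 hyΔ i)
  · rw [hl]
    refine ⟨hy.1, fun z hz => ((hxF'.2 z hz).trans ?_)⟩
    obtain ⟨δ, hδ0, hδ⟩ := hu.exists_add_smul_mem hA hxF'.1 (w := x - y) fun i hi => by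
      have h1 := (hA i).1 hi
      have h2 := hy.2 i hi
      rw [slack] at h1 h2
      rw [map_sub]
      linarith
    have h1 := hxF'.2 _ hδ.1
    rw [map_add, map_smul, map_sub, smul_eq_mul, add_le_iff_nonpos_right] at h1
    exact sub_nonpos.1 (nonpos_of_mul_nonpos_right h1 hδ0)

/-- The directions of the face are the common kernel of the normals in `A`. These normals are
independent because the face contains a vertex, where edge vectors are dual to them. -/
lemma IsFacetPresentation.faceDim_facetInter (hΔ : IsPolytope Δ)
    (fr : ∀ v : Δ.extremePoints ℝ, VertexFrame Δ u μ v) {A : Finset (Fin d)}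
    {x : Fin n → ℝ} (hA : ∀ i, i ∈ A ↔ slack u μ i x = 0) (hx : x ∈ Δ) :
    A.card + faceDim (facetInter Δ u μ A) = n := by
  classical
  set L : (Fin n → ℝ) →ₗ[ℝ] (A → ℝ) := LinearMap.pi fun i => pairing (u i.1) with hL
  have hspan : vectorSpan ℝ (facetInter Δ u μ A) = LinearMap.ker L := by
    refine le_antisymm ?_ fun w hw => ?_
    · refine Submodule.span_le.2 ?_
      rintro _ ⟨y, hy, z, hz, rfl⟩
      rw [SetLike.mem_coe, LinearMap.mem_ker]
      ext i
      have h1 := hy.2 i.1 i.2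
      have h2 := hz.2 i.1 i.2
      rw [slack] at h1 h2
      simp only [hL, LinearMap.pi_apply, vsub_eq_sub, map_sub, Pi.zero_apply]
      linarith
    · obtain ⟨δ, hδ0, hδ⟩ := hu.exists_add_smul_mem hA hx (w := w) fun i hi =>
        congrFun (LinearMap.mem_ker.1 hw) ⟨i, hi⟩
      have h1 := vsub_mem_vectorSpan ℝ hδ
        (⟨hx, fun i hi => (hA i).1 hi⟩ : x ∈ facetInter Δ u μ A)
      rw [vsub_eq_sub, add_sub_cancel_left] at h1
      exact (Submodule.smul_mem_iff _ hδ0.ne').1 h1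
  -- The zero functional is enough here, any vertex of the face being suitable.
  obtain ⟨v, hv, hvA, -⟩ := hu.exists_vertex_min hΔ A ⟨x, hx, fun i hi => (hA i).1 hi⟩ 0
  have hsurj : Function.Surjective L := by
    intro c
    have hα : ∀ i : A, ∃ α, (fr ⟨v, hv⟩).facet α = i := fun i =>
      ((fr ⟨v, hv⟩).slack_eq_zero_iff i).1 (hvA i i.2)
    choose e he using hα
    refine ⟨∑ i, c i • intVec (e i).1, ?_⟩
    ext j
    simp only [hL, LinearMap.pi_apply, map_sum, map_smul, ← he j, (fr ⟨v, hv⟩).pairing_facet]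
    rw [Finset.sum_eq_single j]
    · simp
    · intro i _ hij
      rw [if_neg, smul_zero]
      intro h
      refine hij (Subtype.ext ?_)
      rw [← he i, ← he j, h]
    · simp
  have h1 := L.finrank_range_add_finrank_ker
  rw [LinearMap.range_eq_top.2 hsurj, finrank_top, Module.finrank_fintype_fun_eq_card,
    Module.finrank_fin_fun, Fintype.card_coe, ← hspan] at h1
  exact h1

/-- The weighted characteristic function in terms of the facets. -/
theorem IsFacetPresentation.weightedChar_eq (hΔ : IsPolytope Δ)
    (fr : ∀ v : Δ.extremePoints ℝ, VertexFrame Δ u μ v) (x : Fin n → ℝ) :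
    weightedChar Δ x = ∏ i, halfStep (slack u μ i x) := by
  classical
  by_cases hx : x ∈ Δ
  · set A : Finset (Fin d) := {i | slack u μ i x = 0} with hAdef
    have hA : ∀ i, i ∈ A ↔ slack u μ i x = 0 := by simp [hAdef]
    have hface : IsFace Δ (facetInter Δ u μ A) :=
      ⟨⟨x, hx, fun i hi => (hA i).1 hi⟩, hu.isExposed_facetInter A⟩
    have hdim := hu.faceDim_facetInter hΔ fr hA hx
    have hcod : n - faceDim (facetInter Δ u μ A) = A.card := by omega
    rw [weightedChar, finsum_eq_single _ (facetInter Δ u μ A), finsum_eq_if,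
      if_pos (show facetInter Δ u μ A ∈ {F | IsFace Δ F} from hface),
      Set.indicator_of_mem (hu.mem_intrinsicInterior_facetInter hA hx), hcod]
    · have hstep : ∀ i, halfStep (slack u μ i x) = if i ∈ A then 1 / 2 else 1 := by
        intro i
        by_cases hi : i ∈ A
        · rw [if_pos hi, (hA i).1 hi, halfStep_zero]
        · rw [if_neg hi, halfStep_of_pos]
          exact (hu.mem_iff.1 hx i).lt_of_ne' fun h => hi ((hA i).2 h)
      simp only [hstep]
      rw [Finset.prod_ite_mem, Finset.univ_inter, Finset.prod_const]
    · intro F hF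
      rw [finsum_eq_if, ite_eq_right_iff]
      intro hface
      exact Set.indicator_of_notMem (fun h => hF (hu.eq_facetInter hA hface h)) _
  · have hprod : ∏ i, halfStep (slack u μ i x) = 0 := by
      rw [hu.mem_iff] at hx
      push Not at hx
      obtain ⟨i, hi⟩ := hx
      exact Finset.prod_eq_zero (Finset.mem_univ i) (halfStep_of_neg hi)
    rw [hprod, weightedChar]
    refine finsum_mem_eq_zero_of_forall_eq_zero fun F hF => ?_
    exact Set.indicator_of_notMem (fun h => hx (hF.2.subset (intrinsicInterior_subset h))) _

end WeightedChar


/-! ### Vertex charts -/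

section VertexChart

variable {n d : ℕ}

/-- The integer matrix of the map has an integer left inverse, so its determinant is `±1`. -/
lemma measurePreserving_sum_smul_intVec {J : Type*} [Fintype J] [DecidableEq J]
    (hJ : Fintype.card J = n) (w c : J → Fin n → ℤ)
    (hcw : ∀ i j, ∑ k, c i k * w j k = if i = j then 1 else 0) :
    MeasurePreserving (fun t : J → ℝ => ∑ j, t j • intVec (w j)) := by
  set e := Fintype.equivFinOfCardEq hJ
  set M : Matrix (Fin n) (Fin n) ℤ := Matrix.of fun k j => w (e.symm j) k with hM
  set C : Matrix (Fin n) (Fin n) ℤ := Matrix.of fun j k => c (e.symm j) k with hC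
  have hCM : C * M = 1 := by
    ext i j
    rw [Matrix.mul_apply, Matrix.one_apply]
    simp only [hM, hC, Matrix.of_apply, hcw, e.symm.injective.eq_iff]
  have hdet : IsUnit M.det := by
    refine IsUnit.of_mul_eq_one C.det ?_
    rw [mul_comm, ← Matrix.det_mul, hCM, Matrix.det_one]
  have hdetR : (M.map (Int.castRingHom ℝ)).det = (M.det : ℝ) :=
    ((Int.castRingHom ℝ).map_det M).symm
  have habs : |(M.map (Int.castRingHom ℝ)).det| = 1 := by
    rw [hdetR]
    rcases Int.isUnit_iff.1 hdet with h | h <;> simp [h]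
  have hne : (M.map (Int.castRingHom ℝ)).det ≠ 0 := by
    intro h
    rw [h, abs_zero] at habs
    exact zero_ne_one habs
  have hT : MeasurePreserving (Matrix.toLin' (M.map (Int.castRingHom ℝ))) := by
    refine ⟨(LinearMap.continuous_of_finiteDimensional _).measurable, ?_⟩
    rw [Real.map_matrix_volume_pi_eq_smul_volume_pi hne, abs_inv, habs]
    simp
  have he := volume_measurePreserving_piCongrLeft (fun _ : Fin n => ℝ) e
  have hcomp : (fun t : J → ℝ => ∑ j, t j • intVec (w j)) =
      Matrix.toLin' (M.map (Int.castRingHom ℝ)) ∘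
        MeasurableEquiv.piCongrLeft (fun _ : Fin n => ℝ) e := by
    ext t k
    simp only [Function.comp_apply, Matrix.toLin'_apply, Matrix.mulVec, dotProduct, Matrix.map_apply,
      hM, Matrix.of_apply, Finset.sum_apply, Pi.smul_apply, smul_eq_mul, intVec]
    refine Fintype.sum_equiv e _ _ fun j => ?_
    have : (MeasurableEquiv.piCongrLeft (fun _ : Fin n => ℝ) e) t (e j) = t j :=
      MeasurableEquiv.piCongrLeft_apply_apply (β := fun _ => ℝ) e t j
    rw [this, e.symm_apply_apply, mul_comm]
    rfl
  rw [hcomp]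
  exact hT.comp he

/-- The sign by which an edge vector is polarized. -/
def edgeSign (ξ : Module.Dual ℝ (Fin n → ℝ)) (α : Fin n → ℤ) : ℤˣ :=
  if 0 < ξ (intVec α) then -1 else 1

lemma edgeSign_mul_self (ξ : Module.Dual ℝ (Fin n → ℝ)) (α : Fin n → ℤ) :
    ((edgeSign ξ α : ℤ) : ℝ) * ((edgeSign ξ α : ℤ) : ℝ) = 1 := by
  rcases units_cast_eq (edgeSign ξ α) with h | h <;> simp [h]

lemma polarized_eq (ξ : Module.Dual ℝ (Fin n → ℝ)) (α : Fin n → ℤ) :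
    polarized ξ α = ((edgeSign ξ α : ℤ) : ℝ) • intVec α := by
  rw [polarized, edgeSign]
  split_ifs <;> simp

lemma polarized_eq_intVec (ξ : Module.Dual ℝ (Fin n → ℝ)) (α : Fin n → ℤ) :
    polarized ξ α = intVec ((edgeSign ξ α : ℤ) • α) := by
  rw [polarized_eq, intVec_smul]

lemma neg_one_pow_flipCount (Δ : Set (Fin n → ℝ)) (ξ : Module.Dual ℝ (Fin n → ℝ))
    (v : Fin n → ℝ) :
    (-1 : ℝ) ^ flipCount Δ ξ v = ∏ α : edgeVectors Δ v, ((edgeSign ξ α.1 : ℤ) : ℝ) := by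
  rw [flipCount, ← Finset.prod_const, Finset.prod_filter,
    Finset.prod_coe_sort (edgeVectors Δ v) fun α => ((edgeSign ξ α : ℤ) : ℝ)]
  refine Finset.prod_congr rfl fun α _ => ?_
  rw [edgeSign]
  split_ifs <;> simp

variable {Δ : Set (Fin n → ℝ)} {u : Fin d → Fin n → ℤ} {μ : Fin d → ℝ} {v : Fin n → ℝ}
  (fr : VertexFrame Δ u μ v) (ξ : Module.Dual ℝ (Fin n → ℝ))

lemma vertexChart_eq (t : edgeVectors Δ v → ℝ) : vertexChart Δ ξ v t =
    v + ∑ α, t α • intVec ((edgeSign ξ α.1 : ℤ) • α.1) := by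
  simp only [vertexChart, polarized_eq_intVec]

namespace VertexFrame

lemma slack_vertexChart (t : edgeVectors Δ v → ℝ) (α : edgeVectors Δ v) :
    slack u μ (fr.facet α) (vertexChart Δ ξ v t) = ((edgeSign ξ α.1 : ℤ) : ℝ) * t α := by
  rw [vertexChart, slack_add, (fr.slack_eq_zero_iff _).2 ⟨α, rfl⟩, zero_add, map_sum,
    Finset.sum_eq_single α]
  · rw [map_smul, polarized_eq, map_smul, fr.pairing_facet, if_pos rfl]
    simp [mul_comm]
  · intro β _ hβ
    rw [map_smul, polarized_eq, map_smul, fr.pairing_facet, if_neg hβ.symm]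
    simp
  · simp

/-- The coordinates of a point in the chart at a vertex. -/
def coord (x : Fin n → ℝ) (α : edgeVectors Δ v) : ℝ :=
  ((edgeSign ξ α.1 : ℤ) : ℝ) * slack u μ (fr.facet α) x

lemma vertexChart_coord (x : Fin n → ℝ) : vertexChart Δ ξ v (fr.coord ξ x) = x := by
  conv_rhs => rw [fr.eq_add_sum x]
  rw [vertexChart]
  congr 1
  refine Finset.sum_congr rfl fun α _ => ?_
  rw [coord, polarized_eq, smul_smul, mul_right_comm, edgeSign_mul_self, one_mul]

lemma coord_vertexChart (t : edgeVectors Δ v → ℝ) :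
    fr.coord ξ (vertexChart Δ ξ v t) = t := by
  ext α
  rw [coord, slack_vertexChart, ← mul_assoc, edgeSign_mul_self, one_mul]

/-- The chart at a vertex as a homeomorphism. -/
def chartHomeomorph : (edgeVectors Δ v → ℝ) ≃ₜ (Fin n → ℝ) where
  toFun := vertexChart Δ ξ v
  invFun := fr.coord ξ
  left_inv := fr.coord_vertexChart ξ
  right_inv := fr.vertexChart_coord ξ
  continuous_toFun := by unfold vertexChart; fun_prop
  continuous_invFun := continuous_pi fun α => continuous_const.mul (continuous_slack u μ _)

include fr in
lemma measurePreserving_vertexChart : MeasurePreserving (vertexChart Δ ξ v) := by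
  have h1 := measurePreserving_sum_smul_intVec fr.card_eq
    (fun α => (edgeSign ξ α.1 : ℤ) • α.1) (fun α => (edgeSign ξ α.1 : ℤ) • u (fr.facet α)) (by
      intro α β
      have h2 := fr.pairing_facet α β
      have h3 : ∀ k, ((edgeSign ξ α.1 : ℤ) • u (fr.facet α)) k * ((edgeSign ξ β.1 : ℤ) • β.1) k =
          ((edgeSign ξ α.1 : ℤ) * (edgeSign ξ β.1 : ℤ)) * (u (fr.facet α) k * β.1 k) := by
        intro k
        simp only [Pi.smul_apply, smul_eq_mul]
        ring
      simp only [h3]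
      rw [← Finset.mul_sum]
      rw [pairing_intVec] at h2
      have h4 : ∑ k, u (fr.facet α) k * β.1 k = if α = β then 1 else 0 := by
        split_ifs at h2 ⊢ <;> exact_mod_cast h2
      rw [h4]
      split_ifs with h
      · rw [h, Int.units_coe_mul_self, one_mul]
      · rw [mul_zero])
  have h2 : vertexChart Δ ξ v = (fun x => v + x) ∘ fun t : edgeVectors Δ v → ℝ =>
      ∑ α, t α • intVec ((edgeSign ξ α.1 : ℤ) • α.1) := by
    ext1 t
    exact vertexChart_eq ξ t
  rw [h2]
  exact (measurePreserving_add_left volume v).comp h1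

variable {E : Type*} [NormedAddCommGroup E] [NormedSpace ℝ E]

include fr in
lemma measurableEmbedding_vertexChart : MeasurableEmbedding (vertexChart Δ ξ v) :=
  (fr.chartHomeomorph ξ).measurableEmbedding

include fr in
lemma integral_comp_vertexChart (F : (Fin n → ℝ) → E) :
    ∫ t, F (vertexChart Δ ξ v t) = ∫ x, F x :=
  (fr.measurePreserving_vertexChart ξ).integral_comp (fr.measurableEmbedding_vertexChart ξ) F

include fr in
lemma setIntegral_polarizedCone (F : (Fin n → ℝ) → E) :
    ∫ x in polarizedCone Δ ξ v, F x = ∫ t in orthant 0, F (vertexChart Δ ξ v t) := by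
  have h := (fr.measurePreserving_vertexChart ξ).setIntegral_preimage_emb
    (fr.measurableEmbedding_vertexChart ξ) F (polarizedCone Δ ξ v)
  rw [← h, polarizedCone, Set.preimage_image_eq]
  exact (fr.chartHomeomorph ξ).injective

lemma intVec_latticeChart {z₀ : Fin n → ℤ} (hz : v = intVec z₀) (z : edgeVectors Δ v → ℤ) :
    intVec (z₀ + ∑ α, z α • ((edgeSign ξ α.1 : ℤ) • α.1)) =
      vertexChart Δ ξ v fun α => (z α : ℝ) := by
  rw [vertexChart_eq]
  ext k
  have := congrFun hz k
  simp only [intVec] at this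
  simp [intVec, this]

lemma coord_intVec {z₀ : Fin n → ℤ} (hz : v = intVec z₀) (y : Fin n → ℤ)
    (α : edgeVectors Δ v) : fr.coord ξ (intVec y) α =
      (((edgeSign ξ α.1 : ℤ) * ∑ k, u (fr.facet α) k * (y k - z₀ k) : ℤ) : ℝ) := by
  have h1 := (fr.slack_eq_zero_iff (fr.facet α)).2 ⟨α, rfl⟩
  rw [slack, congrArg (pairing (u (fr.facet α))) hz, pairing_intVec] at h1
  rw [coord, slack, pairing_intVec]
  push_cast at h1 ⊢
  simp only [mul_sub, Finset.sum_sub_distrib]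
  linear_combination ((edgeSign ξ α.1 : ℤ) : ℝ) * h1

/-- The chart at a lattice vertex maps the lattice points onto the lattice points. -/
def latticeEquiv {z₀ : Fin n → ℤ} (hz : v = intVec z₀) :
    (edgeVectors Δ v → ℤ) ≃ (Fin n → ℤ) where
  toFun z := z₀ + ∑ α, z α • ((edgeSign ξ α.1 : ℤ) • α.1)
  invFun y α := (edgeSign ξ α.1 : ℤ) * ∑ k, u (fr.facet α) k * (y k - z₀ k)
  left_inv z := by
    ext α
    have h := fr.coord_intVec ξ hz (z₀ + ∑ α, z α • ((edgeSign ξ α.1 : ℤ) • α.1)) α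
    rw [intVec_latticeChart ξ hz, coord_vertexChart] at h
    exact_mod_cast h.symm
  right_inv y := by
    apply intVec_injective
    rw [intVec_latticeChart ξ hz]
    simp only [← fr.coord_intVec ξ hz]
    exact fr.vertexChart_coord ξ _

lemma intVec_latticeEquiv {z₀ : Fin n → ℤ} (hz : v = intVec z₀) (z : edgeVectors Δ v → ℤ) :
    intVec (fr.latticeEquiv ξ hz z) = vertexChart Δ ξ v fun α => (z α : ℝ) :=
  intVec_latticeChart ξ hz z

/-- The weights of the polarized cone are the polarized products of the weights of the facets. -/
lemma vertexProd_halfStep (t : edgeVectors Δ v → ℝ) :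
    vertexProd ξ fr (fun i => halfStep (slack u μ i (vertexChart Δ ξ v t))) =
      (-1) ^ flipCount Δ ξ v * ∏ α, halfStep (t α) := by
  rw [neg_one_pow_flipCount, ← Finset.prod_mul_distrib, vertexProd]
  refine Finset.prod_congr rfl fun α _ => ?_
  rw [slack_vertexChart, edgeSign, flipInd]
  split_ifs
  -- For a flipped edge the factor is the weight of `-t` minus one, that is, minus the weight of
  -- `t`; these minus signs make up the sign of the vertex.
  · simp [halfStep_neg]
  · simp

open Classical in
/-- Almost everywhere, the indicator of the shifted polarized cone is the polarized product of the
indicators of the shifted half-spaces. -/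
lemma ae_vertexProd_indicator (h : Fin d → ℝ) : ∀ᵐ t : edgeVectors Δ v → ℝ,
    vertexProd ξ fr (fun i => if 0 ≤ slack u μ i (vertexChart Δ ξ v t) + h i then 1 else 0) =
      (-1) ^ flipCount Δ ξ v *
        (orthant fun α => ((edgeSign ξ α.1 : ℤ) : ℝ) * h (fr.facet α)).indicator 1 t := by
  -- On the shifted coordinate hyperplanes a closed half-space and its closed opposite overlap, so
  -- they must be excluded; they are null sets.
  filter_upwards [ae_add_ne_zero fun α : edgeVectors Δ v =>
    ((edgeSign ξ α.1 : ℤ) : ℝ) * h (fr.facet α)] with t ht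
  have hind : (orthant fun α => ((edgeSign ξ α.1 : ℤ) : ℝ) * h (fr.facet α)).indicator 1 t =
      ∏ α : edgeVectors Δ v,
        if 0 ≤ t α + ((edgeSign ξ α.1 : ℤ) : ℝ) * h (fr.facet α) then (1 : ℝ) else 0 := by
    rw [Finset.prod_ite_zero, Finset.prod_const_one, Set.indicator_apply]
    simp [orthant]
  rw [neg_one_pow_flipCount, hind, ← Finset.prod_mul_distrib, vertexProd]
  refine Finset.prod_congr rfl fun α _ => ?_
  have h1 := ht α
  rw [slack_vertexChart, flipInd]
  by_cases h2 : 0 < ξ (intVec α.1)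
  · simp only [edgeSign, h2, if_true] at h1 ⊢
    push_cast at h1 ⊢
    rcases lt_or_gt_of_ne h1 with h3 | h3
    · rw [if_pos (by linarith), if_neg (by linarith)]
      simp
    · rw [if_neg (by linarith), if_pos (by linarith)]
      simp
  · simp [edgeSign, h2]

end VertexFrame

end VertexChart


/-! ### The Euler–Maclaurin formula for the polytope -/

section Formula

variable {n d : ℕ} {Δ : Set (Fin n → ℝ)} {u : Fin d → Fin n → ℤ} {μ : Fin d → ℝ}
  {E : Type*} [NormedAddCommGroup E] [NormedSpace ℝ E]

lemma contDiff_vertexChart (ξ : Module.Dual ℝ (Fin n → ℝ)) (v : Fin n → ℝ) {N : WithTop ℕ∞} :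
    ContDiff ℝ N (vertexChart Δ ξ v) := by
  unfold vertexChart
  fun_prop

lemma VertexFrame.contDiff_comp {v : Fin n → ℝ} (fr : VertexFrame Δ u μ v)
    (ξ : Module.Dual ℝ (Fin n → ℝ)) {m : ℕ} {f : (Fin n → ℝ) → E}
    (hf : ContDiff ℝ (m * n : ℕ) f) :
    ContDiff ℝ (m * Fintype.card (edgeVectors Δ v) : ℕ) fun t => f (vertexChart Δ ξ v t) := by
  rw [fr.card_eq]
  exact hf.comp (contDiff_vertexChart ξ v)

omit [NormedSpace ℝ E] in
lemma VertexFrame.hasCompactSupport_comp {v : Fin n → ℝ} (fr : VertexFrame Δ u μ v)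
    (ξ : Module.Dual ℝ (Fin n → ℝ)) {f : (Fin n → ℝ) → E} (hc : HasCompactSupport f) :
    HasCompactSupport fun t => f (vertexChart Δ ξ v t) :=
  hc.comp_homeomorph (fr.chartHomeomorph ξ)

lemma finite_intVec_mem {K : Set (Fin n → ℝ)} (hK : IsCompact K) :
    {z : Fin n → ℤ | intVec z ∈ K}.Finite := by
  obtain ⟨C, hC⟩ := hK.isBounded.exists_norm_le
  refine (Set.finite_Icc (fun _ : Fin n => -⌈C⌉) fun _ => ⌈C⌉).subset fun z hz => ?_
  have h1 : ∀ i, |(z i : ℝ)| ≤ ⌈C⌉ := fun i =>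
    ((norm_le_pi_norm (intVec z) i).trans (hC _ hz)).trans (Int.le_ceil C)
  refine ⟨fun i => ?_, fun i => ?_⟩
  · exact_mod_cast (abs_le.1 (h1 i)).1
  · exact_mod_cast (abs_le.1 (h1 i)).2

/-- The signed lattice sums over the polarized cones add up to the weighted sum over `Δ`. -/
theorem weightedSum_eq_sum (hΔ : IsRegularLatticePolytope Δ) (hu : IsFacetPresentation Δ u μ)
    [Fintype (Δ.extremePoints ℝ)] (fr : ∀ v : Δ.extremePoints ℝ, VertexFrame Δ u μ v)
    {ξ : Module.Dual ℝ (Fin n → ℝ)} (hξ : IsPolarizing Δ ξ) {f : (Fin n → ℝ) → E}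
    (hc : HasCompactSupport f) :
    weightedSum Δ f = ∑ v : Δ.extremePoints ℝ, (-1 : ℝ) ^ flipCount Δ ξ v •
      ∑' z : edgeVectors Δ v.1 → ℤ,
        (∏ α, halfStep (z α)) • f (vertexChart Δ ξ v fun α => (z α : ℝ)) := by
  classical
  have hfin : ∀ c : (Fin n → ℤ) → ℝ,
      (Function.support fun z => c z • f (intVec z)).Finite := fun c =>
    (finite_intVec_mem hc.isCompact).subset fun z hz => subset_tsupport f fun h => hz (by simp [h])
  have h1 : weightedSum Δ f = ∑' z : Fin n → ℤ, weightedChar Δ (intVec z) • f (intVec z) := by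
    rw [tsum_eq_finsum (hfin _), weightedSum]
    refine finsum_congr fun z => ?_
    rw [finsum_eq_if]
    split_ifs with hz
    · rfl
    · rw [hu.weightedChar_eq hΔ.polytope fr]
      have hz' : intVec z ∉ Δ := hz
      rw [hu.mem_iff] at hz'
      push Not at hz'
      obtain ⟨i, hi⟩ := hz'
      rw [Finset.prod_eq_zero (Finset.mem_univ i) (halfStep_of_neg hi), zero_smul]
  rw [h1]
  simp only [hu.weightedChar_eq hΔ.polytope fr, ← polarSum_halfStep fr hu hΔ.polytope hξ, polarSum,
    Finset.sum_smul]
  rw [Summable.tsum_finsetSum fun v _ => summable_of_hasFiniteSupport (hfin _)]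
  refine Finset.sum_congr rfl fun v _ => ?_
  obtain ⟨z₀, hz₀⟩ := hΔ.integral v.1 v.2
  -- Integrality of the vertex and unimodularity of its edges turn the sum over all of `ℤⁿ` into a
  -- sum over the coordinates of the chart.
  rw [← ((fr v).latticeEquiv ξ hz₀).tsum_eq, ← tsum_const_smul'']
  refine tsum_congr fun z => ?_
  rw [(fr v).intVec_latticeEquiv ξ hz₀, (fr v).vertexProd_halfStep, mul_smul]

/-- Near `h = 0` the integral over `Δ(h)` is a signed sum of integrals over shifted orthants. -/
theorem eventually_integral_dilated_eq (hΔ : IsPolytope Δ) (hu : IsFacetPresentation Δ u μ)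
    [Fintype (Δ.extremePoints ℝ)] (fr : ∀ v : Δ.extremePoints ℝ, VertexFrame Δ u μ v)
    {ξ : Module.Dual ℝ (Fin n → ℝ)} (hξ : IsPolarizing Δ ξ) (m : ℕ) {f : (Fin n → ℝ) → E}
    (hf : Continuous f) (hc : HasCompactSupport f) :
    ∀ᶠ h : Fin d → ℝ in nhds 0, ∫ x in dilated (fun i => intVec (u i)) μ h, f x =
      ∑ v : Δ.extremePoints ℝ, (-1 : ℝ) ^ flipCount Δ ξ v •
        stdIntegral m (fun α => edgeSign ξ α.1) Finset.univ
          (fun t => f (vertexChart Δ ξ v t)) (h ∘ (fr v).facet) := by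
  classical
  filter_upwards [eventually_shifted_vertices_mem fr hu] with h hh
  have hmeas : MeasurableSet (dilated (fun i => intVec (u i)) μ h) := by
    have : dilated (fun i => intVec (u i)) μ h = ⋂ i, {x | 0 ≤ slack u μ i x + h i} := by
      ext x
      simp [mem_dilated]
    rw [this]
    exact MeasurableSet.iInter fun i => measurableSet_le measurable_const
      ((continuous_slack u μ i).measurable.add_const _)
  have hind : ∀ x, (dilated (fun i => intVec (u i)) μ h).indicator f x = ∑ v,
      vertexProd ξ (fr v) (fun i => if 0 ≤ slack u μ i x + h i then 1 else 0) • f x := by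
    intro x
    rw [← Finset.sum_smul]
    have := polarSum_indicator fr hu hΔ hξ hh x
    rw [polarSum] at this
    rw [this, Set.indicator_apply, Set.indicator_apply]
    split_ifs <;> simp
  have hint : ∀ v, Integrable fun x => vertexProd ξ (fr v)
      (fun i => if 0 ≤ slack u μ i x + h i then 1 else 0) • f x := by
    intro v
    refine integrable_bdd_smul ?_ ⟨1, fun x => ?_⟩ hf hc
    · refine Finset.measurable_prod _ fun α _ => Measurable.sub_const ?_ _
      exact Measurable.ite (measurableSet_le measurable_const
        ((continuous_slack u μ _).measurable.add_const _)) measurable_const measurable_const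
    · rw [vertexProd, Finset.abs_prod]
      refine Finset.prod_le_one (fun _ _ => abs_nonneg _) fun α _ => ?_
      rw [flipInd]
      split_ifs <;> simp
  rw [← integral_indicator hmeas, integral_congr_ae (Filter.Eventually.of_forall hind),
    integral_finsetSum _ fun v _ => hint v]
  refine Finset.sum_congr rfl fun v _ => ?_
  rw [← (fr v).integral_comp_vertexChart ξ, stdIntegral,
    ← integral_indicator (measurableSet_orthant _), ← integral_smul]
  refine integral_congr_ae ?_
  filter_upwards [(fr v).ae_vertexProd_indicator ξ h] with t ht
  rw [ht, mul_smul]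
  congr 1
  simp only [Set.indicator_apply, Function.comp_apply, Pi.one_apply]
  split_ifs
  -- With `I` the full set there is neither a periodic factor nor a derivative, so `m` plays no role
  -- in this integral.
  · simp only [Finset.compl_univ, Finset.prod_empty, one_smul, mixedPartial, Finset.toList_empty,
      List.foldr_nil]
  · simp

/-- The family of partial derivatives in `h` of the integral over `Δ(h)`. -/
def dilatedFamily [Fintype (Δ.extremePoints ℝ)]
    (fr : ∀ v : Δ.extremePoints ℝ, VertexFrame Δ u μ v) (ξ : Module.Dual ℝ (Fin n → ℝ)) (m : ℕ)
    (f : (Fin n → ℝ) → E) (a : Fin d →₀ ℕ) (h : Fin d → ℝ) : E :=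
  ∑ v : Δ.extremePoints ℝ, (-1 : ℝ) ^ flipCount Δ ξ v •
    pullbackFamily (fr v).facet (orthantFamily (fun α => ((edgeSign ξ α.1 : ℤ) : ℝ))
      (fun x => ∏ i ∈ Finset.univᶜ, periodicB m (x i)) (fun t => f (vertexChart Δ ξ v t))
        (∑ i ∈ Finset.univᶜ, Finsupp.single i m)) a h

lemma derivSystem_dilatedFamily [Fintype (Δ.extremePoints ℝ)]
    (fr : ∀ v : Δ.extremePoints ℝ, VertexFrame Δ u μ v) (ξ : Module.Dual ℝ (Fin n → ℝ)) {m : ℕ}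
    {f : (Fin n → ℝ) → E} (hf : ContDiff ℝ (m * n : ℕ) f) (hc : HasCompactSupport f) :
    DerivSystem {a | ∀ i, a i ≤ 2 * (m / 2)} Set.univ (dilatedFamily fr ξ m f) := by
  refine DerivSystem.sum _ fun v _ => ?_
  refine DerivSystem.pullback (fr v).facet_injective (r := fun _ => 2 * (m / 2)) ?_
  have := derivSystem_stdIntegral ((fr v).contDiff_comp ξ hf) ((fr v).hasCompactSupport_comp ξ hc)
    (fun α => ((edgeSign ξ α.1 : ℤ) : ℝ)) Finset.univ
  simpa only [Finset.mem_univ, if_true] using this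

lemma eventually_integral_dilated_eq_dilatedFamily (hΔ : IsPolytope Δ)
    (hu : IsFacetPresentation Δ u μ) [Fintype (Δ.extremePoints ℝ)]
    (fr : ∀ v : Δ.extremePoints ℝ, VertexFrame Δ u μ v)
    {ξ : Module.Dual ℝ (Fin n → ℝ)} (hξ : IsPolarizing Δ ξ) {m : ℕ} {f : (Fin n → ℝ) → E}
    (hf : ContDiff ℝ (m * n : ℕ) f) (hc : HasCompactSupport f) :
    ∃ U : Set (Fin d → ℝ), IsOpen U ∧ 0 ∈ U ∧
      Set.EqOn (fun h => ∫ x in dilated (fun i => intVec (u i)) μ h, f x)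
        (dilatedFamily fr ξ m f 0) U := by
  obtain ⟨U, hU, hUo, h0⟩ := eventually_nhds_iff.1
    (eventually_integral_dilated_eq hΔ hu fr hξ m hf.continuous hc)
  refine ⟨U, hUo, h0, fun h hh => ?_⟩
  beta_reduce
  rw [hU h hh, dilatedFamily]
  refine Finset.sum_congr rfl fun v _ => ?_
  congr 1
  rw [stdIntegral_eq_orthantFamily ((fr v).contDiff_comp ξ hf), pullbackFamily]
  have h1 : (MvPolynomial.monomial 0 1 : MvPolynomial (Fin d) ℝ) = 1 := rfl
  rw [h1, map_one, ev_one]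

/-- A facet that misses the vertex contributes the constant term of the series, which is 1. -/
lemma restrictVars_prod_truncL {ι κ : Type*} [Fintype ι] [Fintype κ] {e : ι → κ}
    (he : e.Injective) (k : ℕ) :
    restrictVars e (∏ i, truncL k (MvPolynomial.X i)) = ∏ j, truncL k (MvPolynomial.X j) := by
  rw [map_prod]
  refine (Fintype.prod_of_injective e he _ _ (fun i hi => ?_) fun j => ?_).symm
  · rw [map_truncL, restrictVars_X_of_notMem hi, truncL_zero]
  · rw [map_truncL, restrictVars_X he]

/-- Near `h = 0` the integral is a signed sum of orthant integrals, each depending only on the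
shifts of the facets through its vertex. The operators then act under the integral sign, with signs
absorbed by evenness. -/
theorem prodOpL_integral_dilated (hΔ : IsPolytope Δ) (hu : IsFacetPresentation Δ u μ)
    [Fintype (Δ.extremePoints ℝ)] (fr : ∀ v : Δ.extremePoints ℝ, VertexFrame Δ u μ v)
    {ξ : Module.Dual ℝ (Fin n → ℝ)} (hξ : IsPolarizing Δ ξ) {m : ℕ} {f : (Fin n → ℝ) → E}
    (hf : ContDiff ℝ (m * n : ℕ) f) (hc : HasCompactSupport f) :
    prodOpL (m / 2) (Finset.univ : Finset (Fin d))
        (fun h => ∫ x in dilated (fun i => intVec (u i)) μ h, f x) 0 =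
      ∑ v : Δ.extremePoints ℝ, (-1 : ℝ) ^ flipCount Δ ξ v • ∫ t in orthant 0,
        ev (multiD fun t => f (vertexChart Δ ξ v t))
          (∏ α, truncL (m / 2) (MvPolynomial.X α)) t := by
  obtain ⟨U, hU, h0, hfU⟩ := eventually_integral_dilated_eq_dilatedFamily hΔ hu fr hξ hf hc
  have hlow : IsLowerSet {a : Fin d →₀ ℕ | ∀ i, a i ≤ 2 * (m / 2)} :=
    fun a b hab ha i => (hab i).trans (ha i)
  rw [((derivSystem_dilatedFamily fr ξ hf hc).mono subset_rfl (Set.subset_univ U)).prodOpL_eqOn hU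
    hlow (k := m / 2) Finset.univ (p := 1) (Room.one fun i => by
      rw [Finsupp.finsetSum_apply]
      simp [Finsupp.single_apply]) (by rwa [ev_one]) h0, mul_one]
  unfold dilatedFamily
  rw [ev_sum]
  refine Finset.sum_congr rfl fun v _ => ?_
  rw [ev_pullbackFamily, restrictVars_prod_truncL (fr v).facet_injective,
    ev_orthantFamily_prod_truncL ((fr v).contDiff_comp ξ hf) ((fr v).hasCompactSupport_comp ξ hc)
      fun α => units_cast_eq _]
  simp only [Function.comp_apply, Pi.zero_apply, mul_zero, Finset.compl_univ, Finset.prod_empty,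
    one_smul, mixedPoly, mul_one]
  rfl

lemma remainder_eq_sum [Fintype (Δ.extremePoints ℝ)] (m : ℕ) (ξ : Module.Dual ℝ (Fin n → ℝ))
    (ε : (v : Fin n → ℝ) → edgeVectors Δ v → ℤˣ) (f : (Fin n → ℝ) → E) :
    remainder m Δ ξ ε f = ∑ v : Δ.extremePoints ℝ, (-1 : ℝ) ^ flipCount Δ ξ v •
      stdRemainder m (ε v) fun t => f (vertexChart Δ ξ v t) := by
  rw [remainder, ← finsum_set_coe_eq_finsum_mem, finsum_eq_sum_of_fintype]

/-- The Euler–Maclaurin formula with remainder. -/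
theorem weightedSum_eq_prodOpL_add_remainder [CompleteSpace E] (hΔ : IsRegularLatticePolytope Δ)
    (hu : IsFacetPresentation Δ u μ) {ξ : Module.Dual ℝ (Fin n → ℝ)} (hξ : IsPolarizing Δ ξ)
    (ε : (v : Fin n → ℝ) → edgeVectors Δ v → ℤˣ) {m : ℕ} (hm : 1 ≤ m) {f : (Fin n → ℝ) → E}
    (hf : ContDiff ℝ (m * n : ℕ) f) (hc : HasCompactSupport f) :
    weightedSum Δ f = prodOpL (m / 2) (Finset.univ : Finset (Fin d))
        (fun h => ∫ x in dilated (fun i => intVec (u i)) μ h, f x) 0 + remainder m Δ ξ ε f := by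
  have := hΔ.polytope.finite_extremePoints.fintype
  have fr : ∀ v : Δ.extremePoints ℝ, VertexFrame Δ u μ v :=
    fun v => Classical.choice (nonempty_vertexFrame hΔ hu v.2)
  rw [weightedSum_eq_sum hΔ hu fr hξ hc, prodOpL_integral_dilated hΔ.polytope hu fr hξ hf hc,
    remainder_eq_sum, ← Finset.sum_add_distrib]
  refine Finset.sum_congr rfl fun v _ => ?_
  rw [← smul_add]
  congr 1
  exact tsum_halfStep_eq hm ((fr v).contDiff_comp ξ hf) ((fr v).hasCompactSupport_comp ξ hc) (ε v)

lemma exists_isPolarizing (hΔ : IsRegularLatticePolytope Δ) :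
    ∃ ξ : Module.Dual ℝ (Fin n → ℝ), IsPolarizing Δ ξ := by
  have := hΔ.polytope.finite_extremePoints.to_subtype
  obtain ⟨ξ, hξ⟩ := Module.exists_dual_forall_apply_ne_zero (K := ℝ)
    (fun p : Σ v : Δ.extremePoints ℝ, edgeVectors Δ v.1 => intVec p.2.1) fun p h => by
      obtain ⟨b, hb, -, -⟩ := hΔ.exists_basis p.1.2
      have h0 : p.2.1 = 0 := by
        apply intVec_injective
        rw [h]
        ext; simp [intVec]
      rw [← hb p.2] at h0
      exact b.ne_zero _ h0
  exact ⟨ξ, fun v hv α hα => hξ ⟨⟨v, hv⟩, ⟨α, hα⟩⟩⟩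

theorem hasContinuousPartials_integral_dilated (hΔ : IsRegularLatticePolytope Δ)
    (hu : IsFacetPresentation Δ u μ) {m : ℕ} {f : (Fin n → ℝ) → E}
    (hf : ContDiff ℝ (m * n : ℕ) f) (hc : HasCompactSupport f) :
    HasContinuousPartials (fun _ : Fin d => 2 * (m / 2))
      (fun h => ∫ x in dilated (fun i => intVec (u i)) μ h, f x) := by
  have := hΔ.polytope.finite_extremePoints.fintype
  have fr : ∀ v : Δ.extremePoints ℝ, VertexFrame Δ u μ v :=
    fun v => Classical.choice (nonempty_vertexFrame hΔ hu v.2)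
  obtain ⟨ξ, hξ⟩ := exists_isPolarizing hΔ
  obtain ⟨U, hU, h0, hfU⟩ :=
    eventually_integral_dilated_eq_dilatedFamily hΔ.polytope hu fr hξ hf hc
  exact ((derivSystem_dilatedFamily fr ξ hf hc).mono subset_rfl
    (Set.subset_univ U)).hasContinuousPartials hU h0 hfU

end Formula


/-! ### Partial derivatives of a composition with an affine map -/

section AffineSubstitution

variable {ι κ E : Type*} [Fintype ι] [DecidableEq ι] [Fintype κ] [DecidableEq κ]
  [NormedAddCommGroup E] [NormedSpace ℝ E]

/-- The substitution `X_i ↦ ∑ j, w i j X_j`. -/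
def linSubst (w : ι → κ → ℝ) : MvPolynomial ι ℝ →ₐ[ℝ] MvPolynomial κ ℝ :=
  MvPolynomial.aeval fun i => ∑ j, w i j • MvPolynomial.X j

omit [Fintype ι] [DecidableEq ι] [DecidableEq κ] in
-- A linear substitution maps homogeneous polynomials to homogeneous ones of the same degree, so
-- orders of differentiation are unchanged by a chart.
lemma exists_degree_eq_of_mem_support_linSubst {w : ι → κ → ℝ} {p : MvPolynomial ι ℝ}
    {a : κ →₀ ℕ} (ha : a ∈ (linSubst w p).support) : ∃ b ∈ p.support, b.degree = a.degree := by
  classical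
  rw [← p.support_sum_monomial_coeff, map_sum] at ha
  obtain ⟨b, hb, hab⟩ := Finset.mem_biUnion.1 (MvPolynomial.support_sum ha)
  refine ⟨b, hb, ?_⟩
  have h1 : (MvPolynomial.monomial b (p.coeff b)).IsHomogeneous b.degree :=
    MvPolynomial.isHomogeneous_monomial _ rfl
  have h2 := h1.aeval (fun i => ∑ j, w i j • (MvPolynomial.X j : MvPolynomial κ ℝ)) (n := 1)
    fun i => MvPolynomial.IsHomogeneous.sum _ _ _ fun j _ => by
      rw [MvPolynomial.smul_eq_C_mul]
      exact (MvPolynomial.isHomogeneous_X ℝ j).C_mul _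
  rw [one_mul] at h2
  by_contra hne
  exact MvPolynomial.mem_support_iff.1 hab (h2.coeff_eq_zero (Ne.symm hne))

lemma contDiff_ev_multiD {N : ℕ} {f : (κ → ℝ) → E} {q : MvPolynomial κ ℝ} (c : ℕ)
    (hf : ContDiff ℝ N f) (hq : ∀ a ∈ q.support, c + a.degree ≤ N) :
    ContDiff ℝ c (ev (multiD f) q) := by
  rw [ev_eq_sum]
  have : (∑ a ∈ q.support, q.coeff a • multiD f a) =
      fun x => ∑ a ∈ q.support, q.coeff a • multiD f a x := by
    ext x
    simp
  rw [this]
  exact ContDiff.sum fun a ha => contDiff_const.smul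
    (contDiff_multiD (hf.of_le (by exact_mod_cast hq a ha)))

/-- The chain rule along a line: the coordinate direction `i` upstairs is the direction `w i`
downstairs. -/
lemma partialDeriv_ev_comp_affine {N : ℕ} {f : (κ → ℝ) → E} (hf : ContDiff ℝ N f)
    {q : MvPolynomial κ ℝ} (hq : ∀ a ∈ q.support, 1 + a.degree ≤ N) (v : κ → ℝ)
    (w : ι → κ → ℝ) (i : ι) :
    partialDeriv i (fun t => ev (multiD f) q (v + ∑ i, t i • w i)) =
      fun t => ev (multiD f) ((∑ j, w i j • MvPolynomial.X j) * q) (v + ∑ i, t i • w i) := by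
  ext t
  set x := v + ∑ i, t i • w i with hx
  have hG : ContDiff ℝ 1 (ev (multiD f) q) := contDiff_ev_multiD 1 hf hq
  have hupd : ∀ s, v + ∑ k, Function.update t i s k • w k = x + (s - t i) • w i := by
    intro s
    have h1 : ∀ k, Function.update t i s k • w k = t k • w k + if k = i then (s - t i) • w i else 0 := by
      intro k
      rcases eq_or_ne k i with rfl | hk
      · rw [Function.update_self, if_pos rfl, ← add_smul, add_sub_cancel]
      · rw [Function.update_of_ne hk, if_neg hk, add_zero]
    simp only [h1, Finset.sum_add_distrib, Finset.sum_ite_eq', Finset.mem_univ, if_true, hx,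
      add_assoc]
  have hline : HasDerivAt (fun s : ℝ => x + (s - t i) • w i) (w i) (t i) := by
    simpa using (((hasDerivAt_id (t i)).sub_const (t i)).smul_const (w i)).const_add x
  have hx0 : x + (t i - t i) • w i = x := by simp
  have hder : HasDerivAt (fun s => ev (multiD f) q (x + (s - t i) • w i))
      (fderiv ℝ (ev (multiD f) q) x (w i)) (t i) := by
    have h1 := (hG.differentiable one_ne_zero x).hasFDerivAt
    rw [← hx0] at h1
    have h2 := h1.comp_hasDerivAt (t i) hline
    rwa [hx0] at h2
  rw [partialDeriv]
  simp only [hupd]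
  rw [hder.deriv]
  have hpart : ∀ j, fderiv ℝ (ev (multiD f) q) x (Pi.single j 1) =
      ev (multiD f) (MvPolynomial.X j * q) x := by
    intro j
    rw [← congrFun (partialDeriv_eq_fderiv hG j) x]
    refine (derivSystem_multiD hf).partialDeriv_eqOn isOpen_univ (p := q) (fun a ha => ?_)
      (fun _ _ => rfl) (Set.mem_univ x)
    have := hq a ha
    simp only [Set.mem_ofPred_eq, map_add, Finsupp.degree_single]
    omega
  conv_lhs => rw [pi_eq_sum_univ' (w i)]
  simp only [map_sum, map_smul, hpart, Finset.sum_mul, Finset.sum_apply, Pi.smul_apply, smul_mul_assoc]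

omit [Fintype ι] [DecidableEq ι] in
lemma list_prod_X_eq_monomial (l : List ι) :
    (l.map fun i => (MvPolynomial.X i : MvPolynomial ι ℝ)).prod =
      MvPolynomial.monomial (l.map fun i => Finsupp.single i 1).sum 1 := by
  induction l with
  | nil => rfl
  | cons i l ih =>
    rw [List.map_cons, List.prod_cons, ih, List.map_cons, List.sum_cons, MvPolynomial.X,
      MvPolynomial.monomial_mul, one_mul]

lemma foldr_partialDeriv_comp_affine {N : ℕ} {f : (κ → ℝ) → E} (hf : ContDiff ℝ N f)
    (v : κ → ℝ) (w : ι → κ → ℝ) (l : List ι) (hl : l.length ≤ N) :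
    l.foldr partialDeriv (fun t => f (v + ∑ i, t i • w i)) = fun t =>
      ev (multiD f) (linSubst w (l.map fun i => MvPolynomial.X i).prod) (v + ∑ i, t i • w i) := by
  induction l with
  | nil => simp [ev_one, multiD_zero]
  | cons i l ih =>
    rw [List.length_cons] at hl
    rw [List.foldr_cons, ih (by omega), partialDeriv_ev_comp_affine hf]
    · rw [List.map_cons, List.prod_cons, map_mul (linSubst w)]
      simp only [linSubst, MvPolynomial.aeval_X]
    · intro a ha
      obtain ⟨b, hb, hdeg⟩ := exists_degree_eq_of_mem_support_linSubst ha
      rw [list_prod_X_eq_monomial] at hb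
      have hb' := Finset.mem_singleton.1 (MvPolynomial.support_monomial_subset hb)
      have hlen : ∀ l : List ι, (l.map fun i => Finsupp.single i 1).sum.degree = l.length := by
        intro l
        induction l with
        | nil => simp
        | cons i l ih => simp [ih, add_comm]
      rw [← hdeg, hb', hlen]
      omega

lemma multiD_comp_affine {N : ℕ} {f : (κ → ℝ) → E} (hf : ContDiff ℝ N f)
    (v : κ → ℝ) (w : ι → κ → ℝ) {a : ι →₀ ℕ} (ha : a.degree ≤ N) :
    multiD (fun t => f (v + ∑ i, t i • w i)) a = fun t =>
      ev (multiD f) (linSubst w (MvPolynomial.monomial a 1)) (v + ∑ i, t i • w i) := by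
  rw [multiD, foldr_partialDeriv_comp_affine hf v w _ (by rwa [length_toList_toMultiset]),
    list_prod_X_eq_monomial]
  have : ((Finsupp.toMultiset a).toList.map fun i => Finsupp.single i 1).sum = a := by
    ext i
    rw [list_sum_single_apply, ← Multiset.coe_count, Multiset.coe_toList, Finsupp.count_toMultiset]
  rw [this]

/-- The chain rule for differential operators with constant coefficients and affine maps. -/
lemma ev_multiD_comp_affine {N : ℕ} {f : (κ → ℝ) → E} (hf : ContDiff ℝ N f)
    (v : κ → ℝ) (w : ι → κ → ℝ) {p : MvPolynomial ι ℝ} (hp : ∀ a ∈ p.support, a.degree ≤ N)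
    (t : ι → ℝ) :
    ev (multiD fun t => f (v + ∑ i, t i • w i)) p t =
      ev (multiD f) (linSubst w p) (v + ∑ i, t i • w i) := by
  conv_rhs => rw [← p.support_sum_monomial_coeff]
  rw [ev_eq_sum, map_sum, map_sum, Finset.sum_apply, Finset.sum_apply]
  refine Finset.sum_congr rfl fun a ha => ?_
  have h1 : MvPolynomial.monomial a (p.coeff a) = p.coeff a • MvPolynomial.monomial a 1 := by
    rw [MvPolynomial.smul_monomial, smul_eq_mul, mul_one]
  rw [h1, map_smul, map_smul, Pi.smul_apply, Pi.smul_apply,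
    multiD_comp_affine hf v w (hp a ha)]

lemma mixedPartial_univ_eq_multiD {N : ℕ} {f : (κ → ℝ) → E} (hf : ContDiff ℝ N f)
    {a : κ →₀ ℕ} (ha : a.degree ≤ N) : mixedPartial Finset.univ a f = multiD f a := by
  have h := (derivSystem_multiD hf).mixedPartial_eqOn isOpen_univ (isLowerSet_degree_le N)
    Finset.univ a (p := 1) (Room.one (by rwa [Finsupp.univ_sum_single])) (f := f)
    (by rw [ev_one, multiD_zero]; exact fun _ _ => rfl)
  have h1 : ∏ i, (MvPolynomial.X i : MvPolynomial κ ℝ) ^ a i = MvPolynomial.monomial a 1 := by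
    rw [MvPolynomial.monomial_eq, map_one, one_mul, Finsupp.prod_fintype _ _ fun _ => pow_zero _]
  rw [mul_one, h1, ev_monomial] at h
  exact funext fun x => h (Set.mem_univ x)

omit [DecidableEq κ] in
lemma ev_multiD_eq_sum_multiIndices {n p N : ℕ} {f : (Fin n → ℝ) → E} (hf : ContDiff ℝ N f)
    {q : MvPolynomial (Fin n) ℝ} (hq : ∀ a ∈ q.support, p ≤ a.degree ∧ a.degree ≤ N)
    (x : Fin n → ℝ) : ev (multiD f) q x = ∑ a ∈ multiIndices n p N,
      q.coeff (Finsupp.equivFunOnFinite.symm a) • mixedPartial Finset.univ a f x := by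
  rw [ev_eq_sum, Finset.sum_apply]
  refine Finset.sum_of_injOn (fun a => ⇑a) DFunLike.coe_injective.injOn ?_ ?_ ?_
  · intro a ha
    obtain ⟨h1, h2⟩ := hq a ha
    rw [Finsupp.degree_eq_sum] at h1 h2
    simp only [multiIndices, Finset.coe_filter, Set.mem_ofPred_eq, Fintype.mem_piFinset,
      Finset.mem_range]
    refine ⟨fun i => Nat.lt_succ_of_le ?_, h1, h2⟩
    exact (Finset.single_le_sum (f := fun i => a i) (fun _ _ => Nat.zero_le _)
      (Finset.mem_univ i)).trans h2
  · intro a _ ha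
    have : q.coeff (Finsupp.equivFunOnFinite.symm a) = 0 := by
      by_contra h
      exact ha ⟨_, MvPolynomial.mem_support_iff.2 h, rfl⟩
    rw [this, zero_smul]
  · intro a ha
    rw [Pi.smul_apply, mixedPartial_univ_eq_multiD hf (hq a ha).2]
    congr 2
    exact (Finsupp.equivFunOnFinite.symm_apply_apply a).symm

/-- As `I` is proper, at least one factor `X_i ^ m` is present, whence the lower bound. For the
upper bound each coordinate contributes at most `m`. -/
lemma degree_of_mem_support_mixedPoly {m : ℕ} {I : Finset ι} (hI : I ≠ Finset.univ)
    {a : ι →₀ ℕ} (ha : a ∈ (mixedPoly ι m (m / 2) I Iᶜ).support) :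
    m ≤ a.degree ∧ a.degree ≤ m * Fintype.card ι := by
  constructor
  · have h1 := MvPolynomial.mem_support_iff.1 ha
    rw [mixedPoly, prod_X_pow_eq_monomial, MvPolynomial.coeff_mul_monomial'] at h1
    have h2 : ∑ i ∈ Iᶜ, Finsupp.single i m ≤ a := by
      by_contra h
      exact h1 (if_neg h)
    have h3 := Finsupp.degree_mono h2
    rw [sum_single_degree] at h3
    have h4 : 0 < Iᶜ.card := by
      rw [Finset.card_pos, ← Finset.compl_ne_univ_iff_nonempty, compl_compl]
      exact hI
    exact (Nat.le_mul_of_pos_right m h4).trans h3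
  · have h1 := mixedPoly_room (ι := ι) (m := m) (k := m / 2) (N := m * Fintype.card ι) (I := I)
      (J := Iᶜ) (b := 0) (by have := card_compl_add_card I m; simp; omega) a ha
    simpa using h1

end AffineSubstitution


/-! ### The remainder as a sum of integrals over orthants -/

section Remainder

variable {n d : ℕ} {Δ : Set (Fin n → ℝ)} {u : Fin d → Fin n → ℤ} {μ : Fin d → ℝ}
  {v : Fin n → ℝ} {E : Type*} [NormedAddCommGroup E] [NormedSpace ℝ E]

namespace VertexFrame

/-- The bounded periodic function by which `∂^a f` is multiplied in the remainder at a vertex. -/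
def remainderWeight (fr : VertexFrame Δ u μ v) (ξ : Module.Dual ℝ (Fin n → ℝ)) (m : ℕ)
    (a : Fin n → ℕ) (x : Fin n → ℝ) : ℝ :=
  ∑ I ∈ (Finset.univ : Finset (edgeVectors Δ v)).ssubsets,
    ((-1) ^ flipCount Δ ξ v * ((-1) ^ ((m - 1) * (Fintype.card (edgeVectors Δ v) - I.card)) *
      (linSubst (fun α : edgeVectors Δ v => polarized ξ α.1)
        (mixedPoly (edgeVectors Δ v) m (m / 2) I Iᶜ)).coeff (Finsupp.equivFunOnFinite.symm a))) *
      ∏ i ∈ Iᶜ, periodicB m (fr.coord ξ x i)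

variable (fr : VertexFrame Δ u μ v) (ξ : Module.Dual ℝ (Fin n → ℝ)) (m : ℕ)

lemma measurable_remainderWeight (a : Fin n → ℕ) : Measurable (fr.remainderWeight ξ m a) :=
  Finset.measurable_sum _ fun I _ => measurable_const.mul
    ((measurable_prod_periodicB m Iᶜ).comp (fr.chartHomeomorph ξ).symm.continuous.measurable)

lemma exists_abs_remainderWeight_le (a : Fin n → ℕ) :
    ∃ C : ℝ, ∀ x, |fr.remainderWeight ξ m a x| ≤ C := by
  choose C hC using fun I : Finset (edgeVectors Δ v) => exists_abs_prod_periodicB_le m Iᶜ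
  refine ⟨∑ I ∈ (Finset.univ : Finset (edgeVectors Δ v)).ssubsets,
    |(-1) ^ flipCount Δ ξ v * ((-1) ^ ((m - 1) * (Fintype.card (edgeVectors Δ v) - I.card)) *
      (linSubst (fun α : edgeVectors Δ v => polarized ξ α.1)
        (mixedPoly (edgeVectors Δ v) m (m / 2) I Iᶜ)).coeff (Finsupp.equivFunOnFinite.symm a))| *
      C I, fun x => (Finset.abs_sum_le_sum_abs _ _).trans (Finset.sum_le_sum fun I _ => ?_)⟩
  rw [abs_mul]
  exact mul_le_mul_of_nonneg_left (hC I _) (abs_nonneg _)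

lemma coord_add_intVec (x : Fin n → ℝ) (z : Fin n → ℤ) (α : edgeVectors Δ v) :
    fr.coord ξ (x + intVec z) α = fr.coord ξ x α +
      (((edgeSign ξ α.1 : ℤ) * ∑ k, u (fr.facet α) k * z k : ℤ) : ℝ) := by
  rw [coord, slack_add, mul_add, pairing_intVec, coord]
  push_cast
  rfl

/-- Lattice translations change the chart coordinates by integers, to which the periodic factors are
insensitive. -/
lemma remainderWeight_add_intVec (a : Fin n → ℕ) (x : Fin n → ℝ) (z : Fin n → ℤ) :
    fr.remainderWeight ξ m a (x + intVec z) = fr.remainderWeight ξ m a x := by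
  simp only [remainderWeight, coord_add_intVec, periodicB_add_int]

include fr in
lemma measurableSet_polarizedCone : MeasurableSet (polarizedCone Δ ξ v) :=
  (fr.measurableEmbedding_vertexChart ξ).measurableSet_image.2 (measurableSet_orthant 0)

end VertexFrame

lemma degree_le_of_mem_multiIndices {p N : ℕ} {a : Fin n → ℕ} (ha : a ∈ multiIndices n p N) :
    (Finsupp.equivFunOnFinite.symm a).degree ≤ N := by
  rw [Finsupp.degree_eq_sum]
  exact (Finset.mem_filter.1 ha).2.2

lemma mixedPartial_eq_multiD_of_mem_multiIndices {p N : ℕ} {f : (Fin n → ℝ) → E}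
    (hf : ContDiff ℝ N f) {a : Fin n → ℕ} (ha : a ∈ multiIndices n p N) :
    mixedPartial Finset.univ a f = multiD f (Finsupp.equivFunOnFinite.symm a) :=
  mixedPartial_univ_eq_multiD hf (degree_le_of_mem_multiIndices ha)

/-- The contribution of a vertex to the remainder is a sum of integrals over the polarized cone. -/
theorem VertexFrame.stdRemainder_eq_sum (fr : VertexFrame Δ u μ v)
    (ξ : Module.Dual ℝ (Fin n → ℝ)) {m : ℕ} (ε : edgeVectors Δ v → ℤˣ) {f : (Fin n → ℝ) → E}
    (hf : ContDiff ℝ (m * n : ℕ) f) (hc : HasCompactSupport f) :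
    (-1 : ℝ) ^ flipCount Δ ξ v • stdRemainder m ε (fun t => f (vertexChart Δ ξ v t)) =
      ∑ a ∈ multiIndices n m (m * n), ∫ x in polarizedCone Δ ξ v,
        fr.remainderWeight ξ m a x • mixedPartial Finset.univ a f x := by
  have hg := fr.contDiff_comp ξ hf
  have hgc := fr.hasCompactSupport_comp ξ hc
  set q : Finset (edgeVectors Δ v) → MvPolynomial (Fin n) ℝ := fun I =>
    linSubst (fun α : edgeVectors Δ v => polarized ξ α.1)
      (mixedPoly (edgeVectors Δ v) m (m / 2) I Iᶜ) with hq
  set c : Finset (edgeVectors Δ v) → ℝ := fun I => (-1) ^ flipCount Δ ξ v *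
    (-1) ^ ((m - 1) * (Fintype.card (edgeVectors Δ v) - I.card)) with hcdef
  have hev : ∀ I ∈ (Finset.univ : Finset (edgeVectors Δ v)).ssubsets, ∀ t,
      ev (multiD fun t => f (vertexChart Δ ξ v t))
        (mixedPoly (edgeVectors Δ v) m (m / 2) I Iᶜ) t =
      ∑ a ∈ multiIndices n m (m * n), (q I).coeff (Finsupp.equivFunOnFinite.symm a) •
        mixedPartial Finset.univ a f (vertexChart Δ ξ v t) := by
    intro I hI t
    have hI' : I ≠ Finset.univ := (Finset.mem_ssubsets.1 hI).ne
    rw [← ev_multiD_eq_sum_multiIndices hf]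
    · refine ev_multiD_comp_affine hf v _ (fun a ha => ?_) t
      have := (degree_of_mem_support_mixedPoly hI' ha).2
      rwa [fr.card_eq] at this
    · intro a ha
      obtain ⟨b, hb, hdeg⟩ := exists_degree_eq_of_mem_support_linSubst ha
      have := degree_of_mem_support_mixedPoly hI' hb
      rwa [fr.card_eq, hdeg] at this
  have hint1 : ∀ I ∈ (Finset.univ : Finset (edgeVectors Δ v)).ssubsets,
      Integrable (fun t => c I • (∏ i ∈ Iᶜ, periodicB m (t i)) •
        ev (multiD fun t => f (vertexChart Δ ξ v t))
          (mixedPoly (edgeVectors Δ v) m (m / 2) I Iᶜ) t) (volume.restrict (orthant 0)) := by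
    intro I hI
    refine (integrable_smul_ev_multiD hg hgc (measurable_prod_periodicB m _)
      (exists_abs_prod_periodicB_le m _) fun a ha => ?_).smul (c I)
    rw [add_zero]
    exact (degree_of_mem_support_mixedPoly (Finset.mem_ssubsets.1 hI).ne ha).2
  have hint2 : ∀ a ∈ multiIndices n m (m * n), Integrable (fun t =>
      fr.remainderWeight ξ m a (vertexChart Δ ξ v t) •
        mixedPartial Finset.univ a f (vertexChart Δ ξ v t)) (volume.restrict (orthant 0)) := by
    intro a ha
    have hchart : Continuous (vertexChart Δ ξ v) := (fr.chartHomeomorph ξ).continuous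
    obtain ⟨C, hC⟩ := fr.exists_abs_remainderWeight_le ξ m a
    rw [mixedPartial_eq_multiD_of_mem_multiIndices hf ha]
    refine integrable_bdd_smul ((fr.measurable_remainderWeight ξ m a).comp hchart.measurable)
      ⟨C, fun t => hC _⟩ (Continuous.comp ?_ hchart) ?_
    · exact continuousOn_univ.1
        ((derivSystem_multiD hf).cont _ (degree_le_of_mem_multiIndices ha))
    · exact (hc.mono' ((subset_tsupport _).trans (tsupport_multiD_subset f _))).comp_homeomorph
        (fr.chartHomeomorph ξ)
  have hterm : ∀ I ∈ (Finset.univ : Finset (edgeVectors Δ v)).ssubsets,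
      (-1 : ℝ) ^ flipCount Δ ξ v •
        (-1 : ℝ) ^ ((m - 1) * (Fintype.card (edgeVectors Δ v) - I.card)) •
          prodOpL (m / 2) I (stdIntegral m ε I fun t => f (vertexChart Δ ξ v t)) 0 =
      ∫ t in orthant 0, c I • (∏ i ∈ Iᶜ, periodicB m (t i)) •
        ev (multiD fun t => f (vertexChart Δ ξ v t))
          (mixedPoly (edgeVectors Δ v) m (m / 2) I Iᶜ) t := by
    intro I _
    rw [prodOpL_stdIntegral hg hgc, smul_smul, integral_smul]
  rw [stdRemainder, Finset.smul_sum, Finset.sum_congr rfl hterm, ← integral_finsetSum _ hint1]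
  simp only [fr.setIntegral_polarizedCone ξ]
  rw [← integral_finsetSum _ hint2]
  refine integral_congr_ae (Filter.Eventually.of_forall fun t => ?_)
  simp only [VertexFrame.remainderWeight, fr.coord_vertexChart ξ t, Finset.sum_smul]
  rw [Finset.sum_comm]
  refine Finset.sum_congr rfl fun I hI => ?_
  rw [hev I hI, Finset.smul_sum, Finset.smul_sum]
  refine Finset.sum_congr rfl fun a _ => ?_
  simp only [smul_smul, hcdef, hq]
  congr 1
  ring

/-- The remainder vanishes if the support of the function is disjoint from the polytope. -/
theorem remainder_eq_zero [CompleteSpace E] (hΔ : IsRegularLatticePolytope Δ)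
    (hu : IsFacetPresentation Δ u μ) {ξ : Module.Dual ℝ (Fin n → ℝ)} (hξ : IsPolarizing Δ ξ)
    (ε : (v : Fin n → ℝ) → edgeVectors Δ v → ℤˣ) {m : ℕ} (hm : 1 ≤ m) {f : (Fin n → ℝ) → E}
    (hf : ContDiff ℝ (m * n : ℕ) f) (hc : HasCompactSupport f) (hsupp : tsupport f ⊆ Δᶜ) :
    remainder m Δ ξ ε f = 0 := by
  have hzero : ∀ x ∈ Δ, f x = 0 := fun x hx => by
    by_contra h
    exact hsupp (subset_tsupport f h) hx
  have h1 : weightedSum Δ f = 0 :=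
    finsum_mem_eq_zero_of_forall_eq_zero fun z hz => by rw [hzero _ hz, smul_zero]
  -- By compactness the support of `f` misses Δ(h) for all small `h`. The integral is thus zero on a
  -- neighbourhood of 0, not merely at 0, which is needed before differentiating in `h`.
  have h2 : ∀ᶠ h in nhds (0 : Fin d → ℝ), ∀ x ∈ tsupport f, ∃ i, slack u μ i x + h i < 0 := by
    refine hc.isCompact.eventually_forall_of_forall_eventually fun x hx => ?_
    have hx' : x ∉ Δ := hsupp hx
    rw [hu.mem_iff] at hx'
    push Not at hx'
    obtain ⟨i, hi⟩ := hx'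
    have hcont : Continuous fun z : (Fin d → ℝ) × (Fin n → ℝ) => slack u μ i z.2 + z.1 i :=
      ((continuous_slack u μ i).comp continuous_snd).add
        ((continuous_apply i).comp continuous_fst)
    have h3 : ∀ᶠ z in nhds ((0 : Fin d → ℝ), x), slack u μ i z.2 + z.1 i < 0 :=
      hcont.continuousAt.eventually_lt_const (by simpa using hi)
    exact h3.mono fun z hz => ⟨i, hz⟩
  obtain ⟨U, hU, hUo, h0⟩ := eventually_nhds_iff.1 h2
  have h4 : Set.EqOn (fun h => ∫ x in dilated (fun i => intVec (u i)) μ h, f x)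
      (ev (fun (_ : Fin d →₀ ℕ) _ => (0 : E)) 1) U := by
    intro h hh
    rw [ev_one]
    refine setIntegral_eq_zero_of_forall_eq_zero fun x hx => ?_
    by_contra hne
    obtain ⟨i, hi⟩ := hU h hh x (subset_tsupport f hne)
    exact hi.not_ge (mem_dilated.1 hx i)
  have h5 : DerivSystem Set.univ U (fun (_ : Fin d →₀ ℕ) _ => (0 : E)) :=
    ⟨fun _ _ => continuousOn_const, fun _ _ _ _ _ => hasDerivAt_const _ _⟩
  have h6 := h5.prodOpL_eqOn hUo isLowerSet_univ (k := m / 2) Finset.univ (p := 1)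
    (fun _ _ => Set.mem_univ _) h4 h0
  have h7 : ∀ p : MvPolynomial (Fin d) ℝ, ev (fun (_ : Fin d →₀ ℕ) _ => (0 : E)) p 0 = 0 := by
    intro p
    rw [ev_eq_sum, Finset.sum_apply]
    exact Finset.sum_eq_zero fun a _ => by simp
  have h8 := weightedSum_eq_prodOpL_add_remainder hΔ hu hξ ε hm hf hc
  rw [h1, h6, h7, zero_add] at h8
  exact h8.symm

end Remainder

/-! ### The remainder as a distribution -/

section Distribution

open TestFunction in
-- Each coordinate derivative is continuous on test functions and costs one order of
-- differentiability; the empty word is the inclusion into a space of lower order.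
lemma exists_iterated_partialDeriv_clm {𝕜 : Type*} [RCLike 𝕜] {n N : ℕ} (l : List (Fin n)) :
    ∀ k : ℕ, k + l.length ≤ N →
      ∃ D : TestFunction (⊤ : TopologicalSpace.Opens (Fin n → ℝ)) 𝕜 (N : ℕ∞) →L[𝕜]
        TestFunction (⊤ : TopologicalSpace.Opens (Fin n → ℝ)) 𝕜 (k : ℕ∞),
        ∀ f, ⇑(D f) = l.foldr partialDeriv ⇑f := by
  induction l with
  | nil =>
    intro k hk
    refine ⟨monoCLM 𝕜, fun f => ?_⟩
    rw [monoCLM_apply, if_pos ⟨by simpa using hk, le_rfl⟩]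
    rfl
  | cons i l ih =>
    intro k hk
    rw [List.length_cons] at hk
    obtain ⟨D, hD⟩ := ih (k + 1) (by omega)
    refine ⟨lineDerivCLM 𝕜 (Pi.single i 1) ∘L D, fun f => ?_⟩
    have h1 : ContDiff ℝ 1 (D f) := (D f).contDiff.of_le (by norm_cast; omega)
    ext x
    rw [ContinuousLinearMap.comp_apply, lineDerivCLM_apply_of_le (by norm_cast), List.foldr_cons,
      ← hD, partialDeriv_eq_fderiv h1,
      (h1.differentiable one_ne_zero x).lineDeriv_eq_fderiv]

/-- Integration of a bounded function on a measurable set against a partial derivative is a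
distribution. -/
lemma exists_integral_clm {𝕜 : Type*} [RCLike 𝕜] {n p N : ℕ} {C : Set (Fin n → ℝ)}
    (hC : MeasurableSet C) {w : (Fin n → ℝ) → ℝ} (hw : Measurable w)
    (hb : ∃ M : ℝ, ∀ x, |w x| ≤ M) {a : Fin n → ℕ} (ha : a ∈ multiIndices n p N) :
    ∃ T : TestFunction (⊤ : TopologicalSpace.Opens (Fin n → ℝ)) 𝕜 (N : ℕ∞) →L[𝕜] 𝕜,
      ∀ f, T f = ∫ x in C, w x • mixedPartial Finset.univ a f x := by
  classical
  obtain ⟨M, hM⟩ := hb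
  have hdeg := degree_le_of_mem_multiIndices ha
  obtain ⟨D, hD⟩ := exists_iterated_partialDeriv_clm (𝕜 := 𝕜) (N := N)
    (Finsupp.toMultiset (Finsupp.equivFunOnFinite.symm a)).toList 0
    (by rwa [length_toList_toMultiset, zero_add])
  -- The domain of integration is absorbed into the weight. The resulting function is bounded and
  -- measurable, hence locally integrable, and defines a distribution of order zero.
  set φ : (Fin n → ℝ) → 𝕜 := C.indicator fun x => ((w x : ℝ) : 𝕜) with hφ
  have hloc : LocallyIntegrable φ := by
    refine (locallyIntegrable_const M).mono ?_ (Filter.Eventually.of_forall fun x => ?_)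
    · exact ((RCLike.measurable_ofReal.comp hw).indicator hC).aestronglyMeasurable
    · refine (norm_indicator_le_norm_self _ x).trans ?_
      rw [RCLike.norm_ofReal, Real.norm_eq_abs]
      exact (hM x).trans (le_abs_self M)
  refine ⟨TestFunction.integralAgainstBilinCLM (ContinuousLinearMap.mul 𝕜 𝕜) volume φ ∘L D,
    fun f => ?_⟩
  rw [ContinuousLinearMap.comp_apply, TestFunction.integralAgainstBilinCLM_apply,
    if_pos (hloc.locallyIntegrableOn _), ← integral_indicator hC]
  have hf : ContDiff ℝ N f := f.contDiff
  refine integral_congr_ae (Filter.Eventually.of_forall fun x => ?_)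
  have h1 : D f x = mixedPartial Finset.univ a f x := by
    rw [mixedPartial_eq_multiD_of_mem_multiIndices hf ha, hD, multiD]
  simp only [ContinuousLinearMap.mul_apply', h1, hφ, Set.indicator_apply]
  split_ifs
  · rw [RCLike.real_smul_eq_coe_mul, mul_comm]
  · rw [mul_zero]

end Distribution

end EulerMaclaurin

end


/-! ### Assembly of the theorem -/

theorem theorem4p1 {𝕜 : Type*} [RCLike 𝕜] {n m d : ℕ} (hm : 1 ≤ m) {Δ : Set (Fin n → ℝ)}
    (hΔ : EulerMaclaurin.IsRegularLatticePolytope Δ)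
    (u : Fin d → Fin n → ℤ) (μ : Fin d → ℝ) (hu : EulerMaclaurin.IsFacetPresentation Δ u μ) :
    -- the derivatives with respect to `h` in the formula exist
    (∀ f : (Fin n → ℝ) → 𝕜, ContDiff ℝ ((m * n : ℕ) : ℕ∞) f → HasCompactSupport f →
      EulerMaclaurin.HasContinuousPartials (fun _ : Fin d => 2 * (m / 2))
        (fun h => ∫ x in EulerMaclaurin.dilated (fun i => EulerMaclaurin.intVec (u i)) μ h, f x)) ∧
    ∀ (ξ : Module.Dual ℝ (Fin n → ℝ))
      (ε : (v : Fin n → ℝ) → EulerMaclaurin.edgeVectors Δ v → ℤˣ),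
      EulerMaclaurin.IsPolarizing Δ ξ →
      -- so do those in the definition of the remainder
      (∀ f : (Fin n → ℝ) → 𝕜, ContDiff ℝ ((m * n : ℕ) : ℕ∞) f → HasCompactSupport f →
        ∀ v ∈ Δ.extremePoints ℝ, ∀ I : Finset (EulerMaclaurin.edgeVectors Δ v), I ≠ Finset.univ →
          EulerMaclaurin.HasContinuousPartials (fun i => if i ∈ I then 2 * (m / 2) else 0)
            (EulerMaclaurin.stdIntegral m (ε v) I
              fun t => f (EulerMaclaurin.vertexChart Δ ξ v t))) ∧
      -- the Euler–Maclaurin formula with remainder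
      (∀ f : (Fin n → ℝ) → 𝕜, ContDiff ℝ ((m * n : ℕ) : ℕ∞) f → HasCompactSupport f →
        EulerMaclaurin.weightedSum Δ f =
          EulerMaclaurin.prodOpL (m / 2) (Finset.univ : Finset (Fin d))
            (fun h => ∫ x in EulerMaclaurin.dilated (fun i => EulerMaclaurin.intVec (u i)) μ h, f x)
            0
          + EulerMaclaurin.remainder m Δ ξ ε f) ∧
      -- the remainder is a sum of integrals over orthants of bounded periodic functions times
      -- partial derivatives of order between `m` and `m * n`
      (∃ φ : (Fin n → ℝ) → (Fin n → ℕ) → (Fin n → ℝ) → ℝ,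
        (∀ v a, Measurable (φ v a) ∧ (∃ C : ℝ, ∀ x, |φ v a x| ≤ C) ∧
          ∀ (x : Fin n → ℝ) (z : Fin n → ℤ), φ v a (x + EulerMaclaurin.intVec z) = φ v a x) ∧
        ∀ f : (Fin n → ℝ) → 𝕜, ContDiff ℝ ((m * n : ℕ) : ℕ∞) f → HasCompactSupport f →
          EulerMaclaurin.remainder m Δ ξ ε f =
            ∑ᶠ v ∈ Δ.extremePoints ℝ, ∑ a ∈ EulerMaclaurin.multiIndices n m (m * n),
              ∫ x in EulerMaclaurin.polarizedCone Δ ξ v,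
                φ v a x • EulerMaclaurin.mixedPartial Finset.univ a f x) ∧
      -- the remainder does not depend on the polarization (nor on the choice of signs)
      (∀ (ξ' : Module.Dual ℝ (Fin n → ℝ))
        (ε' : (v : Fin n → ℝ) → EulerMaclaurin.edgeVectors Δ v → ℤˣ),
        EulerMaclaurin.IsPolarizing Δ ξ' →
        ∀ f : (Fin n → ℝ) → 𝕜, ContDiff ℝ ((m * n : ℕ) : ℕ∞) f → HasCompactSupport f →
          EulerMaclaurin.remainder m Δ ξ ε f = EulerMaclaurin.remainder m Δ ξ' ε' f) ∧
      -- the remainder is a distribution (of order at most `m * n`) supported on `Δ`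
      (∃ T : TestFunction (⊤ : TopologicalSpace.Opens (Fin n → ℝ)) 𝕜 ((m * n : ℕ) : ℕ∞) →L[𝕜] 𝕜,
        (∀ f, T f = EulerMaclaurin.remainder m Δ ξ ε f) ∧
        Distribution.IsVanishingOn T Δᶜ ∧ Distribution.dsupport T ⊆ Δ) := by
  classical
  have := hΔ.polytope.finite_extremePoints.fintype
  have fr : ∀ v : Δ.extremePoints ℝ, EulerMaclaurin.VertexFrame Δ u μ v :=
    fun v => Classical.choice (EulerMaclaurin.nonempty_vertexFrame hΔ hu v.2)
  have hcast : ∀ {f : (Fin n → ℝ) → 𝕜}, ContDiff ℝ ((m * n : ℕ) : ℕ∞) f →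
      ContDiff ℝ (m * n : ℕ) f := fun hf => hf
  refine ⟨fun f hf hc => EulerMaclaurin.hasContinuousPartials_integral_dilated hΔ hu (hcast hf) hc,
    fun ξ ε hξ => ?_⟩
  have hrep : ∀ f : (Fin n → ℝ) → 𝕜, ContDiff ℝ (m * n : ℕ) f → HasCompactSupport f →
      EulerMaclaurin.remainder m Δ ξ ε f = ∑ v : Δ.extremePoints ℝ,
        ∑ a ∈ EulerMaclaurin.multiIndices n m (m * n),
          ∫ x in EulerMaclaurin.polarizedCone Δ ξ v, (fr v).remainderWeight ξ m a x •
            EulerMaclaurin.mixedPartial Finset.univ a f x := fun f hf hc => by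
    rw [EulerMaclaurin.remainder_eq_sum]
    exact Finset.sum_congr rfl fun v _ => (fr v).stdRemainder_eq_sum ξ (ε v) hf hc
  refine ⟨fun f hf hc v hv I _ => ?_, fun f hf hc => ?_, ?_, fun ξ' ε' hξ' f hf hc => ?_, ?_⟩
  · exact EulerMaclaurin.hasContinuousPartials_stdIntegral
      ((fr ⟨v, hv⟩).contDiff_comp ξ (hcast hf)) ((fr ⟨v, hv⟩).hasCompactSupport_comp ξ hc) (ε v) I
  · exact EulerMaclaurin.weightedSum_eq_prodOpL_add_remainder hΔ hu hξ ε hm (hcast hf) hc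
  · refine ⟨fun v a => if h : v ∈ Δ.extremePoints ℝ then (fr ⟨v, h⟩).remainderWeight ξ m a else 0,
      fun v a => ?_, fun f hf hc => ?_⟩
    · beta_reduce
      split_ifs with h
      · exact ⟨(fr ⟨v, h⟩).measurable_remainderWeight ξ m a,
          (fr ⟨v, h⟩).exists_abs_remainderWeight_le ξ m a,
          (fr ⟨v, h⟩).remainderWeight_add_intVec ξ m a⟩
      · exact ⟨measurable_zero, ⟨0, fun x => by simp⟩, fun _ _ => rfl⟩
    · rw [hrep f (hcast hf) hc, ← finsum_set_coe_eq_finsum_mem, finsum_eq_sum_of_fintype]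
      refine Finset.sum_congr rfl fun v _ => Finset.sum_congr rfl fun a _ => ?_
      simp only [v.2, dif_pos]
  -- The lattice sum and the main term involve neither the polarization nor the signs, so comparing
  -- two instances of the formula identifies the remainders.
  · have h1 := EulerMaclaurin.weightedSum_eq_prodOpL_add_remainder hΔ hu hξ ε hm (hcast hf) hc
    have h2 := EulerMaclaurin.weightedSum_eq_prodOpL_add_remainder hΔ hu hξ' ε' hm (hcast hf) hc
    exact add_left_cancel (h1.symm.trans h2)
  · have hT : ∀ (v : Δ.extremePoints ℝ) (a : Fin n → ℕ), ∃ T : TestFunction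
        (⊤ : TopologicalSpace.Opens (Fin n → ℝ)) 𝕜 ((m * n : ℕ) : ℕ∞) →L[𝕜] 𝕜,
        a ∈ EulerMaclaurin.multiIndices n m (m * n) → ∀ f, T f =
          ∫ x in EulerMaclaurin.polarizedCone Δ ξ v, (fr v).remainderWeight ξ m a x •
            EulerMaclaurin.mixedPartial Finset.univ a f x := fun v a => by
      by_cases ha : a ∈ EulerMaclaurin.multiIndices n m (m * n)
      · obtain ⟨T, hT⟩ := EulerMaclaurin.exists_integral_clm (𝕜 := 𝕜)
          ((fr v).measurableSet_polarizedCone ξ) ((fr v).measurable_remainderWeight ξ m a)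
          ((fr v).exists_abs_remainderWeight_le ξ m a) ha
        exact ⟨T, fun _ => hT⟩
      · exact ⟨0, fun h => absurd h ha⟩
    choose T hT using hT
    set S := ∑ v : Δ.extremePoints ℝ, ∑ a ∈ EulerMaclaurin.multiIndices n m (m * n), T v a with hS
    have hSf : ∀ f, S f = EulerMaclaurin.remainder m Δ ξ ε f := fun f => by
      rw [hrep f f.contDiff f.hasCompactSupport, hS]
      simp only [sum_apply]
      exact Finset.sum_congr rfl fun v _ => Finset.sum_congr rfl fun a ha => hT v a ha f
    have hvan : Distribution.IsVanishingOn S Δᶜ := fun f hf => by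
      rw [hSf]
      exact EulerMaclaurin.remainder_eq_zero hΔ hu hξ ε hm f.contDiff f.hasCompactSupport hf
    -- The support is an intersection of closed sets off which the distribution vanishes, and Δ,
    -- being compact, is one of them.
    exact ⟨S, hSf, hvan, Set.sInter_subset_of_mem
      ⟨hvan, hΔ.polytope.isCompact.isClosed⟩⟩
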